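/- Setting. Let $r\ge 2$ be an integer, $\alpha\in(0,1]$, and let $\Omega\subset\mathbb R^p$ be a bounded domain. Let $X_0,X_1,\dots,X_n$ be vector fields on $\Omega$, where $X_0$ has weight $p_0=2$ and $X_1,\dots,X_n$ have weight $p_i=1$; the coefficients of $X_i$ belong to $C^{r-p_i,\alpha}(\Omega)$ (all derivatives of order at most $r-p_i$ exist and are bounded and Hölder continuous of exponent $\alpha$ on $\Omega$). For a multi-index $I=(i_1,\dots,i_k)$, $k\ge 1$, put $|I|=p_{i_1}+\dots+p_{i_k}$ and $X_{[I]}=[X_{i_1},[X_{i_2},\dots[X_{i_{k-1}},X_{i_k}]\dots]]$. Assume that the vectors $(X_{[I]})_x$, $|I|\le r$, span $\mathbb R^p$ at every $x\in\Omega$, and that the fields are free up to weight $r$ at every $x\in\Omega$: if $\sum_{|I|\le r}a_I(X_{[I]})_x=0$ with constants $a_I$, then $\sum_{|I|\le r}a_IA_{IJ}=0$ for all $J$, where $A_{IJ}$ is the coefficient of the monomial $\xi_J=\xi_{j_1}\cdots\xi_{j_l}$ in the commutator $\xi_{[I]}$ of free noncommuting variables $\xi_0,\dots,\xi_n$. Let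 $B$ be a set of multi-indices of weight at most $r$ such that $\{(X_{[I]})_x\}_{I\in B}$ is a basis of $\mathbb R^p$ at some $x\in\Omega$ (equivalently, by freeness, at every $x\in\Omega$). Write $u=(u_I)_{I\in B}$ for the points of $\mathbb R^B\cong\mathbb R^p$, $\|u\|=\sum_{J\in B}|u_J|^{1/|J|}$ and $\delta_\lambda u=(\lambda^{|I|}u_I)_{I\in B}$. For $y\in\Omega$ let $S_i^y$ be the polynomial vector field obtained from $X_i$ by replacing its coefficients by their Taylor polynomials of order $r-p_i$ centered at $y$, and let $E(u,y)=\exp\big(\sum_{I\in B}u_IS^y_{[I]}\big)(y)$. Theorem. There are a Lie group operation on $\mathbb R^B$, with identity $0$, inverse $u^{-1}=-u$ and automorphisms $\delta_\lambda$ $(\lambda>0)$, and smooth vector fields $Y_0,\dots,Y_n$ on $\mathbb R^B$ which are free up to weight $r$ at every point, such that the $Y_{[I]}$, $|I|\le r$, span $\mathbb R^B$ at every point, every $Y_{[I]}$ is left invariant and homogeneous of degree $|I|$, $(Y_{[I]})_0=\partial_{u_I}$ for $I\in B$, and $\sum_{I\in B}u_IY_{[I]}=\sum_{I\in B}u_I\partial_{u_I}$,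 for which the following holds. For every $x_0\in\Omega$ there are an open neighborhood $W\subset\Omega$ of $x_0$, an open neighborhood $U$ of $0$ in $\mathbb R^B$, a constant $C$ and, for every $y\in W$, a smooth diffeomorphism $\Theta_y$ from an open set $N_y$ with $W\subset N_y\subset\Omega$ onto $U$, with $\Theta_y(y)=0$ and $\Theta_y^{-1}(u)=E(u,y)$ for $u\in U$, and vector fields $R_{y,[I]}$ $(|I|\le r)$ on $U$ such that: (a) for all $x,y,y'\in W$, $$|\Theta_y(x)-\Theta_{y'}(x)|\le C|y-y'|^\alpha,\qquad \Big\|\frac{\partial\Theta_y}{\partial x}(x)-\frac{\partial\Theta_{y'}}{\partial x}(x)\Big\|\le C|y-y'|^\alpha;$$ (b) for every $y\in W$ and $|I|\le r$, the field $X_{[I]}$ expressed in the coordinates $u=\Theta_y(x)$ is $X_{[I]}^u=Y_{[I]}+R_{y,[I]}$ on $U$; equivalently, for every differentiable $f:U\to\mathbb R$ and every $x\in N_y$, $$X_{[I]}\big(f\circ\Theta_y\big)(x)=\big(Y_{[I]}f+R_{y,[I]}f\big)(\Theta_y(x));$$ (c) for every $y\in W$ and $|I|\le r$, $R_{y,[I]}$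 is of class $C^{r-|I|,\alpha}$ on $U$, with all derivatives of order at most $r-|I|$ bounded by $C$ and Hölder continuous of exponent $\alpha$ with constant $C$, and it has weight $\ge\alpha-|I|$: writing $R_{y,[I]}=\sum_{J\in B}c_J(u)\partial_{u_J}$, one has $|c_J(u)|\le C\|u\|^{\alpha-|I|+|J|}$ for $u\in U$ (no condition at $u=0$ if the exponent is negative); (d) $R_{y,[I]}$ depends on $y$ in a $C^\alpha$ way: for $|I|\le r$ and all $x,y,y'\in W$, $$\big|R_{y,[I]}(\Theta_y(x))-R_{y',[I]}(\Theta_{y'}(x))\big|\le C|y-y'|^\alpha;$$ moreover, at a fixed point $u\in U$, for $y,y'\in W$, $|R_{y,[I]}(u)-R_{y',[I]}(u)|\le C|y-y'|^{\alpha}$ if $|I|<r$, and $\le C|y-y'|^{\alpha^2}$ if $|I|=r$. -/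

import Mathlib

open scoped ContDiff

noncomputable section

namespace WeightedFields

/-! ### Multi-indices, weights, iterated commutators -/

/-- The weight of the `i`-th field: `2` for `i = 0` and `1` for `i = 1, …, n`. -/
def fieldWeight {n : ℕ} (i : Fin (n + 1)) : ℕ := if i = 0 then 2 else 1

/-- The weight `|I|` of a multi-index `I = (i₁, …, i_k)`, the sum of the weights of its entries. -/
def weight {n : ℕ} (I : List (Fin (n + 1))) : ℕ := (I.map fieldWeight).sum

/-- The (nonempty) multi-indices of weight at most `s`. -/
def multiindices (n s : ℕ) : Set (List (Fin (n + 1))) := {I | I ≠ [] ∧ weight I ≤ s}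

/-- The iterated commutator `X_[I] = [X_{i₁}, [X_{i₂}, … [X_{i_{k-1}}, X_{i_k}] …]]`.
The value at the empty list is irrelevant. -/
def bracket {ι E : Type*} [NormedAddCommGroup E] [NormedSpace ℝ E] (X : ι → E → E) :
    List ι → E → E
  | [] => 0
  | [i] => X i
  | i :: j :: J => VectorField.lieBracket ℝ (X i) (bracket X (j :: J))

/-- The iterated commutator `ξ_[I]` of the free noncommuting variables `ξ_i`. -/
def freeBracket {ι : Type*} : List ι → FreeAlgebra ℝ ι
  | [] => 0
  | [i] => FreeAlgebra.ι ℝ i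
  | i :: j :: J =>
      FreeAlgebra.ι ℝ i * freeBracket (j :: J) - freeBracket (j :: J) * FreeAlgebra.ι ℝ i

/-- The universal constants `A_{IJ}` of the formal expansion `X_[I] = ∑_J A_{IJ} X_J`,
that is, the coefficient of the monomial `ξ_J` in `ξ_[I]`. -/
def structConst {ι : Type*} (I J : List ι) : ℝ :=
  (FreeAlgebra.equivMonoidAlgebraFreeMonoid (freeBracket I)).coeff (FreeMonoid.ofList J)

/-- The fields `X₀, …, X_n` are free up to weight `s` at the point `x`. -/
def IsFreeAt {n : ℕ} {E : Type*} [NormedAddCommGroup E] [NormedSpace ℝ E]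
    (X : Fin (n + 1) → E → E) (s : ℕ) (x : E) : Prop :=
  ∀ a : List (Fin (n + 1)) →₀ ℝ, (a.support : Set (List (Fin (n + 1)))) ⊆ multiindices n s →
    (a.sum fun I c => c • bracket X I x) = 0 →
      ∀ J, (a.sum fun I c => c * structConst I J) = 0

/-- A vector field `Z` acting on a function `f` as a differential operator. -/
def act {E : Type*} [NormedAddCommGroup E] [NormedSpace ℝ E] (Z : E → E) (f : E → ℝ) (x : E) : ℝ :=
  fderiv ℝ f x (Z x)

/-! ### Hölder classes -/

/-- `f` is of class `C^{k,α}` on the open set `s`, with constant `C`: all derivatives of order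
at most `k` exist, are continuous, bounded by `C`, and Hölder continuous of exponent `α`
with constant `C`. -/
def HolderClassWith {E F : Type*} [NormedAddCommGroup E] [NormedSpace ℝ E]
    [NormedAddCommGroup F] [NormedSpace ℝ F]
    (C : ℝ) (k : ℕ) (α : ℝ) (s : Set E) (f : E → F) : Prop :=
  ContDiffOn ℝ k f s ∧ ∀ m ≤ k,
    (∀ x ∈ s, ‖iteratedFDeriv ℝ m f x‖ ≤ C) ∧
    ∀ x ∈ s, ∀ y ∈ s, ‖iteratedFDeriv ℝ m f x - iteratedFDeriv ℝ m f y‖ ≤ C * ‖x - y‖ ^ α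

/-- The space `C^{k,α}(s)`, for an open set `s`. -/
def HolderClass {E F : Type*} [NormedAddCommGroup E] [NormedSpace ℝ E]
    [NormedAddCommGroup F] [NormedSpace ℝ F]
    (k : ℕ) (α : ℝ) (s : Set E) (f : E → F) : Prop :=
  ∃ C, HolderClassWith C k α s f

/-! ### Regularized canonical coordinates -/

/-- The Taylor polynomial of `f` of order `k` centered at `y`. -/
def taylorPoly {E F : Type*} [NormedAddCommGroup E] [NormedSpace ℝ E]
    [NormedAddCommGroup F] [NormedSpace ℝ F] (k : ℕ) (f : E → F) (y x : E) : F :=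
  ∑ m ∈ Finset.range (k + 1),
    ((m.factorial : ℝ)⁻¹) • iteratedFDeriv ℝ m f y (fun _ => x - y)

/-- The smooth approximating fields `S_i^y`: the coefficients of `X_i` are replaced by their
Taylor polynomials of order `r - p_i` centered at `y`, where `p_i` is the weight of `X_i`. -/
def approxField {n : ℕ} {E : Type*} [NormedAddCommGroup E] [NormedSpace ℝ E]
    (r : ℕ) (X : Fin (n + 1) → E → E) (y : E) (i : Fin (n + 1)) : E → E :=
  taylorPoly (r - fieldWeight i) (X i) y

/-- `x' = exp(Z)(x)`: there is an integral curve of `Z` from `x` at time `0` to `x'` at time `1`. -/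
def IsExp {E : Type*} [NormedAddCommGroup E] [NormedSpace ℝ E] (Z : E → E) (x x' : E) : Prop :=
  ∃ γ : ℝ → E, γ 0 = x ∧ γ 1 = x' ∧
    ∀ t ∈ Set.Icc (0 : ℝ) 1, HasDerivWithinAt γ (Z (γ t)) (Set.Icc 0 1) t

/-- The field `∑_{I ∈ B} u_I X_[I]`. -/
def combination {n : ℕ} {E : Type*} [NormedAddCommGroup E] [NormedSpace ℝ E]
    (X : Fin (n + 1) → E → E) (B : Finset (List (Fin (n + 1)))) (u : EuclideanSpace ℝ B)
    (x : E) : E :=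
  ∑ I : B, u I • bracket X I x

/-- The vector field `Z` expressed in the coordinates `u = Θ(x)`. -/
def inCoords {E F : Type*} [NormedAddCommGroup E] [NormedSpace ℝ E]
    [NormedAddCommGroup F] [NormedSpace ℝ F]
    (Θ : OpenPartialHomeomorph E F) (Z : E → E) (u : F) : F :=
  fderiv ℝ Θ (Θ.symm u) (Z (Θ.symm u))

/-! ### Homogeneous structure on `ℝ^B` -/

/-- The homogeneous norm `‖u‖ = ∑_{J ∈ B} |u_J|^{1/|J|}`. -/
def homNorm {n : ℕ} {B : Finset (List (Fin (n + 1)))} (u : EuclideanSpace ℝ B) : ℝ :=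
  ∑ J : B, |u J| ^ (1 / (weight (J : List (Fin (n + 1))) : ℝ))

/-- On `U`, the components of `Z = ∑_J c_J(u) ∂_{u_J}` satisfy `|c_J(u)| ≤ C ‖u‖^{k + |J|}`
(weight `≥ k`). At `u = 0` nothing is required when the exponent is negative, since the
right-hand side is then infinite. -/
def HasWeightGEWith {n : ℕ} {B : Finset (List (Fin (n + 1)))} (C k : ℝ)
    (U : Set (EuclideanSpace ℝ B)) (Z : EuclideanSpace ℝ B → EuclideanSpace ℝ B) : Prop :=
  ∀ u ∈ U, ∀ J : B, (u ≠ 0 ∨ 0 ≤ k + weight (J : List (Fin (n + 1)))) →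
    |Z u J| ≤ C * homNorm u ^ (k + weight (J : List (Fin (n + 1))))

/-- The dilation `δ_t (u_I)_I = (t^{|I|} u_I)_I`. -/
def dilation {n : ℕ} {B : Finset (List (Fin (n + 1)))} (t : ℝ) (u : EuclideanSpace ℝ B) :
    EuclideanSpace ℝ B :=
  WithLp.toLp 2 fun I : B => t ^ weight (I : List (Fin (n + 1))) * u I

/-- `mul` is a Lie group operation on `ℝ^B` with identity `0`, in which the inverse of `u` is `-u`,
and the dilations `δ_t`, `t > 0`, are automorphisms of it. -/
structure IsHomogeneousGroup {n : ℕ} {B : Finset (List (Fin (n + 1)))}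
    (mul : EuclideanSpace ℝ B → EuclideanSpace ℝ B → EuclideanSpace ℝ B) : Prop where
  smooth : ContDiff ℝ ∞ fun q : EuclideanSpace ℝ B × EuclideanSpace ℝ B => mul q.1 q.2
  assoc : ∀ u v w, mul (mul u v) w = mul u (mul v w)
  zero_mul : ∀ u, mul 0 u = u
  mul_zero : ∀ u, mul u 0 = u
  neg_mul : ∀ u, mul (-u) u = 0
  mul_neg : ∀ u, mul u (-u) = 0
  dilation_mul : ∀ t : ℝ, 0 < t → ∀ u v, dilation t (mul u v) = mul (dilation t u) (dilation t v)

/-- `Z` is left invariant for the group operation `mul`. -/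
def IsLeftInvariant {F : Type*} [NormedAddCommGroup F] [NormedSpace ℝ F]
    (mul : F → F → F) (Z : F → F) : Prop :=
  ∀ g u, Z (mul g u) = fderiv ℝ (mul g) u (Z u)

/-- `Z` is homogeneous of degree `k` as a differential operator:
`Z (f ∘ δ_t) = t^k (Z f) ∘ δ_t` for all smooth `f` and all `t > 0`. -/
def IsHomogeneousField {n : ℕ} {B : Finset (List (Fin (n + 1)))} (k : ℕ)
    (Z : EuclideanSpace ℝ B → EuclideanSpace ℝ B) : Prop :=
  ∀ f : EuclideanSpace ℝ B → ℝ, ContDiff ℝ ∞ f → ∀ t : ℝ, 0 < t → ∀ u,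
    act Z (f ∘ dilation t) u = t ^ k * act Z f (dilation t u)

/-- `(ℝ^B, mul)` is the free nilpotent homogeneous group of weight `r`, written in the exponential
coordinates given by `B`, and `Y₀, …, Y_n` are its canonical left invariant generators. -/
structure IsFreeModel {n : ℕ} (r : ℕ) (B : Finset (List (Fin (n + 1))))
    (mul : EuclideanSpace ℝ B → EuclideanSpace ℝ B → EuclideanSpace ℝ B)
    (Y : Fin (n + 1) → EuclideanSpace ℝ B → EuclideanSpace ℝ B) : Prop where
  group : IsHomogeneousGroup mul
  smooth : ∀ i, ContDiff ℝ ∞ (Y i)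
  free : ∀ u, IsFreeAt Y r u
  span : ∀ u, Submodule.span ℝ ((fun I => bracket Y I u) '' multiindices n r) = ⊤
  leftInvariant : ∀ I, I ≠ [] → IsLeftInvariant mul (bracket Y I)
  homogeneous : ∀ I, I ≠ [] → IsHomogeneousField (weight I) (bracket Y I)
  at_zero : ∀ I : B, bracket Y I 0 = EuclideanSpace.single I 1
  euler : ∀ u, combination Y B u u = u

end WeightedFields

end

open scoped ContDiff

noncomputable section

namespace WeightedFields

open Filter Topology

/-! ### Commutators in the free algebra -/

section FreeAlgebra

variable {n : ℕ}

/-! The fields have limited smoothness, but at each base point `y` they are compared with polynomial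
fields `S^y`, for which every identity between commutators in the free algebra is available.
Freeness at one point turns `B` into a graded basis of the commutators of weight at most `r` in the
free algebra (`isFreeBasis_of_isFreeAt`), so all structure constants are universal and respect
weights.

The model. The free algebra acts on words of weight at most `r` by nilpotent matrices, and this
action is faithful on commutators of weight at most `r`. The span of the images of the `ξ_[I]`, `I ∈
B`, is a Lie algebra, and by the Campbell–Hausdorff theorem (`IsNilFiltration.truncLog_mul_mem`) the
logarithm of a product of exponentials stays in it. This gives the group law on `ℝ^B`; the `Y_i` are
the left invariant fields of the generators (`IsFreeBasis.exists_isFreeModel`).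

The charts. The field `S^y` depends on `y` only through the jet `q(y)` of the coefficients, a point
of a finite dimensional space. The exponential map `Ex (u, q)` is jointly smooth in `u` and the jet
`q`: integral curves are zeros of a smooth map on a space of continuous curves
(`exists_smooth_flow`, `exists_smooth_exp`). The inverse function theorem for `(u, q) ↦ (Ex (u, q),
q)` inverts all of them at once on a ball of fixed radius (`exists_chart_family`). Since `y ↦ q(y)`
is only `C^α`, every Lipschitz dependence on `q` becomes Hölder dependence on `y`.

The remainder splits as `R = M (X_[I] - S^y_[I]) + (S^y_[I] in coordinates - Y_[I])`, with `M` the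
differential of the chart. The first term is of order `r - |I| + α` at `y` by Taylor's formula,
carried through commutators (`exists_flatWith_bracket_sub`). The second has weight at least `1 -
|I|`: in exponential coordinates both frames satisfy `∑ u_J v_J = u`, take the same values at the
origin and have the same structure constants up to weight `r`. Differentiating the first relation
along the frame gives an ordinary differential equation along rays, and an induction on the order of
vanishing compares its solutions (`exists_frame_comparison`).

At a fixed `x`, the remainder is the differential of the chart applied to the fixed vector
`X_[I](x)`, minus `Y_[I]` at the image, so it is `C^α` in `y`. At a fixed `u` the point `Ex (u,
q(y))` moves like `|y - y'|^α`, and for `|I| = r` the field is only `C^α` there, whence the exponent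
`α²`. -/

lemma fieldWeight_pos (i : Fin (n + 1)) : 1 ≤ fieldWeight i := by
  unfold fieldWeight; split_ifs <;> simp

@[simp] lemma weight_nil : weight ([] : List (Fin (n + 1))) = 0 := rfl

@[simp] lemma weight_cons (i : Fin (n + 1)) (J : List (Fin (n + 1))) :
    weight (i :: J) = fieldWeight i + weight J := by simp [weight]

lemma length_le_weight (I : List (Fin (n + 1))) : I.length ≤ weight I := by
  induction I with
  | nil => simp
  | cons i J ih => have := fieldWeight_pos i; simp; omega

lemma weight_pos {I : List (Fin (n + 1))} (hI : I ≠ []) : 1 ≤ weight I :=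
  le_trans (List.length_pos_of_ne_nil hI) (length_le_weight I)

lemma finite_weight_le (n s : ℕ) : {I : List (Fin (n + 1)) | weight I ≤ s}.Finite :=
  (List.finite_length_le (Fin (n + 1)) s).subset fun I hI => (length_le_weight I).trans hI

lemma finite_multiindices (n s : ℕ) : (multiindices n s).Finite :=
  (finite_weight_le n s).subset fun _ hI => hI.2

lemma freeBracket_cons {ι : Type*} (i : ι) {J : List ι} (hJ : J ≠ []) :
    freeBracket (i :: J) =
      FreeAlgebra.ι ℝ i * freeBracket J - freeBracket J * FreeAlgebra.ι ℝ i := by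
  cases J with
  | nil => exact absurd rfl hJ
  | cons j J => rfl

lemma bracket_cons {ι E : Type*} [NormedAddCommGroup E] [NormedSpace ℝ E] (X : ι → E → E) (i : ι)
    {J : List ι} (hJ : J ≠ []) :
    bracket X (i :: J) = VectorField.lieBracket ℝ (X i) (bracket X J) := by
  cases J with
  | nil => exact absurd rfl hJ
  | cons j J => rfl

/-- Induction on nonempty lists. -/
lemma nonempty_list_induction {ι : Type*} {P : List ι → Prop} (h1 : ∀ i, P [i])
    (h2 : ∀ i J, J ≠ [] → P J → P (i :: J)) : ∀ I, I ≠ [] → P I := by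
  intro I
  induction I with
  | nil => intro h; exact absurd rfl h
  | cons i J ih =>
    intro _
    rcases eq_or_ne J [] with rfl | hJ
    · exact h1 i
    · exact h2 i J hJ (ih hJ)

/-- The dilation of the free algebra that multiplies `ξ_i` by `t ^ p_i`. -/
def freeDilation (n : ℕ) (t : ℝ) :
    FreeAlgebra ℝ (Fin (n + 1)) →ₐ[ℝ] FreeAlgebra ℝ (Fin (n + 1)) :=
  FreeAlgebra.lift ℝ fun i => t ^ fieldWeight i • FreeAlgebra.ι ℝ i

/-- Commutators are eigenvectors of the dilations. Comparing eigenvalues at `t = 2` is what later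
separates different weights. -/
lemma freeDilation_freeBracket (t : ℝ) (I : List (Fin (n + 1))) :
    freeDilation n t (freeBracket I) = t ^ weight I • freeBracket I := by
  rcases eq_or_ne I [] with rfl | hI
  · simp [freeBracket]
  · refine nonempty_list_induction (P := fun I => freeDilation n t (freeBracket I) =
      t ^ weight I • freeBracket I) ?_ ?_ I hI
    · intro i; simp [freeBracket, freeDilation]
    · intro i J hJ ih
      rw [freeBracket_cons i hJ, map_sub, map_mul, map_mul, ih]
      simp only [freeDilation, FreeAlgebra.lift_ι_apply, weight_cons, smul_mul_smul_comm, smul_sub,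
        pow_add]
      rw [mul_comm (t ^ weight J)]

/-- The Jacobi identity `[[i, J], I] = [i, [J, I]] - [J, [i, I]]` allows induction on `J`. Hence
right-nested commutators already span a Lie algebra, graded by weight. -/
lemma commutator_freeBracket_mem (J I : List (Fin (n + 1))) (hJ : J ≠ []) (hI : I ≠ []) :
    freeBracket J * freeBracket I - freeBracket I * freeBracket J ∈
      Submodule.span ℝ (freeBracket '' {L : List (Fin (n + 1)) |
        L ≠ [] ∧ weight L = weight J + weight I}) := by
  refine nonempty_list_induction (P := fun J => ∀ I : List (Fin (n + 1)), I ≠ [] →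
    freeBracket J * freeBracket I - freeBracket I * freeBracket J ∈
      Submodule.span ℝ (freeBracket '' {L : List (Fin (n + 1)) |
        L ≠ [] ∧ weight L = weight J + weight I})) ?_ ?_ J hJ I hI
  · intro i I hI
    refine Submodule.subset_span ⟨i :: I, ⟨by simp, by simp⟩, ?_⟩
    rw [freeBracket_cons i hI]; rfl
  · intro i J hJ ih I hI
    have key : freeBracket (i :: J) * freeBracket I - freeBracket I * freeBracket (i :: J) =
        (FreeAlgebra.ι ℝ i * (freeBracket J * freeBracket I - freeBracket I * freeBracket J) -
          (freeBracket J * freeBracket I - freeBracket I * freeBracket J) * FreeAlgebra.ι ℝ i) -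
        (freeBracket J * freeBracket (i :: I) - freeBracket (i :: I) * freeBracket J) := by
      rw [freeBracket_cons i hJ, freeBracket_cons i hI]; noncomm_ring
    rw [key]
    refine Submodule.sub_mem _ ?_ ?_
    · have h := ih I hI
      generalize freeBracket J * freeBracket I - freeBracket I * freeBracket J = z at h ⊢
      induction h using Submodule.span_induction with
      | mem x hx =>
        obtain ⟨L, ⟨hL, hw⟩, rfl⟩ := hx
        refine Submodule.subset_span ⟨i :: L, ⟨by simp, by simp [hw, add_assoc]⟩, ?_⟩
        rw [freeBracket_cons i hL]
      | zero => simp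
      | add x y _ _ hx hy =>
        convert Submodule.add_mem _ hx hy using 1; noncomm_ring
      | smul a x _ hx =>
        convert Submodule.smul_mem _ a hx using 1
        simp [smul_sub]
    · have h := ih (i :: I) (by simp)
      have e : weight J + weight (i :: I) = weight (i :: J) + weight I := by simp; omega
      rwa [e] at h

/-- The coefficient of the monomial `ξ_J`. -/
def freeCoeff (J : List (Fin (n + 1))) : FreeAlgebra ℝ (Fin (n + 1)) →ₗ[ℝ] ℝ :=
  (Finsupp.lapply (FreeMonoid.ofList J)).comp
    ((MonoidAlgebra.coeffLinearEquiv ℝ).toLinearMap.comp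
      FreeAlgebra.equivMonoidAlgebraFreeMonoid.toLinearMap)

lemma freeCoeff_freeBracket (I J : List (Fin (n + 1))) :
    freeCoeff J (freeBracket I) = structConst I J := rfl

lemma eq_zero_of_freeCoeff {z : FreeAlgebra ℝ (Fin (n + 1))} (h : ∀ J, freeCoeff J z = 0) :
    z = 0 := by
  apply FreeAlgebra.equivMonoidAlgebraFreeMonoid.injective
  rw [map_zero]
  ext m
  exact h (FreeMonoid.toList m)

/-- Monomials form a basis of the free algebra, so the conclusion in the definition of freeness is a
linear relation between the `ξ_[I]` themselves. -/
lemma sum_structConst_eq_zero_iff (a : List (Fin (n + 1)) →₀ ℝ) :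
    (∀ J, (a.sum fun I c => c * structConst I J) = 0) ↔
      (a.sum fun I c => c • freeBracket I) = 0 := by
  have e : ∀ J, freeCoeff J (a.sum fun I c => c • freeBracket I) =
      a.sum fun I c => c * structConst I J := by
    intro J
    simp [Finsupp.sum, map_sum, freeCoeff_freeBracket]
  constructor
  · intro h
    exact eq_zero_of_freeCoeff fun J => by rw [e, h]
  · intro h J
    rw [← e, h, map_zero]

/-- The commutators `ξ_[I]`, `I ∈ B`, form a basis of the span of all `ξ_[I]` of weight at most
`r`, compatible with the grading. -/
structure IsFreeBasis (r : ℕ) (B : Finset (List (Fin (n + 1)))) : Prop where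
  subset : (B : Set (List (Fin (n + 1)))) ⊆ multiindices n r
  linearIndependent : LinearIndependent ℝ fun I : B => freeBracket (I : List (Fin (n + 1)))
  expansion : ∀ I ∈ multiindices n r, ∃ c : B → ℝ,
    freeBracket I = ∑ K : B, c K • freeBracket (K : List (Fin (n + 1))) ∧
      ∀ K : B, weight (K : List (Fin (n + 1))) ≠ weight I → c K = 0

/-- The grading comes for free: dilating an expansion of `ξ_[I]` by `2` and subtracting `2^|I|`
times the original gives a relation with coefficients `(2^|I| - 2^|K|) c_K`, which vanish by linear
independence. -/
lemma IsFreeBasis.of_mem_span {r : ℕ} {B : Finset (List (Fin (n + 1)))}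
    (hB : (B : Set (List (Fin (n + 1)))) ⊆ multiindices n r)
    (hli : LinearIndependent ℝ fun I : B => freeBracket (I : List (Fin (n + 1))))
    (hspan : ∀ I ∈ multiindices n r, ∃ c : B → ℝ,
      freeBracket I = ∑ K : B, c K • freeBracket (K : List (Fin (n + 1)))) :
    IsFreeBasis r B := by
  refine ⟨hB, hli, fun I hI => ?_⟩
  obtain ⟨c, hc⟩ := hspan I hI
  refine ⟨c, hc, fun K hK => ?_⟩
  have h1 := congrArg (freeDilation n 2) hc
  rw [freeDilation_freeBracket, map_sum] at h1
  simp only [map_smul, freeDilation_freeBracket] at h1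
  rw [hc, Finset.smul_sum, ← sub_eq_zero, ← Finset.sum_sub_distrib] at h1
  have h2 : ∑ K : B, (((2 : ℝ) ^ weight I - 2 ^ weight (K : List (Fin (n + 1)))) * c K) •
      freeBracket (K : List (Fin (n + 1))) = 0 := by
    rw [← h1]
    refine Finset.sum_congr rfl fun K _ => ?_
    rw [smul_smul, smul_smul, ← sub_smul]; congr 1; ring
  have h3 := Fintype.linearIndependent_iff.1 hli _ h2 K
  rcases mul_eq_zero.1 h3 with h | h
  · exact absurd (pow_right_injective₀ (by norm_num : (0:ℝ) < 2) (by norm_num)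
      (sub_eq_zero.1 h)).symm hK
  · exact h

lemma IsFreeBasis.mem {r : ℕ} {B : Finset (List (Fin (n + 1)))} (hB : IsFreeBasis r B) (I : B) :
    (I : List (Fin (n + 1))) ∈ multiindices n r := hB.subset I.2

lemma IsFreeBasis.weight_pos {r : ℕ} {B : Finset (List (Fin (n + 1)))} (hB : IsFreeBasis r B)
    (I : B) : 1 ≤ weight (I : List (Fin (n + 1))) := WeightedFields.weight_pos (hB.mem I).1

lemma IsFreeBasis.weight_le {r : ℕ} {B : Finset (List (Fin (n + 1)))} (hB : IsFreeBasis r B)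
    (I : B) : weight (I : List (Fin (n + 1))) ≤ r := (hB.mem I).2

lemma IsFreeBasis.commutator {r : ℕ} {B : Finset (List (Fin (n + 1)))} (hB : IsFreeBasis r B)
    {J I : List (Fin (n + 1))} (hJ : J ≠ []) (hI : I ≠ []) (h : weight J + weight I ≤ r) :
    ∃ c : B → ℝ, freeBracket J * freeBracket I - freeBracket I * freeBracket J =
      ∑ K : B, c K • freeBracket (K : List (Fin (n + 1))) ∧
      ∀ K : B, weight (K : List (Fin (n + 1))) ≠ weight J + weight I → c K = 0 := by
  have key := commutator_freeBracket_mem J I hJ hI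
  generalize freeBracket J * freeBracket I - freeBracket I * freeBracket J = z at key ⊢
  induction key using Submodule.span_induction with
  | mem x hx =>
    obtain ⟨L, ⟨hL, hw⟩, rfl⟩ := hx
    obtain ⟨c, hc, hc'⟩ := hB.expansion L ⟨hL, hw.trans_le h⟩
    exact ⟨c, hc, fun K hK => hc' K (by rwa [hw])⟩
  | zero => exact ⟨0, by simp, by simp⟩
  | add x y _ _ hx hy =>
    obtain ⟨c, hc, hc'⟩ := hx
    obtain ⟨d, hd, hd'⟩ := hy
    refine ⟨c + d, ?_, fun K hK => by simp [hc' K hK, hd' K hK]⟩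
    simp [hc, hd, add_smul, Finset.sum_add_distrib]
  | smul a x _ hx =>
    obtain ⟨c, hc, hc'⟩ := hx
    refine ⟨a • c, ?_, fun K hK => by simp [hc' K hK]⟩
    simp [hc, Finset.smul_sum, smul_smul]

end FreeAlgebra

/-! ### Smooth fields as differential operators -/

section SmoothFields

variable {ι E : Type*} [NormedAddCommGroup E] [NormedSpace ℝ E]

lemma two_le_infty : (2 : WithTop ℕ∞) ≤ ∞ := WithTop.coe_le_coe.2 (le_top : (2 : ℕ∞) ≤ ⊤)

/-- The smooth functions on `E`. -/
def smoothFunctions (E : Type*) [NormedAddCommGroup E] [NormedSpace ℝ E] : Submodule ℝ (E → ℝ) where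
  carrier := {f | ContDiff ℝ ∞ f}
  add_mem' := fun {f g} (hf : ContDiff ℝ ∞ f) (hg : ContDiff ℝ ∞ g) => hf.add hg
  zero_mem' := show ContDiff ℝ ∞ (fun _ : E => (0 : ℝ)) from contDiff_const
  smul_mem' := fun c f (hf : ContDiff ℝ ∞ f) => hf.const_smul c

lemma mem_smoothFunctions {f : E → ℝ} : f ∈ smoothFunctions E ↔ ContDiff ℝ ∞ f := Iff.rfl

lemma contDiff_act {Z : E → E} {f : E → ℝ} (hZ : ContDiff ℝ ∞ Z) (hf : ContDiff ℝ ∞ f) :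
    ContDiff ℝ ∞ (act Z f) :=
  (hf.fderiv_right (m := ∞) (by simp)).clm_apply hZ

/-- A smooth field as an endomorphism of the space of smooth functions. -/
def actLinear (Z : E → E) (hZ : ContDiff ℝ ∞ Z) : Module.End ℝ (smoothFunctions E) where
  toFun f := ⟨act Z f, contDiff_act hZ (mem_smoothFunctions.1 f.2)⟩
  map_add' f g := by
    ext x
    have hf : DifferentiableAt ℝ (f : E → ℝ) x := (mem_smoothFunctions.1 f.2).differentiable (by simp) x
    have hg : DifferentiableAt ℝ (g : E → ℝ) x := (mem_smoothFunctions.1 g.2).differentiable (by simp) x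
    simp [act, fderiv_add hf hg]
  map_smul' c f := by
    ext x
    have hf : DifferentiableAt ℝ (f : E → ℝ) x := (mem_smoothFunctions.1 f.2).differentiable (by simp) x
    simp [act, fderiv_const_smul hf]

lemma contDiff_bracket {X : ι → E → E} (hX : ∀ i, ContDiff ℝ ∞ (X i)) (I : List ι) :
    ContDiff ℝ ∞ (bracket X I) := by
  rcases eq_or_ne I [] with rfl | hI
  · exact contDiff_const (c := (0 : E))
  · refine nonempty_list_induction (P := fun I => ContDiff ℝ ∞ (bracket X I)) hX ?_ I hI
    intro i J hJ ih
    rw [bracket_cons X i hJ]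
    exact (hX i).lieBracket_vectorField ih (by simp)

/-- `z` acts on smooth functions as the field `Z` when `ξ_i` acts as `X_i`. -/
def Represents {X : ι → E → E} (hX : ∀ i, ContDiff ℝ ∞ (X i)) (z : FreeAlgebra ℝ ι) (Z : E → E) :
    Prop :=
  ContDiff ℝ ∞ Z ∧ ∀ f : smoothFunctions E, ∀ x,
    (FreeAlgebra.lift ℝ (fun i => actLinear (X i) (hX i)) z f : E → ℝ) x = act Z f x

variable {X : ι → E → E} (hX : ∀ i, ContDiff ℝ ∞ (X i))

/-- The Lie bracket of two fields acts on functions as the commutator of the two operators.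
Relations in the free algebra can thus be transported to brackets of smooth fields. -/
lemma Represents.commutator {z w : FreeAlgebra ℝ ι} {Z V : E → E} (hz : Represents hX z Z)
    (hw : Represents hX w V) : Represents hX (z * w - w * z) (VectorField.lieBracket ℝ Z V) := by
  refine ⟨hz.1.lieBracket_vectorField hw.1 (by simp), fun f x => ?_⟩
  have hf : ContDiff ℝ ∞ (f : E → ℝ) := f.2
  have h1 : ((FreeAlgebra.lift ℝ (fun i => actLinear (X i) (hX i)) w f : smoothFunctions E) :
    E → ℝ) = act V f := funext (hw.2 f)
  have h2 : ((FreeAlgebra.lift ℝ (fun i => actLinear (X i) (hX i)) z f : smoothFunctions E) :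
    E → ℝ) = act Z f := funext (hz.2 f)
  simp only [map_sub, map_mul, LinearMap.sub_apply, Module.End.mul_apply, Submodule.coe_sub,
    Pi.sub_apply]
  rw [hz.2, hw.2, h1, h2]
  exact (VectorField.fderiv_apply_lieBracket (n := ∞) hf.contDiffAt
    (by rw [minSmoothness_of_isRCLikeNormedField]; exact two_le_infty)
    (hw.1.differentiable (by simp) x) (hz.1.differentiable (by simp) x)).symm

lemma represents_freeBracket {I : List ι} (hI : I ≠ []) :
    Represents hX (freeBracket I) (bracket X I) := by
  have h1 : ∀ i, Represents hX (FreeAlgebra.ι ℝ i) (X i) := fun i =>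
    ⟨hX i, fun f x => by rw [FreeAlgebra.lift_ι_apply]; rfl⟩
  refine nonempty_list_induction (P := fun I => Represents hX (freeBracket I) (bracket X I))
    h1 ?_ I hI
  intro i J hJ ih
  rw [freeBracket_cons i hJ, bracket_cons X i hJ]
  exact (h1 i).commutator hX ih

lemma Represents.sum {κ : Type*} (s : Finset κ) {z : κ → FreeAlgebra ℝ ι} {Z : κ → E → E}
    (c : κ → ℝ) (h : ∀ k ∈ s, Represents hX (z k) (Z k)) :
    Represents hX (∑ k ∈ s, c k • z k) (fun x => ∑ k ∈ s, c k • Z k x) := by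
  refine ⟨ContDiff.sum fun k hk => contDiff_const.smul (h k hk).1, fun f x => ?_⟩
  rw [map_sum, LinearMap.sum_apply, Submodule.coe_sum, Finset.sum_apply]
  simp only [act, map_sum, map_smul]
  refine Finset.sum_congr rfl fun k hk => ?_
  simp only [LinearMap.smul_apply, Submodule.coe_smul, Pi.smul_apply, (h k hk).2 f x, act]

/-- Continuous linear functionals are smooth test functions and separate points, so the operator
determines the field. -/
lemma Represents.unique {z : FreeAlgebra ℝ ι} {Z V : E → E} (hZ : Represents hX z Z)
    (hV : Represents hX z V) : Z = V := by
  funext x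
  refine (SeparatingDual.eq_iff_forall_dual_eq (R := ℝ)).2 fun g => ?_
  have := (hZ.2 ⟨g, mem_smoothFunctions.2 g.contDiff⟩ x).symm.trans (hV.2 ⟨g, mem_smoothFunctions.2 g.contDiff⟩ x)
  simpa [act] using this

/-- Universal relations hold for smooth fields. They are applied to the polynomial fields `S^y` and
to the model fields; the given fields `X_i` are not smooth enough for this argument. -/
lemma bracket_eq_sum (hX : ∀ i, ContDiff ℝ ∞ (X i)) {κ : Type*} {s : Finset κ} {I : List ι} {K : κ → List ι} {c : κ → ℝ}
    (hI : I ≠ []) (hK : ∀ k ∈ s, K k ≠ [])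
    (h : freeBracket I = ∑ k ∈ s, c k • freeBracket (K k)) :
    bracket X I = fun x => ∑ k ∈ s, c k • bracket X (K k) x := by
  refine (represents_freeBracket hX hI).unique hX ?_
  rw [h]
  exact Represents.sum hX s c fun k hk => represents_freeBracket hX (hK k hk)

lemma lieBracket_bracket_eq_sum (hX : ∀ i, ContDiff ℝ ∞ (X i)) {κ : Type*} {s : Finset κ} {J I : List ι} {K : κ → List ι}
    {c : κ → ℝ} (hJ : J ≠ []) (hI : I ≠ []) (hK : ∀ k ∈ s, K k ≠ [])
    (h : freeBracket J * freeBracket I - freeBracket I * freeBracket J =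
      ∑ k ∈ s, c k • freeBracket (K k)) :
    VectorField.lieBracket ℝ (bracket X J) (bracket X I) =
      fun x => ∑ k ∈ s, c k • bracket X (K k) x := by
  refine ((represents_freeBracket hX hJ).commutator hX (represents_freeBracket hX hI)).unique hX ?_
  rw [h]
  exact Represents.sum hX s c fun k hk => represents_freeBracket hX (hK k hk)

lemma sum_bracket_eq_zero (hX : ∀ i, ContDiff ℝ ∞ (X i)) {κ : Type*} {s : Finset κ} {K : κ → List ι}
    {c : κ → ℝ} (hK : ∀ k ∈ s, K k ≠ []) (h : ∑ k ∈ s, c k • freeBracket (K k) = 0) (x : E) :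
    ∑ k ∈ s, c k • bracket X (K k) x = 0 := by
  have h1 := Represents.sum hX s c fun k hk => represents_freeBracket hX (hK k hk)
  rw [h] at h1
  have h0 : Represents hX (0 : FreeAlgebra ℝ ι) (fun _ : E => (0 : E)) :=
    ⟨contDiff_const, fun f x => by simp [act]⟩
  exact congrFun (h1.unique hX h0) x

end SmoothFields

/-! ### Exponential and logarithm in a nilpotent filtered algebra -/

section NilpotentExp

variable {𝔸 : Type*} [NormedRing 𝔸] [NormedAlgebra ℝ 𝔸]

/-- A decreasing multiplicative filtration of an algebra that terminates after `N` steps. -/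
structure IsNilFiltration (N : ℕ) (A : ℕ → Submodule ℝ 𝔸) : Prop where
  antitone : Antitone A
  mul_mem : ∀ {i j x y}, x ∈ A i → y ∈ A j → x * y ∈ A (i + j)
  one_mem : 1 ∈ A 0
  succ_eq : A (N + 1) = ⊥

/-- The exponential series truncated after degree `N`. -/
def truncExp (N : ℕ) (x : 𝔸) : 𝔸 :=
  ∑ k ∈ Finset.range (N + 1), (k.factorial : ℝ)⁻¹ • x ^ k

/-- The inverse of the truncated exponential on nilpotent elements, obtained by iteration. -/
def truncLog (N : ℕ) (x : 𝔸) : ℕ → 𝔸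
  | 0 => 0
  | j + 1 => x - (truncExp N (truncLog N x j) - 1 - truncLog N x j)

lemma contDiff_truncExp (N : ℕ) : ContDiff ℝ ∞ (truncExp N : 𝔸 → 𝔸) := by
  unfold truncExp
  fun_prop

lemma contDiff_truncLog (N j : ℕ) : ContDiff ℝ ∞ (fun x : 𝔸 => truncLog N x j) := by
  induction j with
  | zero => exact contDiff_const
  | succ j ih =>
    exact contDiff_id.sub ((((contDiff_truncExp N).comp ih).sub contDiff_const).sub ih)

lemma map_truncExp (N : ℕ) (φ : 𝔸 →ₐ[ℝ] 𝔸) (x : 𝔸) : φ (truncExp N x) = truncExp N (φ x) := by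
  simp [truncExp, map_sum, map_pow]

lemma truncExp_zero (N : ℕ) : truncExp N (0 : 𝔸) = 1 := by
  rw [truncExp, Finset.sum_eq_single 0] <;> simp +contextual

lemma sum_range_prod_eq_sum_antidiagonal {M : Type*} [AddCommMonoid M] (N : ℕ) (f : ℕ → ℕ → M)
    (hf : ∀ i j, N < i + j → f i j = 0) :
    ∑ i ∈ Finset.range (N + 1), ∑ j ∈ Finset.range (N + 1), f i j =
      ∑ m ∈ Finset.range (N + 1), ∑ p ∈ Finset.HasAntidiagonal.antidiagonal m, f p.1 p.2 := by
  rw [← Finset.sum_product']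
  rw [← Finset.sum_filter_of_ne (p := fun p : ℕ × ℕ => p.1 + p.2 ≤ N)
    (fun p _ hp => by by_contra h; exact hp (hf _ _ (not_le.1 h)))]
  rw [← Finset.sum_fiberwise_of_maps_to (t := Finset.range (N + 1)) (g := fun p => p.1 + p.2)
    (by intro p hp; simp at hp ⊢; omega)]
  refine Finset.sum_congr rfl fun m hm => Finset.sum_congr ?_ fun _ _ => rfl
  ext ⟨i, j⟩
  simp at hm ⊢
  omega

variable {N : ℕ} {A : ℕ → Submodule ℝ 𝔸}

namespace IsNilFiltration

lemma pow_mem (hA : IsNilFiltration N A) {x : 𝔸} (hx : x ∈ A 1) (k : ℕ) : x ^ k ∈ A k := by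
  induction k with
  | zero => rw [pow_zero]; exact hA.one_mem
  | succ k ih => rw [pow_succ]; exact hA.mul_mem ih hx

lemma eq_zero (hA : IsNilFiltration N A) {x : 𝔸} {k : ℕ} (hk : N < k) (hx : x ∈ A k) : x = 0 := by
  have := hA.antitone (Nat.succ_le_of_lt hk) hx
  rwa [Nat.succ_eq_add_one, hA.succ_eq, Submodule.mem_bot] at this

/-- No error arises from the truncation: every product of total degree above `N` is zero, so the
square of indices may be replaced by a triangle and the binomial theorem applies. -/
lemma truncExp_add (hA : IsNilFiltration N A) {x y : 𝔸} (hx : x ∈ A 1) (hy : y ∈ A 1) (h : Commute x y) :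
    truncExp N x * truncExp N y = truncExp N (x + y) := by
  simp only [truncExp, Finset.sum_mul_sum]
  rw [sum_range_prod_eq_sum_antidiagonal]
  · refine Finset.sum_congr rfl fun m _ => ?_
    rw [h.add_pow', Finset.smul_sum]
    refine Finset.sum_congr rfl fun p hp => ?_
    rw [Finset.HasAntidiagonal.mem_antidiagonal] at hp
    rw [smul_mul_smul_comm, ← Nat.cast_smul_eq_nsmul ℝ, smul_smul]
    congr 1
    subst hp
    have h1 := Nat.choose_mul_factorial_mul_factorial (n := p.1 + p.2) (k := p.1) (by omega)
    rw [← h1, Nat.add_sub_cancel_left]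
    have h3 : ((p.1 + p.2).choose p.1 : ℝ) ≠ 0 := Nat.cast_ne_zero.2 (Nat.choose_pos (by omega)).ne'
    push_cast
    field_simp
  · intro i j hij
    rw [smul_mul_smul_comm, hA.eq_zero hij (hA.mul_mem (hA.pow_mem hx i) (hA.pow_mem hy j)),
      smul_zero]

lemma truncExp_mul_neg (hA : IsNilFiltration N A) {x : 𝔸} (hx : x ∈ A 1) : truncExp N x * truncExp N (-x) = 1 := by
  rw [hA.truncExp_add hx (neg_mem hx) (Commute.neg_right (Commute.refl x)), add_neg_cancel,
    truncExp_zero]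

lemma truncExp_neg_mul (hA : IsNilFiltration N A) {x : 𝔸} (hx : x ∈ A 1) : truncExp N (-x) * truncExp N x = 1 := by
  simpa using hA.truncExp_mul_neg (neg_mem hx)

lemma truncExp_sub_one_mem (hA : IsNilFiltration N A) {x : 𝔸} (hx : x ∈ A 1) : truncExp N x - 1 ∈ A 1 := by
  rw [truncExp, Finset.sum_range_succ']
  simp only [pow_zero, Nat.factorial_zero, Nat.cast_one, inv_one, one_smul, add_sub_cancel_right]
  exact Submodule.sum_mem _ fun k _ => Submodule.smul_mem _ _
    (hA.antitone (by omega) (hA.pow_mem hx (k + 1)))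

lemma pow_sub_pow_mem (hA : IsNilFiltration N A) {x y : 𝔸} (hx : x ∈ A 1) (hy : y ∈ A 1) {m : ℕ} (hxy : x - y ∈ A m)
    (k : ℕ) : x ^ (k + 1) - y ^ (k + 1) ∈ A (m + k) := by
  induction k with
  | zero => simpa using hxy
  | succ k ih =>
    have : x ^ (k + 1 + 1) - y ^ (k + 1 + 1) =
        x ^ (k + 1) * (x - y) + (x ^ (k + 1) - y ^ (k + 1)) * y := by
      rw [pow_succ, pow_succ y]; noncomm_ring
    rw [this]
    refine add_mem ?_ ?_
    · have := hA.mul_mem (hA.pow_mem hx (k + 1)) hxy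
      rwa [add_comm] at this
    · exact hA.mul_mem (i := m + k) ih hy

/-- The nonlinear part of the exponential contains only powers of degree at least two, so it is a
contraction for the filtration. Injectivity of the exponential and convergence of the iteration
`truncLog` both rest on this. -/
lemma remainder_sub_mem (hA : IsNilFiltration N A) {x y : 𝔸} (hx : x ∈ A 1) (hy : y ∈ A 1) {m : ℕ} (hxy : x - y ∈ A m) :
    (truncExp N x - 1 - x) - (truncExp N y - 1 - y) ∈ A (m + 1) := by
  rcases N with _ | N
  · have h0 : ∀ z ∈ A 1, z = 0 := fun z hz => hA.eq_zero one_pos hz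
    rw [h0 x hx, h0 y hy]; simp
  have e : ∀ z : 𝔸, truncExp (N + 1) z - 1 - z =
      ∑ k ∈ Finset.range N, (((k + 2).factorial : ℝ)⁻¹) • z ^ (k + 2) := by
    intro z
    rw [truncExp, Finset.sum_range_succ', Finset.sum_range_succ']
    simp
  rw [e, e, ← Finset.sum_sub_distrib]
  refine Submodule.sum_mem _ fun k _ => ?_
  rw [← smul_sub]
  exact Submodule.smul_mem _ _ (hA.antitone (by omega) (hA.pow_sub_pow_mem hx hy hxy (k + 1)))

lemma truncExp_injOn (hA : IsNilFiltration N A) : Set.InjOn (truncExp N) (A 1 : Set 𝔸) := by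
  intro x hx y hy hxy
  have h : ∀ m, x - y ∈ A (m + 1) := by
    intro m
    induction m with
    | zero => exact sub_mem hx hy
    | succ m ih =>
      have := hA.remainder_sub_mem hx hy ih
      rw [hxy] at this
      have e : truncExp N y - 1 - x - (truncExp N y - 1 - y) = -(x - y) := by abel
      rw [e] at this
      simpa using neg_mem this
  exact sub_eq_zero.1 (hA.eq_zero (Nat.lt_succ_self N) (h N))

lemma truncLog_mem (hA : IsNilFiltration N A) {x : 𝔸} (hx : x ∈ A 1) (j : ℕ) : truncLog N x j ∈ A 1 := by
  induction j with
  | zero => exact zero_mem _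
  | succ j ih => exact sub_mem hx (sub_mem (hA.truncExp_sub_one_mem ih) ih)

/-- Successive iterates differ by an element of `A (j + 1)`, which is zero for `j = N`. The `N`-th
iterate is therefore a fixed point of the iteration, which is the claim. -/
lemma truncExp_truncLog (hA : IsNilFiltration N A) {x : 𝔸} (hx : x ∈ A 1) : truncExp N (truncLog N x N) = 1 + x := by
  have h : ∀ j, truncLog N x (j + 1) - truncLog N x j ∈ A (j + 1) := by
    intro j
    induction j with
    | zero => simpa [truncLog, truncExp_zero] using hx
    | succ j ih =>
      have := hA.remainder_sub_mem (hA.truncLog_mem hx (j + 1)) (hA.truncLog_mem hx j) ih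
      have e : truncLog N x (j + 1 + 1) - truncLog N x (j + 1) =
          -((truncExp N (truncLog N x (j + 1)) - 1 - truncLog N x (j + 1)) -
            (truncExp N (truncLog N x j) - 1 - truncLog N x j)) := by
        rw [truncLog, truncLog]; abel
      rw [e]; exact neg_mem this
  have h1 := hA.eq_zero (Nat.lt_succ_self N) (h N)
  rw [truncLog] at h1
  have h2 : truncExp N (truncLog N x N) = 1 + x - (x - (truncExp N (truncLog N x N) - 1 -
    truncLog N x N) - truncLog N x N) := by abel
  rw [h2, h1, sub_zero]

lemma truncLog_truncExp (hA : IsNilFiltration N A) {x : 𝔸} (hx : x ∈ A 1) : truncLog N (truncExp N x - 1) N = x :=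
  hA.truncExp_injOn (hA.truncLog_mem (hA.truncExp_sub_one_mem hx) N) hx
    (by rw [hA.truncExp_truncLog (hA.truncExp_sub_one_mem hx)]; abel)

lemma mul_sub_one_mem (hA : IsNilFiltration N A) {x y : 𝔸} (hx : x - 1 ∈ A 1) (hy : y - 1 ∈ A 1) : x * y - 1 ∈ A 1 := by
  have : x * y - 1 = (x - 1) * (y - 1) + (x - 1) + (y - 1) := by noncomm_ring
  rw [this]
  exact add_mem (add_mem (hA.antitone (by norm_num) (hA.mul_mem hx hy)) hx) hy

end IsNilFiltration

/-- The derivative of the `k`-th power at `z`, as a linear operator. -/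
def powDeriv (z : 𝔸) : ℕ → Module.End ℝ 𝔸
  | 0 => 0
  | k + 1 => LinearMap.mulLeft ℝ z * powDeriv z k + LinearMap.mulRight ℝ z ^ k

/-- Left minus right multiplication, that is, the commutator with `z`. -/
def adjointAction (z : 𝔸) : Module.End ℝ 𝔸 := LinearMap.mulLeft ℝ z - LinearMap.mulRight ℝ z

lemma adjointAction_apply (z h : 𝔸) : adjointAction z h = z * h - h * z := rfl

lemma hasDerivAt_pow_curve {z : ℝ → 𝔸} {z' : 𝔸} {t : ℝ} (h : HasDerivAt z z' t) (k : ℕ) :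
    HasDerivAt (fun s => z s ^ k) (powDeriv (z t) k z') t := by
  induction k with
  | zero => simpa [powDeriv] using hasDerivAt_const t (1 : 𝔸)
  | succ k ih =>
    have := h.mul ih
    convert! this using 1
    · funext s; exact pow_succ' _ _
    · simp [powDeriv, LinearMap.pow_mulRight, add_comm]

/-- Right multiplication is left multiplication minus the commutator with `z`, and these two
commute; the binomial theorem then moves all left multiplications to the front. -/
lemma powDeriv_eq_sum (z : 𝔸) (k : ℕ) :
    powDeriv z k = ∑ j ∈ Finset.range k, (k.choose (j + 1)) •
      (LinearMap.mulLeft ℝ z ^ (k - 1 - j) * (-adjointAction z) ^ j) := by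
  induction k with
  | zero => rfl
  | succ k ih =>
    have hc : Commute (-adjointAction z) (LinearMap.mulLeft ℝ z) := by
      refine Commute.neg_left (Commute.sub_left (Commute.refl _) ?_)
      exact (LinearMap.commute_mulLeft_right (R := ℝ) z z).symm
    have hR : LinearMap.mulRight ℝ z = -adjointAction z + LinearMap.mulLeft ℝ z := by
      simp [adjointAction]
    rw [powDeriv, ih, hR, hc.add_pow]
    have h1 : LinearMap.mulLeft ℝ z * ∑ j ∈ Finset.range k, (k.choose (j + 1)) •
        (LinearMap.mulLeft ℝ z ^ (k - 1 - j) * (-adjointAction z) ^ j) =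
        ∑ j ∈ Finset.range (k + 1), (k.choose (j + 1)) •
        (LinearMap.mulLeft ℝ z ^ (k - j) * (-adjointAction z) ^ j) := by
      rw [Finset.sum_range_succ, Nat.choose_succ_self, zero_smul, add_zero, Finset.mul_sum]
      refine Finset.sum_congr rfl fun j hj => ?_
      rw [Finset.mem_range] at hj
      rw [mul_smul_comm, ← mul_assoc, ← pow_succ']
      congr 4; omega
    rw [h1, ← Finset.sum_add_distrib]
    refine Finset.sum_congr rfl fun j hj => ?_
    rw [((hc.pow_pow j (k - j)).eq), ← nsmul_eq_mul', ← add_smul, Nat.choose_succ_succ', add_comm]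
    simp

/-- `∑_j (-1)^j / (j+1)! (ad z)^j h`. -/
def logDerivSeries (N : ℕ) (z h : 𝔸) : 𝔸 :=
  ∑ j ∈ Finset.range (N + 1), ((j + 1).factorial : ℝ)⁻¹ • ((-adjointAction z) ^ j) h

lemma IsNilFiltration.adjointAction_pow_mem (hA : IsNilFiltration N A) {z h : 𝔸} (hz : z ∈ A 1) (hh : h ∈ A 1) (j : ℕ) :
    ((-adjointAction z) ^ j) h ∈ A (j + 1) := by
  induction j with
  | zero => simpa using hh
  | succ j ih =>
    rw [pow_succ', Module.End.mul_apply, LinearMap.neg_apply, adjointAction_apply]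
    refine neg_mem (sub_mem ?_ (hA.mul_mem ih hz))
    have := hA.mul_mem hz ih
    rwa [add_comm] at this

/-- The formula for the derivative of the exponential follows by summing `powDeriv_eq_sum` over the
powers and recognising a Cauchy product. -/
lemma IsNilFiltration.hasDerivAt_truncExp (hA : IsNilFiltration N A) {z : ℝ → 𝔸} {h : 𝔸} {t : ℝ} (hd : HasDerivAt z h t)
    (hz : z t ∈ A 1) (hh : h ∈ A 1) :
    HasDerivAt (fun s => truncExp N (z s)) (truncExp N (z t) * logDerivSeries N (z t) h) t := by
  have h1 : HasDerivAt (fun s => truncExp N (z s))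
      (∑ k ∈ Finset.range (N + 1), (k.factorial : ℝ)⁻¹ • powDeriv (z t) k h) t := by
    unfold truncExp
    exact HasDerivAt.fun_sum fun k _ => (hasDerivAt_pow_curve hd k).fun_const_smul _
  convert! h1 using 1
  simp only [truncExp, logDerivSeries, Finset.sum_mul_sum]
  -- The direction `h` itself counts one degree. Already the antidiagonal `i + j = N` contributes
  -- nothing, which matches the absence of a constant term in the differentiated series.
  have hz0 : ∀ i j, N < i + j + 1 → ((i.factorial : ℝ)⁻¹ • z t ^ i) *
      (((j + 1).factorial : ℝ)⁻¹ • ((-adjointAction (z t)) ^ j) h) = 0 := by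
    intro i j hij
    rw [smul_mul_smul_comm, hA.eq_zero hij (x := z t ^ i * ((-adjointAction (z t)) ^ j) h)
      (hA.mul_mem (i := i) (j := j + 1) (hA.pow_mem hz i) (hA.adjointAction_pow_mem hz hh j)), smul_zero]
  rw [sum_range_prod_eq_sum_antidiagonal N _ fun i j hij => hz0 i j (by omega)]
  rw [Finset.sum_range_succ, Finset.sum_range_succ' (fun k => (k.factorial : ℝ)⁻¹ •
    powDeriv (z t) k h)]
  rw [Finset.sum_eq_zero (s := Finset.HasAntidiagonal.antidiagonal N) fun p hp => hz0 p.1 p.2 (by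
    rw [Finset.HasAntidiagonal.mem_antidiagonal] at hp; omega)]
  simp only [powDeriv, LinearMap.zero_apply, smul_zero]
  congr 1
  refine Finset.sum_congr rfl fun m _ => ?_
  change _ = ((m + 1).factorial : ℝ)⁻¹ • powDeriv (z t) (m + 1) h
  rw [powDeriv_eq_sum, LinearMap.sum_apply, Finset.smul_sum, ← Finset.Nat.sum_antidiagonal_swap]
  simp only [Prod.fst_swap, Prod.snd_swap]
  rw [Finset.Nat.sum_antidiagonal_eq_sum_range_succ (fun j i => ((i.factorial : ℝ)⁻¹ • z t ^ i) *
      (((j + 1).factorial : ℝ)⁻¹ • ((-adjointAction (z t)) ^ j) h)) m]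
  refine Finset.sum_congr rfl fun j hj => ?_
  rw [Finset.mem_range] at hj
  rw [LinearMap.smul_apply, ← Nat.cast_smul_eq_nsmul ℝ, smul_smul, smul_mul_smul_comm,
    Module.End.mul_apply, LinearMap.pow_mulLeft, LinearMap.mulLeft_apply, Nat.add_sub_cancel]
  congr 1
  have h2 := Nat.choose_mul_factorial_mul_factorial (n := m + 1) (k := j + 1) (by omega)
  rw [← h2, show m + 1 - (j + 1) = m - j by omega]
  have h3 : ((m + 1).choose (j + 1) : ℝ) ≠ 0 :=
    Nat.cast_ne_zero.2 (Nat.choose_pos (by omega)).ne'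
  push_cast
  field_simp

end NilpotentExp

/-! ### The group of exponentials of a Lie subalgebra -/

section ExpGroup

set_option linter.unusedSectionVars false

variable {𝔸 : Type*} [NormedRing 𝔸] [NormedAlgebra ℝ 𝔸] {N : ℕ} {A : ℕ → Submodule ℝ 𝔸}

/-- Membership in a subspace becomes an equation for a continuous linear map, so it can be
differentiated and integrated along curves. -/
lemma exists_ker_eq [FiniteDimensional ℝ 𝔸] (S : Submodule ℝ 𝔸) :
    ∃ q : 𝔸 →L[ℝ] 𝔸, ∀ x, q x = 0 ↔ x ∈ S := by
  obtain ⟨T, hT⟩ := S.exists_isCompl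
  refine ⟨LinearMap.toContinuousLinearMap (T.subtype ∘ₗ T.projectionOnto S hT.symm), fun x => ?_⟩
  simp

lemma mem_of_hasDerivAt_of_forall_mem [FiniteDimensional ℝ 𝔸] {S : Submodule ℝ 𝔸} {z : ℝ → 𝔸}
    {h : 𝔸} {t : ℝ} (hd : HasDerivAt z h t) (hz : ∀ s, z s ∈ S) : h ∈ S := by
  obtain ⟨q, hq⟩ := exists_ker_eq S
  have h1 := q.hasFDerivAt.comp_hasDerivAt t hd
  have h2 : (q ∘ z) = fun _ => 0 := funext fun s => (hq _).2 (hz s)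
  rw [h2] at h1
  exact (hq h).1 (h1.unique (hasDerivAt_const t 0))

lemma sub_mem_of_hasDerivAt_mem [FiniteDimensional ℝ 𝔸] {S : Submodule ℝ 𝔸} {z z' : ℝ → 𝔸}
    (hd : ∀ t, HasDerivAt z (z' t) t) (hz : ∀ s, z' s ∈ S) (a b : ℝ) : z a - z b ∈ S := by
  obtain ⟨q, hq⟩ := exists_ker_eq S
  have h1 := fun t => q.hasFDerivAt.comp_hasDerivAt t (hd t)
  have h2 : (q ∘ z) a = (q ∘ z) b := is_const_of_deriv_eq_zero (fun t => (h1 t).differentiableAt)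
    (fun t => by rw [(h1 t).deriv]; exact (hq _).2 (hz t)) a b
  rw [← hq, map_sub, sub_eq_zero]; exact h2

/-- The Campbell–Hausdorff theorem: `log (exp u exp v)` belongs to every Lie subalgebra that
contains `u` and `v`. -/
lemma IsNilFiltration.truncLog_mul_mem [FiniteDimensional ℝ 𝔸] (hA : IsNilFiltration N A)
    {g : Submodule ℝ 𝔸} (hg : g ≤ A 1) (hlie : ∀ x ∈ g, ∀ y ∈ g, x * y - y * x ∈ g)
    {u v : 𝔸} (hu : u ∈ g) (hv : v ∈ g) :
    truncLog N (truncExp N u * truncExp N v - 1) N ∈ g := by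
  set z : ℝ → 𝔸 := fun t => truncLog N (truncExp N u * truncExp N (t • v) - 1) N with hzdef
  have hm : ∀ t : ℝ, truncExp N u * truncExp N (t • v) - 1 ∈ A 1 := fun t =>
    hA.mul_sub_one_mem (hA.truncExp_sub_one_mem (hg hu))
      (hA.truncExp_sub_one_mem (Submodule.smul_mem _ _ (hg hv)))
  have hz1 : ∀ t, z t ∈ A 1 := fun t => hA.truncLog_mem (hm t) N
  have hze : ∀ t, truncExp N (z t) = truncExp N u * truncExp N (t • v) := fun t => by
    rw [hzdef]; simp only; rw [hA.truncExp_truncLog (hm t)]; abel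
  have hsm : ContDiff ℝ ∞ z := by
    refine (contDiff_truncLog N N).comp ((contDiff_const.mul ?_).sub contDiff_const)
    exact (contDiff_truncExp N).comp (contDiff_id.smul contDiff_const)
  have hd : ∀ t, HasDerivAt z (deriv z t) t := fun t =>
    (hsm.differentiable (by simp) t).hasDerivAt
  have hz'1 : ∀ t, deriv z t ∈ A 1 := fun t => mem_of_hasDerivAt_of_forall_mem (hd t) hz1
  have hcomm : ∀ t : ℝ, (-adjointAction (t • v)) v = 0 := fun t => by
    simp [adjointAction_apply]
  have hψv : ∀ t : ℝ, logDerivSeries N (t • v) v = v := fun t => by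
    rw [logDerivSeries, Finset.sum_eq_single 0]
    · simp
    · intro j _ hj
      obtain ⟨j, rfl⟩ := Nat.exists_eq_succ_of_ne_zero hj
      rw [Nat.succ_eq_add_one, pow_succ, Module.End.mul_apply, hcomm, map_zero, smul_zero]
    · simp
  -- Differentiating `exp (z t) = exp u exp (t v)` gives a differential equation for `z` that
  -- involves only `v` and iterated commutators with `z`.
  have hkey : ∀ t, logDerivSeries N (z t) (deriv z t) = v := fun t => by
    have h1 := hA.hasDerivAt_truncExp (hd t) (hz1 t) (hz'1 t)
    have h2 : HasDerivAt (fun s : ℝ => truncExp N u * truncExp N (s • v))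
        (truncExp N u * (truncExp N (t • v) * v)) t := by
      have h3 : HasDerivAt (fun s : ℝ => s • v) v t := by
        simpa using (hasDerivAt_id t).smul_const v
      have := hA.hasDerivAt_truncExp h3 (Submodule.smul_mem _ _ (hg hv)) (hg hv)
      rw [hψv] at this
      exact this.const_mul _
    rw [funext hze] at h1
    have h4 := h1.unique h2
    rw [← mul_assoc, ← hze] at h4
    have h5 := congrArg (fun x => truncExp N (-z t) * x) h4
    simpa [← mul_assoc, hA.truncExp_neg_mul (hz1 t)] using h5
  -- A commutator gains one degree on the part outside `g`, because its other factor lies in `A 1`.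
  have hstep : ∀ k, ∀ x ∈ g ⊔ A (k + 1), ∀ y ∈ g ⊔ A (k + 1),
      x * y - y * x ∈ g ⊔ A (k + 2) := by
    intro k x hx y hy
    obtain ⟨a, ha, b, hb, rfl⟩ := Submodule.mem_sup.1 hx
    obtain ⟨c, hc, d, hd, rfl⟩ := Submodule.mem_sup.1 hy
    have e : (a + b) * (c + d) - (c + d) * (a + b) = (a * c - c * a) +
        (a * d - d * a + (b * c - c * b) + (b * d - d * b)) := by noncomm_ring
    rw [e]
    have h1 : ∀ {x y : 𝔸}, x ∈ A 1 → y ∈ A (k + 1) → x * y - y * x ∈ A (k + 2) := by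
      intro x y hx hy
      refine sub_mem (hA.antitone (by omega) (hA.mul_mem hx hy))
        (hA.antitone (by omega) (hA.mul_mem hy hx))
    have hb1 : b ∈ A 1 := hA.antitone (by omega) hb
    refine Submodule.add_mem_sup (hlie a ha c hc) (add_mem (add_mem (h1 (hg ha) hd) ?_) (h1 hb1 hd))
    rw [← neg_sub]; exact neg_mem (h1 (hg hc) hb)
  -- Bootstrap: if the curve lies in `g ⊔ A (k + 1)`, so does its derivative. The equation `hkey`
  -- expresses the derivative through `v` and commutators, hence places it in `g ⊔ A (k + 2)`, and
  -- integration from `z 0 = u` improves the curve. At `k = N` only `g` is left.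
  have hall : ∀ k, ∀ t, z t ∈ g ⊔ A (k + 1) := by
    intro k
    induction k with
    | zero => exact fun t => Submodule.mem_sup_right (hz1 t)
    | succ k ih =>
      have hle : g ⊔ A (k + 2) ≤ g ⊔ A (k + 1) := sup_le_sup_left (hA.antitone (by omega)) _
      have hz'k : ∀ t, deriv z t ∈ g ⊔ A (k + 1) := fun t =>
        mem_of_hasDerivAt_of_forall_mem (hd t) ih
      have had : ∀ t j, ((-adjointAction (z t)) ^ (j + 1)) (deriv z t) ∈ g ⊔ A (k + 2) := by
        intro t j
        induction j with
        | zero =>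
          have h1 := hstep k _ (hz'k t) _ (ih t)
          rw [← neg_sub] at h1
          simpa only [zero_add, pow_one, LinearMap.neg_apply, adjointAction_apply, neg_sub] using h1
        | succ j ihj =>
          rw [pow_succ', Module.End.mul_apply, LinearMap.neg_apply, adjointAction_apply]
          exact neg_mem (hstep k _ (ih t) _ (hle ihj))
      have hz'' : ∀ t, deriv z t ∈ g ⊔ A (k + 2) := by
        intro t
        have h1 := hkey t
        rw [logDerivSeries, Finset.sum_range_succ'] at h1
        simp only [zero_add, Nat.factorial_one, Nat.cast_one, inv_one, pow_zero, one_smul,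
          Module.End.one_apply] at h1
        rw [← eq_sub_iff_add_eq'] at h1
        rw [h1]
        exact sub_mem (Submodule.mem_sup_left hv)
          (Submodule.sum_mem _ fun j _ => Submodule.smul_mem _ _ (had t j))
      intro t
      have h0 : z 0 = u := by
        rw [hzdef]; simp only [zero_smul, truncExp_zero, mul_one]
        exact hA.truncLog_truncExp (hg hu)
      have h1 := sub_mem_of_hasDerivAt_mem hd hz'' t 0
      rw [h0] at h1
      have := add_mem h1 (Submodule.mem_sup_left (T := A (k + 2)) hu)
      rwa [sub_add_cancel] at this
  have h1 := hall N 1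
  rw [hA.succ_eq, sup_bot_eq] at h1
  simpa [hzdef] using h1

/-! ### The group law in linear coordinates and its left invariant fields. -/

variable {V : Type*} [NormedAddCommGroup V] [NormedSpace ℝ V]

/-- A linear parametrization `ι` of a Lie subalgebra of the nilpotent part of the algebra, with a
left inverse `κ`. -/
structure IsLieChart (N : ℕ) (A : ℕ → Submodule ℝ 𝔸) (ι : V →L[ℝ] 𝔸) (κ : 𝔸 →L[ℝ] V) : Prop where
  filtration : IsNilFiltration N A
  mem : ∀ u, ι u ∈ A 1
  left_inv : ∀ u, κ (ι u) = u
  lie : ∀ u v, ∃ w, ι w = ι u * ι v - ι v * ι u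

/-- The product `log (exp u exp v)` in the coordinates given by `ι` and `κ`. -/
def expMul (N : ℕ) (ι : V →L[ℝ] 𝔸) (κ : 𝔸 →L[ℝ] V) (u v : V) : V :=
  κ (truncLog N (truncExp N (ι u) * truncExp N (ι v) - 1) N)

/-- The left invariant field with value `v` at `0`. -/
def leftField (mul : V → V → V) (v u : V) : V := fderiv ℝ (mul u) 0 v

namespace IsLieChart

variable [FiniteDimensional ℝ 𝔸] {ι : V →L[ℝ] 𝔸} {κ : 𝔸 →L[ℝ] V}

lemma ι_expMul (h : IsLieChart N A ι κ) (u v : V) :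
    ι (expMul N ι κ u v) = truncLog N (truncExp N (ι u) * truncExp N (ι v) - 1) N := by
  have h1 : truncLog N (truncExp N (ι u) * truncExp N (ι v) - 1) N ∈
      LinearMap.range (ι : V →ₗ[ℝ] 𝔸) := by
    refine h.filtration.truncLog_mul_mem ?_ ?_ ⟨u, rfl⟩ ⟨v, rfl⟩
    · rintro _ ⟨w, rfl⟩; exact h.mem w
    · rintro _ ⟨w, rfl⟩ _ ⟨w', rfl⟩
      obtain ⟨x, hx⟩ := h.lie w w'
      exact ⟨x, hx⟩
  obtain ⟨w, hw⟩ := h1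
  rw [expMul, ← hw]
  exact congrArg ι (h.left_inv w)

lemma exp_expMul (h : IsLieChart N A ι κ) (u v : V) :
    truncExp N (ι (expMul N ι κ u v)) = truncExp N (ι u) * truncExp N (ι v) := by
  rw [h.ι_expMul, h.filtration.truncExp_truncLog
    (h.filtration.mul_sub_one_mem (h.filtration.truncExp_sub_one_mem (h.mem u))
      (h.filtration.truncExp_sub_one_mem (h.mem v)))]
  abel

lemma exp_injective (h : IsLieChart N A ι κ) {u v : V}
    (huv : truncExp N (ι u) = truncExp N (ι v)) : u = v := by
  have := h.filtration.truncExp_injOn (h.mem u) (h.mem v) huv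
  rw [← h.left_inv u, this, h.left_inv]

lemma contDiff_expMul :
    ContDiff ℝ ∞ fun q : V × V => expMul N ι κ q.1 q.2 := by
  unfold expMul
  refine κ.contDiff.comp ((contDiff_truncLog N N).comp (ContDiff.sub (ContDiff.mul ?_ ?_)
    contDiff_const))
  · exact (contDiff_truncExp N).comp (ι.contDiff.comp contDiff_fst)
  · exact (contDiff_truncExp N).comp (ι.contDiff.comp contDiff_snd)

lemma expMul_assoc (h : IsLieChart N A ι κ) (u v w : V) :
    expMul N ι κ (expMul N ι κ u v) w = expMul N ι κ u (expMul N ι κ v w) :=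
  h.exp_injective (by simp only [h.exp_expMul, mul_assoc])

/-- Lines through the origin are one-parameter subgroups, because multiples of one element commute.
The laws for identity and inverse are the cases `s, t ∈ {0, 1, -1}`. -/
lemma expMul_smul_smul (h : IsLieChart N A ι κ) (s t : ℝ) (u : V) :
    expMul N ι κ (s • u) (t • u) = (s + t) • u := by
  apply h.exp_injective
  rw [h.exp_expMul, add_smul, map_add, h.filtration.truncExp_add (h.mem _) (h.mem _)]
  rw [map_smul, map_smul]
  exact ((Commute.refl (ι u)).smul_left s).smul_right t

lemma zero_expMul (h : IsLieChart N A ι κ) (u : V) : expMul N ι κ 0 u = u := by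
  simpa using h.expMul_smul_smul 0 1 u

lemma expMul_zero (h : IsLieChart N A ι κ) (u : V) : expMul N ι κ u 0 = u := by
  simpa using h.expMul_smul_smul 1 0 u

lemma neg_expMul (h : IsLieChart N A ι κ) (u : V) : expMul N ι κ (-u) u = 0 := by
  simpa using h.expMul_smul_smul (-1) 1 u

lemma expMul_neg (h : IsLieChart N A ι κ) (u : V) : expMul N ι κ u (-u) = 0 := by
  simpa using h.expMul_smul_smul 1 (-1) u

/-- Algebra endomorphisms commute with the exponential; this makes the dilations automorphisms of
the group. -/
lemma map_expMul (h : IsLieChart N A ι κ) (φ : 𝔸 →ₐ[ℝ] 𝔸) (δ : V → V)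
    (hδ : ∀ u, ι (δ u) = φ (ι u)) (u v : V) :
    δ (expMul N ι κ u v) = expMul N ι κ (δ u) (δ v) := by
  apply h.exp_injective
  rw [h.exp_expMul, hδ, hδ, hδ, ← map_truncExp, h.exp_expMul, map_mul, map_truncExp, map_truncExp]

lemma differentiable_expMul (u : V) : Differentiable ℝ (expMul N ι κ u) :=
  (contDiff_expMul.comp (contDiff_prodMk_right u)).differentiable (by simp)

lemma contDiff_leftField (v : V) : ContDiff ℝ ∞ (leftField (expMul N ι κ) v) := by
  have : ContDiff ℝ ∞ fun u => fderiv ℝ (expMul N ι κ u) 0 :=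
    ContDiff.fderiv (m := ∞) (n := ∞) (f := expMul N ι κ) (g := fun _ => 0) contDiff_expMul
      contDiff_const (by simp)
  exact this.clm_apply contDiff_const

/-- Left invariance is associativity differentiated at the identity in the last factor. -/
lemma fderiv_expMul_leftField (h : IsLieChart N A ι κ) (v g u : V) :
    leftField (expMul N ι κ) v (expMul N ι κ g u) =
      fderiv ℝ (expMul N ι κ g) u (leftField (expMul N ι κ) v u) := by
  have e : expMul N ι κ (expMul N ι κ g u) = expMul N ι κ g ∘ expMul N ι κ u :=
    funext fun w => h.expMul_assoc g u w
  rw [leftField, e, fderiv_comp _ (differentiable_expMul g _) (differentiable_expMul u _),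
    h.expMul_zero]
  rfl

lemma leftField_zero (h : IsLieChart N A ι κ) (v : V) : leftField (expMul N ι κ) v 0 = v := by
  rw [leftField, show expMul N ι κ 0 = id from funext h.zero_expMul]; simp

/-- Differentiate `u · (s u) = (1 + s) u` at `s = 0`. This is the source of the Euler identity of
the model. -/
lemma leftField_self (h : IsLieChart N A ι κ) (u : V) : leftField (expMul N ι κ) u u = u := by
  have h1 : HasDerivAt (fun s : ℝ => s • u) u 0 := by
    simpa using (hasDerivAt_id (0 : ℝ)).smul_const u
  have h2 : HasFDerivAt (expMul N ι κ u) (fderiv ℝ (expMul N ι κ u) 0) ((0 : ℝ) • u) := by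
    rw [zero_smul]; exact (differentiable_expMul u 0).hasFDerivAt
  have h3 := h2.comp_hasDerivAt (0 : ℝ) h1
  have h4 : (expMul N ι κ u ∘ fun s : ℝ => s • u) = fun s : ℝ => (1 + s) • u :=
    funext fun s => by simpa using h.expMul_smul_smul 1 s u
  rw [h4] at h3
  have h5 : HasDerivAt (fun s : ℝ => (1 + s) • u) u 0 := by
    simpa using ((hasDerivAt_id (0 : ℝ)).const_add 1).smul_const u
  exact h3.unique h5

lemma fderiv_neg_leftField (h : IsLieChart N A ι κ) (v u : V) :
    fderiv ℝ (expMul N ι κ (-u)) u (leftField (expMul N ι κ) v u) = v := by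
  rw [← h.fderiv_expMul_leftField, h.neg_expMul, h.leftField_zero]

lemma leftField_injective (h : IsLieChart N A ι κ) {v w u : V}
    (hvw : leftField (expMul N ι κ) v u = leftField (expMul N ι κ) w u) : v = w := by
  rw [← h.fderiv_neg_leftField v u, hvw, h.fderiv_neg_leftField]

/-- Seen through the exponential, a left invariant field is right multiplication by a constant,
which makes brackets computable in the algebra. -/
lemma fderiv_exp_leftField (h : IsLieChart N A ι κ) (v u : V) :
    fderiv ℝ (fun w => truncExp N (ι w)) u (leftField (expMul N ι κ) v u) =
      truncExp N (ι u) * ι v := by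
  have hG : Differentiable ℝ (fun w => truncExp N (ι w)) :=
    ((contDiff_truncExp N).comp ι.contDiff).differentiable (by simp)
  have h1 : fderiv ℝ (fun w => truncExp N (ι w)) (expMul N ι κ u 0) ∘L
      fderiv ℝ (expMul N ι κ u) 0 = fderiv ℝ (fun w => truncExp N (ι u) * truncExp N (ι w)) 0 := by
    rw [← fderiv_comp _ (hG _) (differentiable_expMul u 0)]
    congr 1
    exact funext fun w => h.exp_expMul u w
  have h2 : HasFDerivAt (fun w => truncExp N (ι w)) (ι : V →L[ℝ] 𝔸) 0 := by
    have h3 := (hG 0).hasFDerivAt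
    convert! h3 using 1
    ext w
    have h4 : HasDerivAt (fun s : ℝ => s • w) w 0 := by
      simpa using (hasDerivAt_id (0 : ℝ)).smul_const w
    have h5 : HasFDerivAt (fun w => truncExp N (ι w)) (fderiv ℝ (fun w => truncExp N (ι w)) 0)
      ((0 : ℝ) • w) := by rwa [zero_smul]
    have h6 := h5.comp_hasDerivAt (0 : ℝ) h4
    have h7 := h.filtration.hasDerivAt_truncExp (t := 0) (z := fun s : ℝ => s • ι w) (h := ι w)
      (by simpa using (hasDerivAt_id (0 : ℝ)).smul_const (ι w))
      (Submodule.smul_mem _ _ (h.mem w)) (h.mem w)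
    have h8 : ((fun w => truncExp N (ι w)) ∘ fun s : ℝ => s • w) =
        fun s : ℝ => truncExp N (s • ι w) := by
      funext s; simp
    rw [h8] at h6
    rw [h6.unique h7, zero_smul, truncExp_zero, one_mul, logDerivSeries,
      Finset.sum_eq_single 0]
    · simp
    · intro j _ hj
      obtain ⟨j, rfl⟩ := Nat.exists_eq_succ_of_ne_zero hj
      rw [Nat.succ_eq_add_one, pow_succ, Module.End.mul_apply]
      simp [adjointAction_apply]
    · simp
  have h3 := DFunLike.congr_fun h1 v
  rw [h.expMul_zero, ContinuousLinearMap.comp_apply, (h2.const_mul (truncExp N (ι u))).fderiv] at h3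
  exact h3

lemma fderiv_exp_injective (h : IsLieChart N A ι κ) (u : V) :
    Function.Injective (fderiv ℝ (fun w => truncExp N (ι w)) u) := by
  have hG : Differentiable ℝ (fun w => truncExp N (ι w)) :=
    ((contDiff_truncExp N).comp ι.contDiff).differentiable (by simp)
  have hL : Differentiable ℝ (fun x : 𝔸 => κ (truncLog N (x - 1) N)) :=
    (κ.contDiff.comp ((contDiff_truncLog N N).comp
      (contDiff_id.sub contDiff_const))).differentiable (by simp)
  have h1 := fderiv_comp u (hL _) (hG u)
  have h2 : ((fun x : 𝔸 => κ (truncLog N (x - 1) N)) ∘ fun w => truncExp N (ι w)) = id :=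
    funext fun w => by simp [h.filtration.truncLog_truncExp (h.mem w), h.left_inv]
  rw [h2, fderiv_id] at h1
  intro a b hab
  have ha := DFunLike.congr_fun h1 a
  have hb := DFunLike.congr_fun h1 b
  simp only [ContinuousLinearMap.comp_apply, ContinuousLinearMap.id_apply] at ha hb
  rw [ha, hb, hab]

/-- The differential of the exponential is injective, so it suffices to compare the images in the
algebra. There the bracket of two right multiplications is right multiplication by the commutator.
-/
lemma lieBracket_leftField (h : IsLieChart N A ι κ) {v w x : V}
    (hx : ι x = ι v * ι w - ι w * ι v) :
    VectorField.lieBracket ℝ (leftField (expMul N ι κ) v) (leftField (expMul N ι κ) w) =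
      leftField (expMul N ι κ) x := by
  funext u
  apply h.fderiv_exp_injective u
  have hsm : ContDiff ℝ ∞ (fun w => truncExp N (ι w)) := (contDiff_truncExp N).comp ι.contDiff
  have hG : Differentiable ℝ (fun w => truncExp N (ι w)) := hsm.differentiable (by simp)
  rw [VectorField.fderiv_apply_lieBracket (n := ∞) hsm.contDiffAt
    (by rw [minSmoothness_of_isRCLikeNormedField]; exact two_le_infty)
    ((contDiff_leftField w).differentiable (by simp) u)
    ((contDiff_leftField v).differentiable (by simp) u)]
  simp only [h.fderiv_exp_leftField]
  rw [fderiv_mul_const' (hG u), fderiv_mul_const' (hG u)]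
  simp only [smul_apply, MulOpposite.smul_eq_mul_unop, MulOpposite.unop_op,
    h.fderiv_exp_leftField, hx]
  noncomm_ring

end IsLieChart

end ExpGroup

/-! ### The representation of the free algebra on words of bounded weight -/

section Words

variable {n : ℕ}

/-- The words of weight at most `r`. -/
abbrev Words (n r : ℕ) : Type := {w : List (Fin (n + 1)) // weight w ≤ r}

instance (n r : ℕ) : Fintype (Words n r) := (finite_weight_le n r).fintype

/-- The matrix of `w ↦ i :: w`, truncated to words of weight at most `r`. -/
def shiftMatrix (r : ℕ) (i : Fin (n + 1)) : Matrix (Words n r) (Words n r) ℝ :=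
  fun w' w => if w'.1 = i :: w.1 then 1 else 0

/-- The action of the free algebra on words of weight at most `r`. -/
def wordRep (n r : ℕ) : FreeAlgebra ℝ (Fin (n + 1)) →ₐ[ℝ] Matrix (Words n r) (Words n r) ℝ :=
  FreeAlgebra.lift ℝ (shiftMatrix r)

/-- The empty word. -/
def emptyWord (n r : ℕ) : Words n r := ⟨[], by simp⟩

lemma prod_shiftMatrix_apply (r : ℕ) (l : List (Fin (n + 1))) (w : Words n r) :
    (l.map (shiftMatrix r)).prod w (emptyWord n r) = if w.1 = l then 1 else 0 := by
  induction l generalizing w with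
  | nil =>
    simp only [List.map_nil, List.prod_nil, Matrix.one_apply, emptyWord, Subtype.ext_iff]
  | cons i l ih =>
    rw [List.map_cons, List.prod_cons, Matrix.mul_apply]
    simp only [ih, shiftMatrix]
    by_cases hw : w.1 = i :: l
    · have hl : weight l ≤ r := by
        have := w.2; rw [hw, weight_cons] at this; omega
      rw [if_pos hw, Finset.sum_eq_single ⟨l, hl⟩]
      · simp [hw]
      · intro b _ hb
        have : b.1 ≠ l := fun h => hb (Subtype.ext h)
        simp [this]
      · simp
    · rw [if_neg hw]
      refine Finset.sum_eq_zero fun b _ => ?_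
      by_cases hb : b.1 = l
      · rw [hb]; simp [hw]
      · simp [hb]

/-- Generators act by prepending a letter, so applying an element to the empty word lists its
coefficients. This column is what makes the truncated representation faithful up to weight `r`. -/
lemma wordRep_apply_emptyWord (r : ℕ) (z : FreeAlgebra ℝ (Fin (n + 1))) (w : Words n r) :
    wordRep n r z w (emptyWord n r) = freeCoeff w.1 z := by
  obtain ⟨m, rfl⟩ := FreeAlgebra.equivMonoidAlgebraFreeMonoid.symm.surjective z
  induction m using MonoidAlgebra.induction_linear with
  | zero => simp
  | add f g hf hg => simp [hf, hg]
  | single a b =>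
    have h1 : FreeAlgebra.equivMonoidAlgebraFreeMonoid.symm (MonoidAlgebra.single a b) =
        b • FreeMonoid.lift (FreeAlgebra.ι ℝ) a := by
      simp [FreeAlgebra.equivMonoidAlgebraFreeMonoid]
    have h2 : wordRep n r (FreeMonoid.lift (FreeAlgebra.ι ℝ) a) =
        ((FreeMonoid.toList a).map (shiftMatrix r)).prod := by
      rw [FreeMonoid.lift_apply, map_list_prod, List.map_map]
      congr 2
      funext i
      simp [wordRep]
    classical
    have h3 : freeCoeff w.1 (FreeAlgebra.equivMonoidAlgebraFreeMonoid.symm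
        (MonoidAlgebra.single a b)) = if w.1 = FreeMonoid.toList a then b else 0 := by
      have : freeCoeff w.1 (FreeAlgebra.equivMonoidAlgebraFreeMonoid.symm
        (MonoidAlgebra.single a b)) = (FreeAlgebra.equivMonoidAlgebraFreeMonoid
          (FreeAlgebra.equivMonoidAlgebraFreeMonoid.symm
            (MonoidAlgebra.single a b))).coeff (FreeMonoid.ofList w.1) := rfl
      rw [this, AlgEquiv.apply_symm_apply, MonoidAlgebra.coeff_single, Finsupp.single_apply]
      have h4 : (a = FreeMonoid.ofList w.1) ↔ (w.1 = FreeMonoid.toList a) :=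
        ⟨fun h => by rw [h]; rfl, fun h => by rw [h]; rfl⟩
      simp only [h4]
    rw [h3, h1, map_smul, h2, Matrix.smul_apply, prod_shiftMatrix_apply]
    simp

/-- The matrices that raise the weight by at least `k`. -/
def wordFiltration (n r k : ℕ) : Submodule ℝ (Matrix (Words n r) (Words n r) ℝ) where
  carrier := {M | ∀ w' w, weight w'.1 < weight w.1 + k → M w' w = 0}
  add_mem' := fun {M M'} hM hM' w' w h => by simp [hM w' w h, hM' w' w h]
  zero_mem' := fun w' w h => rfl
  smul_mem' := fun c M hM w' w h => by simp [hM w' w h]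

/-- Conjugation by the dilation `w ↦ t ^ |w| w`. -/
def wordDilation (n r : ℕ) (t : ℝ) (ht : t ≠ 0) :
    Matrix (Words n r) (Words n r) ℝ →ₐ[ℝ] Matrix (Words n r) (Words n r) ℝ :=
  AlgHom.ofLinearMap
    { toFun := fun M => Matrix.diagonal (fun w : Words n r => t ^ weight w.1) * M *
        Matrix.diagonal (fun w : Words n r => (t ^ weight w.1)⁻¹)
      map_add' := fun M M' => by rw [mul_add, add_mul]
      map_smul' := fun c M => by simp }
    (by
      change Matrix.diagonal (fun w : Words n r => t ^ weight w.1) * 1 *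
        Matrix.diagonal (fun w : Words n r => (t ^ weight w.1)⁻¹) = 1
      rw [mul_one, Matrix.diagonal_mul_diagonal, ← Matrix.diagonal_one]
      congr 1; funext w; exact mul_inv_cancel₀ (pow_ne_zero _ ht))
    (fun M M' => by
      have h : Matrix.diagonal (fun w : Words n r => (t ^ weight w.1)⁻¹) *
        Matrix.diagonal (fun w : Words n r => t ^ weight w.1) = 1 := by
        rw [Matrix.diagonal_mul_diagonal, ← Matrix.diagonal_one]
        congr 1; funext w; exact inv_mul_cancel₀ (pow_ne_zero _ ht)
      change Matrix.diagonal (fun w : Words n r => t ^ weight w.1) * (M * M') *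
        Matrix.diagonal (fun w : Words n r => (t ^ weight w.1)⁻¹) =
        Matrix.diagonal (fun w : Words n r => t ^ weight w.1) * M *
        Matrix.diagonal (fun w : Words n r => (t ^ weight w.1)⁻¹) *
        (Matrix.diagonal (fun w : Words n r => t ^ weight w.1) * M' *
        Matrix.diagonal (fun w : Words n r => (t ^ weight w.1)⁻¹))
      calc _ = Matrix.diagonal (fun w : Words n r => t ^ weight w.1) * M * 1 * M' *
        Matrix.diagonal (fun w : Words n r => (t ^ weight w.1)⁻¹) := by
            simp only [mul_one, mul_assoc]
        _ = _ := by rw [← h]; simp only [mul_assoc])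

lemma wordDilation_apply (r : ℕ) (t : ℝ) (ht : t ≠ 0) (M : Matrix (Words n r) (Words n r) ℝ)
    (w' w : Words n r) :
    wordDilation n r t ht M w' w = t ^ weight w'.1 * M w' w * (t ^ weight w.1)⁻¹ := by
  change (Matrix.diagonal (fun w : Words n r => t ^ weight w.1) * M *
    Matrix.diagonal (fun w : Words n r => (t ^ weight w.1)⁻¹)) w' w = _
  rw [Matrix.mul_diagonal, Matrix.diagonal_mul]

lemma wordDilation_wordRep (r : ℕ) (t : ℝ) (ht : t ≠ 0) (z : FreeAlgebra ℝ (Fin (n + 1))) :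
    wordDilation n r t ht (wordRep n r z) = wordRep n r (freeDilation n t z) := by
  have h : (wordDilation n r t ht).comp (wordRep n r) = (wordRep n r).comp (freeDilation n t) := by
    apply FreeAlgebra.hom_ext
    funext i
    ext w' w
    simp only [Function.comp_apply, AlgHom.comp_apply, wordDilation_apply, wordRep, freeDilation,
      FreeAlgebra.lift_ι_apply, map_smul, Matrix.smul_apply, shiftMatrix]
    split_ifs with h
    · rw [h, weight_cons, pow_add]
      have := pow_ne_zero (weight w.1) ht
      field_simp
      simp
    · simp
  exact DFunLike.congr_fun h z

lemma wordDilation_wordRep_freeBracket (r : ℕ) (t : ℝ) (ht : t ≠ 0) (I : List (Fin (n + 1))) :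
    wordDilation n r t ht (wordRep n r (freeBracket I)) =
      t ^ weight I • wordRep n r (freeBracket I) := by
  rw [wordDilation_wordRep, freeDilation_freeBracket, map_smul]

/-- In the representation truncated at weight `|J|`, dilation by `2` multiplies this coefficient by
both `2^|J|` and `2^|I|`. -/
lemma structConst_eq_zero_of_weight_ne {I J : List (Fin (n + 1))} (h : weight J ≠ weight I) :
    structConst I J = 0 := by
  have h1 := congrFun (congrFun (wordDilation_wordRep_freeBracket (weight J) 2 (by norm_num) I)
    ⟨J, le_rfl⟩) (emptyWord n _)
  rw [wordDilation_apply, Matrix.smul_apply, wordRep_apply_emptyWord, freeCoeff_freeBracket] at h1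
  simp only [emptyWord, weight_nil, pow_zero, inv_one, mul_one, smul_eq_mul] at h1
  rw [← sub_eq_zero, ← sub_mul, mul_eq_zero] at h1
  rcases h1 with h1 | h1
  · exact absurd (pow_right_injective₀ (by norm_num : (0:ℝ) < 2) (by norm_num)
      (sub_eq_zero.1 h1)) h
  · exact h1

/-- Coefficients at words of weight at most `r` are visible in the column of the empty word; the
others vanish by homogeneity. -/
lemma wordRep_injective_of_sum {r : ℕ} {κ : Type*} (s : Finset κ) (K : κ → List (Fin (n + 1)))
    (hK : ∀ k ∈ s, weight (K k) ≤ r) (c : κ → ℝ)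
    (h : ∑ k ∈ s, c k • wordRep n r (freeBracket (K k)) = 0) :
    ∑ k ∈ s, c k • freeBracket (K k) = 0 := by
  apply eq_zero_of_freeCoeff
  intro J
  by_cases hJ : weight J ≤ r
  · have h1 := congrFun (congrFun h ⟨J, hJ⟩) (emptyWord n r)
    rw [Matrix.sum_apply] at h1
    simp only [Matrix.smul_apply, wordRep_apply_emptyWord] at h1
    simpa using h1
  · rw [map_sum]
    refine Finset.sum_eq_zero fun k hk => ?_
    rw [map_smul, freeCoeff_freeBracket, structConst_eq_zero_of_weight_ne, smul_zero]
    have := hK k hk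
    omega

lemma wordFiltration_antitone (n r : ℕ) : Antitone (wordFiltration n r) :=
  fun _ _ hkl _ hM w' w h => hM w' w (lt_of_lt_of_le h (by omega))

lemma wordFiltration_mul_mem {r i j : ℕ} {M M' : Matrix (Words n r) (Words n r) ℝ}
    (hM : M ∈ wordFiltration n r i) (hM' : M' ∈ wordFiltration n r j) :
    M * M' ∈ wordFiltration n r (i + j) := by
  intro w' w h
  rw [Matrix.mul_apply]
  refine Finset.sum_eq_zero fun x _ => ?_
  by_cases hx : weight w'.1 < weight x.1 + i
  · rw [hM w' x hx, zero_mul]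
  · rw [hM' x w (by omega), mul_zero]

lemma wordRep_freeBracket_mem (r : ℕ) (I : List (Fin (n + 1))) :
    wordRep n r (freeBracket I) ∈ wordFiltration n r (weight I) := by
  rcases eq_or_ne I [] with rfl | hI
  · simp [freeBracket]
  have h1 : ∀ i, wordRep n r (FreeAlgebra.ι ℝ i) ∈ wordFiltration n r (fieldWeight i) := by
    intro i w' w h
    rw [wordRep, FreeAlgebra.lift_ι_apply, shiftMatrix, if_neg]
    intro e
    rw [e, weight_cons] at h; omega
  refine nonempty_list_induction (P := fun I => wordRep n r (freeBracket I) ∈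
    wordFiltration n r (weight I)) ?_ ?_ I hI
  · intro i
    have := h1 i
    rwa [show weight [i] = fieldWeight i by simp]
  · intro i J hJ ih
    rw [freeBracket_cons i hJ, map_sub, map_mul, map_mul, weight_cons]
    refine sub_mem (wordFiltration_mul_mem (h1 i) ih) ?_
    have := wordFiltration_mul_mem ih (h1 i)
    rwa [add_comm] at this

end Words

/-! ### Existence of the free model -/

section Model

variable {n r : ℕ} {B : Finset (List (Fin (n + 1)))}

variable {𝔸 : Type*} [NormedRing 𝔸] [NormedAlgebra ℝ 𝔸]

/-- A representation of the free algebra in a filtered nilpotent algebra that is compatible with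
weights and faithful on the commutators of weight at most `r`. -/
structure IsGradedRep (r : ℕ) (ρ : FreeAlgebra ℝ (Fin (n + 1)) →ₐ[ℝ] 𝔸)
    (A : ℕ → Submodule ℝ 𝔸) : Prop where
  filtration : IsNilFiltration r A
  mem : ∀ I, ρ (freeBracket I) ∈ A (weight I)
  dilation : ∀ t : ℝ, t ≠ 0 → ∃ φ : 𝔸 →ₐ[ℝ] 𝔸, ∀ I,
    φ (ρ (freeBracket I)) = t ^ weight I • ρ (freeBracket I)
  faithful : ∀ {κ : Type} (s : Finset κ) (K : κ → List (Fin (n + 1))),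
    (∀ k ∈ s, weight (K k) ≤ r) → ∀ c : κ → ℝ,
    ∑ k ∈ s, c k • ρ (freeBracket (K k)) = 0 → ∑ k ∈ s, c k • freeBracket (K k) = 0

variable {ρ : FreeAlgebra ℝ (Fin (n + 1)) →ₐ[ℝ] 𝔸} {A : ℕ → Submodule ℝ 𝔸}

/-- The parametrization of the Lie algebra spanned by the images of the `ξ_[I]`, `I ∈ B`. -/
def wordChart (ρ : FreeAlgebra ℝ (Fin (n + 1)) →ₐ[ℝ] 𝔸) (B : Finset (List (Fin (n + 1)))) :
    EuclideanSpace ℝ B →L[ℝ] 𝔸 :=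
  ∑ I : B, (EuclideanSpace.proj I : EuclideanSpace ℝ B →L[ℝ] ℝ).smulRight
    (ρ (freeBracket (I : List (Fin (n + 1)))))

lemma wordChart_apply (u : EuclideanSpace ℝ B) :
    wordChart ρ B u = ∑ I : B, u I • ρ (freeBracket (I : List (Fin (n + 1)))) := by
  simp [wordChart]

lemma wordChart_single (I : B) :
    wordChart ρ B (EuclideanSpace.single I 1) =
      ρ (freeBracket (I : List (Fin (n + 1)))) := by
  rw [wordChart_apply, Finset.sum_eq_single I]
  · simp
  · intro J _ hJ; simp [hJ]
  · simp

lemma IsFreeBasis.wordChart_injective (hB : IsFreeBasis r B) (hρ : IsGradedRep r ρ A) :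
    Function.Injective (wordChart ρ B) := by
  rw [injective_iff_map_eq_zero]
  intro u hu
  rw [wordChart_apply] at hu
  have h := hρ.faithful Finset.univ (fun I : B => (I : List (Fin (n + 1))))
    (fun I _ => hB.weight_le I) (fun I => u I) hu
  ext I
  exact Fintype.linearIndependent_iff.1 hB.linearIndependent (fun I => u I) h I

lemma IsFreeBasis.exists_wordChart_eq (hB : IsFreeBasis r B) (hρ : IsGradedRep r ρ A) {I : List (Fin (n + 1))}
    (hI : I ≠ []) : ∃ v, wordChart ρ B v = ρ (freeBracket I) := by
  by_cases h : weight I ≤ r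
  · obtain ⟨c, hc, -⟩ := hB.expansion I ⟨hI, h⟩
    refine ⟨WithLp.toLp 2 c, ?_⟩
    rw [wordChart_apply, hc, map_sum]
    simp
  · refine ⟨0, ?_⟩
    rw [map_zero, hρ.filtration.eq_zero (not_le.1 h)
      (hρ.mem I)]

/-- Commutators of weight at most `r` are expanded in the basis, and those of higher weight vanish
because the filtration ends at `r`. -/
lemma IsFreeBasis.wordChart_lie (hB : IsFreeBasis r B) (hρ : IsGradedRep r ρ A) (u v : EuclideanSpace ℝ B) :
    ∃ w, wordChart ρ B w =
      wordChart ρ B u * wordChart ρ B v - wordChart ρ B v * wordChart ρ B u := by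
  have h1 : ∀ J I : B, ∃ w, wordChart ρ B w =
      ρ (freeBracket (J : List (Fin (n + 1)))) *
        ρ (freeBracket (I : List (Fin (n + 1)))) -
      ρ (freeBracket (I : List (Fin (n + 1)))) *
        ρ (freeBracket (J : List (Fin (n + 1)))) := by
    intro J I
    by_cases h : weight (J : List (Fin (n + 1))) + weight (I : List (Fin (n + 1))) ≤ r
    · obtain ⟨c, hc, -⟩ := hB.commutator (hB.mem J).1 (hB.mem I).1 h
      refine ⟨WithLp.toLp 2 c, ?_⟩
      rw [← map_mul, ← map_mul, ← map_sub, hc, wordChart_apply, map_sum]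
      simp
    · refine ⟨0, ?_⟩
      have hA := hρ.filtration
      have h0 : ∀ J I : List (Fin (n + 1)), r < weight J + weight I →
          ρ (freeBracket J) * ρ (freeBracket I) = 0 := fun J I h =>
        hA.eq_zero h (hρ.filtration.mul_mem (hρ.mem J)
          (hρ.mem I))
      rw [map_zero, h0 _ _ (not_le.1 h), h0 _ _ (by omega), sub_zero]
  choose w hw using h1
  refine ⟨∑ J : B, ∑ I : B, (u J * v I) • w J I, ?_⟩
  simp only [map_sum, map_smul, hw]
  simp only [wordChart_apply, Finset.sum_mul_sum]
  rw [Finset.sum_comm (s := Finset.univ) (t := Finset.univ) (f := fun J I : B =>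
    (v J • ρ (freeBracket (J : List (Fin (n + 1))))) *
      (u I • ρ (freeBracket (I : List (Fin (n + 1))))))]
  simp only [← Finset.sum_sub_distrib]
  refine Finset.sum_congr rfl fun J _ => Finset.sum_congr rfl fun I _ => ?_
  rw [smul_mul_smul_comm, smul_mul_smul_comm, smul_sub, mul_comm (v I)]

lemma dilation_apply (t : ℝ) (u : EuclideanSpace ℝ B) (I : B) :
    dilation t u I = t ^ weight (I : List (Fin (n + 1))) * u I := rfl

lemma wordChart_dilation {t : ℝ} {φ : 𝔸 →ₐ[ℝ] 𝔸}
    (hφ : ∀ I, φ (ρ (freeBracket I)) = t ^ weight I • ρ (freeBracket I)) (u : EuclideanSpace ℝ B) :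
    wordChart ρ B (dilation t u) = φ (wordChart ρ B u) := by
  simp only [wordChart_apply, map_sum, map_smul, hφ, dilation_apply, smul_smul]
  exact Finset.sum_congr rfl fun I _ => by rw [mul_comm]

/-- The dilation as a linear map. -/
def dilationCLM (t : ℝ) : EuclideanSpace ℝ B →L[ℝ] EuclideanSpace ℝ B :=
  LinearMap.toContinuousLinearMap
    { toFun := dilation t
      map_add' := fun u v => by ext I; simp [dilation_apply, mul_add]
      map_smul' := fun c u => by ext I; simp [dilation_apply]; ring }

lemma dilationCLM_apply (t : ℝ) (u : EuclideanSpace ℝ B) : dilationCLM t u = dilation t u := rfl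

/-- The Lie algebra spanned by the image of `B` is exponentiated. Brackets of the generating left
invariant fields are the left invariant fields of the corresponding commutators, so every property
of the model reduces to a statement about vectors at the identity. -/
theorem IsFreeBasis.exists_isFreeModel_of_rep [FiniteDimensional ℝ 𝔸] (hB : IsFreeBasis r B)
    (hρ : IsGradedRep r ρ A) :
    ∃ (mul : EuclideanSpace ℝ B → EuclideanSpace ℝ B → EuclideanSpace ℝ B)
      (Y : Fin (n + 1) → EuclideanSpace ℝ B → EuclideanSpace ℝ B), IsFreeModel r B mul Y := by
  obtain ⟨κ', hκ'⟩ := LinearMap.exists_leftInverse_of_injective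
    (wordChart ρ B).toLinearMap (LinearMap.ker_eq_bot.2 (hB.wordChart_injective hρ))
  set κ := LinearMap.toContinuousLinearMap κ' with hκdef
  set ι := wordChart ρ B with hι
  have hκ : ∀ u, κ (ι u) = u := fun u => DFunLike.congr_fun hκ' u
  have hA := hρ.filtration
  have h : IsLieChart r A ι κ :=
    { filtration := hA
      mem := fun u => by
        rw [hι, wordChart_apply]
        exact Submodule.sum_mem _ fun I _ => Submodule.smul_mem _ _
          (hA.antitone (hB.weight_pos I) (hρ.mem I))
      left_inv := hκ
      lie := hB.wordChart_lie hρ }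
  set mul := expMul r ι κ with hmul
  have hex : ∀ I : List (Fin (n + 1)), ∃ v, I ≠ [] → ι v = ρ (freeBracket I) := fun I => by
    by_cases hI : I = []
    · exact ⟨0, fun h => absurd hI h⟩
    · obtain ⟨v, hv⟩ := hB.exists_wordChart_eq hρ hI
      exact ⟨v, fun _ => hv⟩
  choose v hv using hex
  set Y : Fin (n + 1) → EuclideanSpace ℝ B → EuclideanSpace ℝ B :=
    fun i => leftField mul (v [i]) with hY
  have hbr : ∀ I, I ≠ [] → bracket Y I = leftField mul (v I) := by
    refine nonempty_list_induction (fun i => rfl) fun i J hJ ih => ?_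
    rw [bracket_cons Y i hJ, ih]
    refine h.lieBracket_leftField ?_
    rw [hv _ (by simp), hv _ (by simp), hv _ hJ, freeBracket_cons i hJ, map_sub, map_mul, map_mul]
    rfl
  have hvB : ∀ I : B, v I = EuclideanSpace.single I 1 := fun I =>
    (hB.wordChart_injective hρ) (by rw [← hι, hv _ (hB.mem I).1, hι, wordChart_single])
  have hdil : ∀ t : ℝ, t ≠ 0 → ∀ I, I ≠ [] → dilation t (v I) = t ^ weight I • v I := by
    intro t ht I hI
    apply (hB.wordChart_injective hρ)
    obtain ⟨φ, hφ⟩ := hρ.dilation t ht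
    rw [wordChart_dilation hφ, ← hι, hv I hI, map_smul, hv I hI, hφ]
  have hmap : ∀ t : ℝ, 0 < t → ∀ u v, dilation t (mul u v) = mul (dilation t u) (dilation t v) :=
    fun t ht => by
      obtain ⟨φ, hφ⟩ := hρ.dilation t ht.ne'
      exact h.map_expMul φ (dilation t) (wordChart_dilation hφ)
  have hlin : ∀ (u : EuclideanSpace ℝ B), ∑ I : B, u I • EuclideanSpace.single I (1 : ℝ) = u := by
    intro u
    ext J
    simp [Finset.sum_apply, Pi.single_apply]
  refine ⟨mul, Y, ⟨?_, ?_, ?_, ?_, ?_, ?_, ?_, ?_⟩⟩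
  · exact ⟨IsLieChart.contDiff_expMul, h.expMul_assoc, h.zero_expMul, h.expMul_zero, h.neg_expMul,
      h.expMul_neg, hmap⟩
  · exact fun i => IsLieChart.contDiff_leftField _
  · intro u a ha hsum
    rw [sum_structConst_eq_zero_iff]
    have hne : ∀ I ∈ a.support, I ≠ [] ∧ weight I ≤ r := fun I hI => ha hI
    have h1 : leftField mul (∑ I ∈ a.support, a I • v I) u = leftField mul 0 u := by
      rw [leftField, map_sum]
      simp only [map_smul]
      have h2 : leftField mul 0 u = 0 := map_zero _
      rw [h2]
      refine Eq.trans ?_ hsum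
      refine Finset.sum_congr rfl fun I hI => ?_
      change _ = a I • bracket Y I u
      rw [hbr I (hne I hI).1]; rfl
    have h2 := h.leftField_injective h1
    refine hρ.faithful a.support id (fun I hI => (hne I hI).2) (fun I => a I) ?_
    have h3 := congrArg ι h2
    rw [map_zero, map_sum] at h3
    rw [← h3]
    exact Finset.sum_congr rfl fun I hI => by rw [map_smul, hv I (hne I hI).1]; rfl
  · intro u
    rw [eq_top_iff]
    intro w _
    -- Any tangent vector at `u` is the value of the left invariant field obtained by translating it
    -- back to the identity.
    have hw : w = leftField mul (fderiv ℝ (mul (-u)) u w) u := by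
      have e : (mul u ∘ mul (-u)) = id := by
        funext x
        change expMul r ι κ u (expMul r ι κ (-u) x) = x
        rw [← h.expMul_assoc, h.expMul_neg, h.zero_expMul]
      have h1 := fderiv_comp u (IsLieChart.differentiable_expMul (N := r) (ι := ι) (κ := κ) u _)
        (IsLieChart.differentiable_expMul (N := r) (ι := ι) (κ := κ) (-u) u)
      rw [← hmul, e, fderiv_id, show mul (-u) u = 0 from h.neg_expMul u] at h1
      exact DFunLike.congr_fun h1 w
    rw [hw, ← hlin (fderiv ℝ (mul (-u)) u w), leftField, map_sum]
    refine Submodule.sum_mem _ fun I _ => ?_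
    rw [map_smul]
    refine Submodule.smul_mem _ _ (Submodule.subset_span ⟨I, hB.mem I, ?_⟩)
    change bracket Y I u = _
    rw [hbr _ (hB.mem I).1, hvB]; rfl
  · intro I hI g u
    rw [hbr I hI]
    exact h.fderiv_expMul_leftField _ g u
  · intro I hI f hf t ht u
    rw [hbr I hI, act, act, show (f ∘ dilation t) = f ∘ dilationCLM (B := B) t from rfl,
      fderiv_comp _ (hf.differentiable (by simp) _) (dilationCLM t).differentiableAt,
      ContinuousLinearMap.fderiv, ContinuousLinearMap.comp_apply, dilationCLM_apply,
      dilationCLM_apply]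
    -- Homogeneity: differentiate `δ_t (u · x) = δ_t u · δ_t x` in `x` at the identity, where `δ_t`
    -- multiplies `v I` by `t^|I|`.
    have key : dilation t (leftField mul (v I) u) =
        t ^ weight I • leftField mul (v I) (dilation t u) := by
      have e : (dilationCLM t ∘ mul u) = mul (dilation t u) ∘ dilationCLM t :=
        funext fun x => hmap t ht u x
      have hd := fun w => IsLieChart.differentiable_expMul (N := r) (ι := ι) (κ := κ) w
      have h1 := congrArg (fun F => fderiv ℝ F 0 (v I)) e
      rw [fderiv_comp _ (dilationCLM t).differentiableAt (hd u 0),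
        fderiv_comp _ (hd _ _) (dilationCLM t).differentiableAt, ContinuousLinearMap.fderiv,
        ContinuousLinearMap.fderiv, map_zero, ContinuousLinearMap.comp_apply,
        ContinuousLinearMap.comp_apply, dilationCLM_apply, dilationCLM_apply,
        hdil t ht.ne' I hI, map_smul] at h1
      exact h1
    rw [key, map_smul, smul_eq_mul]
  · intro I
    rw [hbr _ (hB.mem I).1, h.leftField_zero, hvB]
  · intro u
    have h1 : ∀ I : B, bracket Y I u = fderiv ℝ (mul u) 0 (EuclideanSpace.single I 1) := fun I => by
      rw [hbr _ (hB.mem I).1, hvB]; rfl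
    simp only [combination, h1]
    have h2 := h.leftField_self u
    rw [leftField, ← hmul] at h2
    nth_rw 2 [← hlin u] at h2
    rw [map_sum] at h2
    simpa only [map_smul] using h2

open scoped Matrix.Norms.Operator in
theorem IsFreeBasis.exists_isFreeModel (hB : IsFreeBasis r B) :
    ∃ (mul : EuclideanSpace ℝ B → EuclideanSpace ℝ B → EuclideanSpace ℝ B)
      (Y : Fin (n + 1) → EuclideanSpace ℝ B → EuclideanSpace ℝ B), IsFreeModel r B mul Y :=
  hB.exists_isFreeModel_of_rep (𝔸 := Matrix (Words n r) (Words n r) ℝ) (ρ := wordRep n r)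
    (A := wordFiltration n r)
    { filtration :=
        { antitone := wordFiltration_antitone n r
          mul_mem := wordFiltration_mul_mem
          one_mem := fun w' w h => Matrix.one_apply_ne fun e => by rw [e] at h; omega
          succ_eq := by
            rw [eq_bot_iff]
            intro M hM
            rw [Submodule.mem_bot]
            ext w' w
            exact hM w' w (by have := w'.2; omega) }
      mem := wordRep_freeBracket_mem r
      dilation := fun t ht => ⟨wordDilation n r t ht, wordDilation_wordRep_freeBracket r t ht⟩
      faithful := fun s K hK c h => wordRep_injective_of_sum s K hK c h }

end Model

/-! ### Hölder classes -/

section Holder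

universe u

variable {D E F G H : Type u} [NormedAddCommGroup D] [NormedSpace ℝ D] [NormedAddCommGroup E]
  [NormedSpace ℝ E] [NormedAddCommGroup F] [NormedSpace ℝ F] [NormedAddCommGroup G]
  [NormedSpace ℝ G] [NormedAddCommGroup H] [NormedSpace ℝ H]

lemma iteratedFDeriv_congr_of_eqOn {s : Set E} (hs : IsOpen s) {f g : E → F}
    (h : Set.EqOn f g s) (m : ℕ) : Set.EqOn (iteratedFDeriv ℝ m f) (iteratedFDeriv ℝ m g) s :=
  fun _ hx => (Filter.EventuallyEq.iteratedFDeriv ℝ (h.eventuallyEq_of_mem (hs.mem_nhds hx)) m).eq_of_nhds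

lemma norm_iteratedFDeriv_succ_sub (f : E → F) (m : ℕ) (x y : E) :
    ‖iteratedFDeriv ℝ (m + 1) f x - iteratedFDeriv ℝ (m + 1) f y‖ =
      ‖iteratedFDeriv ℝ m (fderiv ℝ f) x - iteratedFDeriv ℝ m (fderiv ℝ f) y‖ := by
  rw [iteratedFDeriv_succ_eq_comp_right, iteratedFDeriv_succ_eq_comp_right, ← dist_eq_norm,
    ← dist_eq_norm]
  exact LinearIsometryEquiv.dist_map _ _ _

lemma norm_iteratedFDeriv_zero_sub (f : E → F) (x y : E) :
    ‖iteratedFDeriv ℝ 0 f x - iteratedFDeriv ℝ 0 f y‖ = ‖f x - f y‖ := by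
  rw [iteratedFDeriv_zero_eq_comp]
  simp only [Function.comp_apply]
  rw [← map_sub, LinearIsometryEquiv.norm_map]

namespace HolderClassWith

variable {C C' α : ℝ} {k : ℕ} {s : Set E} {f g : E → F}

lemma mono_const (h : HolderClassWith C k α s f) (hC : C ≤ C') : HolderClassWith C' k α s f :=
  ⟨h.1, fun m hm => ⟨fun x hx => ((h.2 m hm).1 x hx).trans hC, fun x hx y hy =>
    ((h.2 m hm).2 x hx y hy).trans (by gcongr)⟩⟩

lemma mono_order (h : HolderClassWith C k α s f) {l : ℕ} (hl : l ≤ k) :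
    HolderClassWith C l α s f :=
  ⟨h.1.of_le (by exact_mod_cast hl), fun m hm => h.2 m (hm.trans hl)⟩

lemma mono_set (h : HolderClassWith C k α s f) {t : Set E} (ht : t ⊆ s) :
    HolderClassWith C k α t f :=
  ⟨h.1.mono ht, fun m hm => ⟨fun x hx => (h.2 m hm).1 x (ht hx), fun x hx y hy =>
    (h.2 m hm).2 x (ht hx) y (ht hy)⟩⟩

lemma congr (h : HolderClassWith C k α s f) (hs : IsOpen s) (hfg : Set.EqOn g f s) :
    HolderClassWith C k α s g := by
  refine ⟨h.1.congr hfg, fun m hm => ⟨fun x hx => ?_, fun x hx y hy => ?_⟩⟩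
  · rw [iteratedFDeriv_congr_of_eqOn hs hfg m hx]; exact (h.2 m hm).1 x hx
  · rw [iteratedFDeriv_congr_of_eqOn hs hfg m hx, iteratedFDeriv_congr_of_eqOn hs hfg m hy]
    exact (h.2 m hm).2 x hx y hy

lemma bound (h : HolderClassWith C k α s f) {x : E} (hx : x ∈ s) : ‖f x‖ ≤ C := by
  simpa using (h.2 0 (Nat.zero_le _)).1 x hx

lemma holder (h : HolderClassWith C k α s f) {x y : E} (hx : x ∈ s) (hy : y ∈ s) :
    ‖f x - f y‖ ≤ C * ‖x - y‖ ^ α := by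
  simpa [norm_iteratedFDeriv_zero_sub] using (h.2 0 (Nat.zero_le _)).2 x hx y hy

lemma nonneg (h : HolderClassWith C k α s f) {x : E} (hx : x ∈ s) : 0 ≤ C :=
  (norm_nonneg _).trans (h.bound hx)

lemma zero_iff : HolderClassWith C 0 α s f ↔ ContinuousOn f s ∧ (∀ x ∈ s, ‖f x‖ ≤ C) ∧
    ∀ x ∈ s, ∀ y ∈ s, ‖f x - f y‖ ≤ C * ‖x - y‖ ^ α := by
  constructor
  · intro h
    exact ⟨h.1.continuousOn, fun x hx => h.bound hx, fun x hx y hy => h.holder hx hy⟩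
  · rintro ⟨h0, h1, h2⟩
    refine ⟨by simpa using h0, fun m hm => ?_⟩
    obtain rfl : m = 0 := by omega
    exact ⟨fun x hx => by simpa using h1 x hx, fun x hx y hy => by
      simpa [norm_iteratedFDeriv_zero_sub] using h2 x hx y hy⟩

/-- The Hölder class in recursive form; the stability results below are inductions on the order
through it. -/
lemma succ_iff (hs : IsOpen s) : HolderClassWith C (k + 1) α s f ↔
    HolderClassWith C 0 α s f ∧ DifferentiableOn ℝ f s ∧
      HolderClassWith C k α s (fderiv ℝ f) := by
  constructor
  · intro h
    have h1 := (contDiffOn_succ_iff_fderiv_of_isOpen (n := (k : WithTop ℕ∞)) hs).1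
      (by simpa using h.1)
    refine ⟨h.mono_order (Nat.zero_le _), h1.1, h1.2.2, fun m hm => ⟨fun x hx => ?_,
      fun x hx y hy => ?_⟩⟩
    · rw [norm_iteratedFDeriv_fderiv]; exact (h.2 (m + 1) (by omega)).1 x hx
    · rw [← norm_iteratedFDeriv_succ_sub]; exact (h.2 (m + 1) (by omega)).2 x hx y hy
  · rintro ⟨h0, hd, h1⟩
    refine ⟨?_, fun m hm => ?_⟩
    · have := (contDiffOn_succ_iff_fderiv_of_isOpen (n := (k : WithTop ℕ∞)) (f := f) hs).2
        ⟨hd, by simp, h1.1⟩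
      simpa using this
    · rcases m with _ | m
      · exact h0.2 0 le_rfl
      · refine ⟨fun x hx => ?_, fun x hx y hy => ?_⟩
        · rw [← norm_iteratedFDeriv_fderiv]; exact (h1.2 m (by omega)).1 x hx
        · rw [norm_iteratedFDeriv_succ_sub]; exact (h1.2 m (by omega)).2 x hx y hy

lemma add (hs : IsOpen s) (hf : HolderClassWith C k α s f) (hg : HolderClassWith C' k α s g) :
    HolderClassWith (C + C') k α s (fun x => f x + g x) := by
  have e : ∀ m ≤ k, ∀ x ∈ s, iteratedFDeriv ℝ m (fun x => f x + g x) x =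
      iteratedFDeriv ℝ m f x + iteratedFDeriv ℝ m g x := fun m hm x hx =>
    iteratedFDeriv_add_apply ((hf.1.contDiffAt (hs.mem_nhds hx)).of_le (by exact_mod_cast hm))
      ((hg.1.contDiffAt (hs.mem_nhds hx)).of_le (by exact_mod_cast hm))
  refine ⟨hf.1.add hg.1, fun m hm => ⟨fun x hx => ?_, fun x hx y hy => ?_⟩⟩
  · rw [e m hm x hx]
    exact (norm_add_le _ _).trans (add_le_add ((hf.2 m hm).1 x hx) ((hg.2 m hm).1 x hx))
  · rw [e m hm x hx, e m hm y hy, add_sub_add_comm, add_mul]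
    exact (norm_add_le _ _).trans
      (add_le_add ((hf.2 m hm).2 x hx y hy) ((hg.2 m hm).2 x hx y hy))

lemma neg (hf : HolderClassWith C k α s f) : HolderClassWith C k α s (fun x => -f x) := by
  have e : ∀ m x, iteratedFDeriv ℝ m (fun x => -f x) x = -iteratedFDeriv ℝ m f x := fun m x =>
    iteratedFDeriv_neg_apply
  refine ⟨hf.1.neg, fun m hm => ⟨fun x hx => ?_, fun x hx y hy => ?_⟩⟩
  · rw [e, norm_neg]; exact (hf.2 m hm).1 x hx
  · rw [e, e, ← neg_sub', norm_neg]; exact (hf.2 m hm).2 x hx y hy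

lemma sub (hs : IsOpen s) (hf : HolderClassWith C k α s f) (hg : HolderClassWith C' k α s g) :
    HolderClassWith (C + C') k α s (fun x => f x - g x) := by
  simpa only [sub_eq_add_neg] using hf.add hs hg.neg

end HolderClassWith

/-! ### Products, compositions and commutators in Hölder classes. -/

open HolderClassWith

/-- The constant is chosen before the set and the functions; this uniformity later makes the bounds
independent of the base point `y`. -/
lemma HolderClassWith.bilinear (k : ℕ) {α : ℝ} (B : F →L[ℝ] G →L[ℝ] H) (C₁ C₂ : ℝ) :
    ∃ C, ∀ {s : Set E} {f : E → F} {g : E → G}, IsOpen s → HolderClassWith C₁ k α s f →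
      HolderClassWith C₂ k α s g → HolderClassWith C k α s (fun x => B (f x) (g x)) := by
  have base : ∀ {F G H : Type u} [NormedAddCommGroup F] [NormedSpace ℝ F] [NormedAddCommGroup G]
      [NormedSpace ℝ G] [NormedAddCommGroup H] [NormedSpace ℝ H] (B : F →L[ℝ] G →L[ℝ] H)
      {s : Set E} {f : E → F} {g : E → G}, HolderClassWith C₁ 0 α s f →
      HolderClassWith C₂ 0 α s g →
        HolderClassWith (2 * (‖B‖ * C₁ * C₂)) 0 α s (fun x => B (f x) (g x)) := by
    intro F G H _ _ _ _ _ _ B s f g hf hg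
    have hfc := hf.1.continuousOn
    have hgc := hg.1.continuousOn
    refine zero_iff.2 ⟨by fun_prop, fun x hx => ?_, fun x hx y hy => ?_⟩
    · have h1 := hf.nonneg hx
      have h2 := hg.nonneg hx
      calc ‖B (f x) (g x)‖ ≤ ‖B‖ * ‖f x‖ * ‖g x‖ := B.le_opNorm₂ _ _
        _ ≤ ‖B‖ * C₁ * C₂ := by gcongr <;> [exact hf.bound hx; exact hg.bound hx]
        _ ≤ _ := by linarith [show 0 ≤ ‖B‖ * C₁ * C₂ by positivity]
    · have h1 := hf.nonneg hx
      have h2 := hg.nonneg hx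
      have e : B (f x) (g x) - B (f y) (g y) = B (f x - f y) (g x) + B (f y) (g x - g y) := by
        simp
      rw [e]
      calc _ ≤ ‖B‖ * ‖f x - f y‖ * ‖g x‖ + ‖B‖ * ‖f y‖ * ‖g x - g y‖ :=
            (norm_add_le _ _).trans (add_le_add (B.le_opNorm₂ _ _) (B.le_opNorm₂ _ _))
        _ ≤ ‖B‖ * (C₁ * ‖x - y‖ ^ α) * C₂ + ‖B‖ * C₁ * (C₂ * ‖x - y‖ ^ α) := by
            gcongr <;> [exact hf.holder hx hy; exact hg.bound hx; exact hf.bound hy;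
              exact hg.holder hx hy]
        _ = _ := by ring
  induction k generalizing F G H with
  | zero => exact ⟨_, fun _ hf hg => base B hf hg⟩
  | succ k ih =>
    obtain ⟨Ca, ha⟩ := ih (B.precompR E)
    obtain ⟨Cb, hb⟩ := ih (B.precompL E)
    refine ⟨max (2 * (‖B‖ * C₁ * C₂)) (Ca + Cb), fun {s f g} hs hf hg => ?_⟩
    have hf' := (succ_iff hs).1 hf
    have hg' := (succ_iff hs).1 hg
    refine (succ_iff hs).2 ⟨(base B hf'.1 hg'.1).mono_const (le_max_left _ _), fun x hx => ?_, ?_⟩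
    · have h1 := hf'.2.1 x hx
      have h2 := hg'.2.1 x hx
      exact (B.hasFDerivWithinAt_of_bilinear h1.hasFDerivWithinAt
        h2.hasFDerivWithinAt).differentiableWithinAt
    · refine (((ha hs (hf.mono_order (Nat.le_succ k)) hg'.2.2).add hs
        (hb hs hf'.2.2 (hg.mono_order (Nat.le_succ k)))).mono_const (le_max_right _ _)).congr hs ?_
      intro x hx
      exact B.fderiv_of_bilinear (hf'.2.1.differentiableAt (hs.mem_nhds hx))
        (hg'.2.1.differentiableAt (hs.mem_nhds hx))

/-- The Lipschitz bound on the inner map is a separate assumption: at order zero its Hölder bound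
alone would only give exponent `α²` for the composition. -/
lemma HolderClassWith.comp (k : ℕ) {α : ℝ} (hα : 0 ≤ α) (C₁ C₂ L : ℝ) :
    ∃ C, ∀ {s : Set E} {t : Set D} {f : E → F} {g : D → E}, IsOpen s → IsOpen t →
      Set.MapsTo g t s → HolderClassWith C₁ k α s f → HolderClassWith C₂ k α t g →
      (∀ x ∈ t, ∀ y ∈ t, ‖g x - g y‖ ≤ L * ‖x - y‖) → HolderClassWith C k α t (fun x => f (g x)) := by
  have base : ∀ {F : Type u} [NormedAddCommGroup F] [NormedSpace ℝ F] {s : Set E} {t : Set D}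
      {f : E → F} {g : D → E}, Set.MapsTo g t s → HolderClassWith C₁ 0 α s f →
      ContinuousOn g t → (∀ x ∈ t, ∀ y ∈ t, ‖g x - g y‖ ≤ L * ‖x - y‖) →
      HolderClassWith (max C₁ (C₁ * |L| ^ α)) 0 α t (fun x => f (g x)) := by
    intro F _ _ s t f g hm hf hg hL
    refine zero_iff.2 ⟨hf.1.continuousOn.comp hg hm, fun x hx =>
      (hf.bound (hm hx)).trans (le_max_left _ _), fun x hx y hy => ?_⟩
    have hC := hf.nonneg (hm hx)
    calc ‖f (g x) - f (g y)‖ ≤ C₁ * ‖g x - g y‖ ^ α := hf.holder (hm hx) (hm hy)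
      _ ≤ C₁ * (|L| * ‖x - y‖) ^ α := by
          gcongr
          exact (hL x hx y hy).trans (by gcongr; exact le_abs_self L)
      _ = C₁ * |L| ^ α * ‖x - y‖ ^ α := by
          rw [Real.mul_rpow (abs_nonneg _) (norm_nonneg _), mul_assoc]
      _ ≤ _ := by gcongr; exact le_max_right _ _
  induction k generalizing F with
  | zero => exact ⟨_, fun _ _ hm hf hg hL => base hm hf hg.1.continuousOn hL⟩
  | succ k ih =>
    obtain ⟨Ca, ha⟩ := ih (F := E →L[ℝ] F)
    obtain ⟨Cb, hb⟩ := HolderClassWith.bilinear (E := D) k (α := α)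
      (ContinuousLinearMap.compL ℝ D E F) Ca C₂
    refine ⟨max (max C₁ (C₁ * |L| ^ α)) Cb, fun {s t f g} hs ht hm hf hg hL => ?_⟩
    have hf' := (succ_iff hs).1 hf
    have hg' := (succ_iff ht).1 hg
    refine (succ_iff ht).2 ⟨(base hm hf'.1 hg.1.continuousOn hL).mono_const (le_max_left _ _),
      hf'.2.1.comp hg'.2.1 hm, ?_⟩
    refine ((hb ht (ha hs ht hm hf'.2.2 (hg.mono_order (Nat.le_succ k)) hL) hg'.2.2).mono_const
      (le_max_right _ _)).congr ht fun x hx => ?_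
    exact fderiv_comp x (hf'.2.1.differentiableAt (hs.mem_nhds (hm hx)))
      (hg'.2.1.differentiableAt (ht.mem_nhds hx))

lemma HolderClass.of_le {k l : ℕ} {α : ℝ} {s : Set E} {f : E → F} (h : HolderClass k α s f)
    (hl : l ≤ k) : HolderClass l α s f :=
  h.imp fun _ h => h.mono_order hl

lemma HolderClass.lieBracket {k : ℕ} {α : ℝ} {s : Set E} (hs : IsOpen s) {V W : E → E}
    (hV : HolderClass (k + 1) α s V) (hW : HolderClass (k + 1) α s W) :
    HolderClass k α s (VectorField.lieBracket ℝ V W) := by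
  obtain ⟨C₁, hV⟩ := hV
  obtain ⟨C₂, hW⟩ := hW
  obtain ⟨Ca, ha⟩ := HolderClassWith.bilinear (E := E) k (α := α)
    (ContinuousLinearMap.id ℝ (E →L[ℝ] E)) C₂ C₁
  obtain ⟨Cb, hb⟩ := HolderClassWith.bilinear (E := E) k (α := α)
    (ContinuousLinearMap.id ℝ (E →L[ℝ] E)) C₁ C₂
  exact ⟨_, (ha hs ((succ_iff hs).1 hW).2.2 (hV.mono_order (Nat.le_succ k))).sub hs
    (hb hs ((succ_iff hs).1 hV).2.2 (hW.mono_order (Nat.le_succ k)))⟩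

lemma holderClass_bracket {n r : ℕ} {α : ℝ} {s : Set E} (hs : IsOpen s)
    {X : Fin (n + 1) → E → E} (hX : ∀ i, HolderClass (r - fieldWeight i) α s (X i))
    {I : List (Fin (n + 1))} (hI : I ∈ multiindices n r) :
    HolderClass (r - weight I) α s (bracket X I) := by
  refine nonempty_list_induction (P := fun I => weight I ≤ r →
    HolderClass (r - weight I) α s (bracket X I)) ?_ ?_ I hI.1 hI.2
  · intro i _; simpa [bracket] using hX i
  · intro i J hJ ih hw
    have h1 := weight_pos hJ
    have h2 := fieldWeight_pos i
    rw [weight_cons] at hw ⊢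
    rw [bracket_cons X i hJ]
    exact HolderClass.lieBracket hs ((hX i).of_le (by omega)) ((ih (by omega)).of_le (by omega))

/-- A jointly smooth family restricts to a bounded family in every Hölder class on small balls. -/
lemma exists_holderClassWith_of_contDiffOn [ProperSpace D] {Q : Type*} [NormedAddCommGroup Q]
    [NormedSpace ℝ Q] [ProperSpace Q] (k : ℕ) {α : ℝ} (hα₀ : 0 < α) (hα₁ : α ≤ 1)
    {O : Set (D × Q)} (hO : IsOpen O) {a : D} {q₀ : Q} {ε : ℝ}
    (hε : Metric.closedBall a ε ×ˢ Metric.closedBall q₀ ε ⊆ O) {f : D × Q → F}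
    (hf : ContDiffOn ℝ ∞ f O) :
    ∃ C, ∀ q ∈ Metric.closedBall q₀ ε,
      HolderClassWith C k α (Metric.ball a ε) (fun u => f (u, q)) := by
  have hd : ∀ {F : Type u} [NormedAddCommGroup F] [NormedSpace ℝ F] {f : D × Q → F}
      (hf : ContDiffOn ℝ ∞ f O) (p : D × Q) (hp : p ∈ O),
      HasFDerivAt (fun u => f (u, p.2)) (fderiv ℝ f p ∘L .inl ℝ D Q) p.1 := by
    intro F _ _ f hf p hp
    have h1 : HasFDerivAt f (fderiv ℝ f p) (p.1, p.2) :=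
      ((hf.contDiffAt (hO.mem_nhds hp)).differentiableAt (by simp)).hasFDerivAt
    exact h1.comp p.1 (hasFDerivAt_prodMk_left p.1 p.2)
  have hd' : ∀ {F : Type u} [NormedAddCommGroup F] [NormedSpace ℝ F] {f : D × Q → F}
      (hf : ContDiffOn ℝ ∞ f O),
      ContDiffOn ℝ ∞ (fun p => fderiv ℝ f p ∘L .inl ℝ D Q) O := fun hf =>
    (hf.fderiv_of_isOpen hO (by simp)).clm_comp contDiffOn_const
  have hmem : ∀ q ∈ Metric.closedBall q₀ ε, ∀ u ∈ Metric.ball a ε, (u, q) ∈ O := fun q hq u hu =>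
    hε ⟨Metric.ball_subset_closedBall hu, hq⟩
  have hcomp : IsCompact (Metric.closedBall a ε ×ˢ Metric.closedBall q₀ ε) :=
    (isCompact_closedBall a ε).prod (isCompact_closedBall q₀ ε)
  have base : ∀ {F : Type u} [NormedAddCommGroup F] [NormedSpace ℝ F] {f : D × Q → F}
      (hf : ContDiffOn ℝ ∞ f O), ∃ C, ∀ q ∈ Metric.closedBall q₀ ε,
      HolderClassWith C 0 α (Metric.ball a ε) (fun u => f (u, q)) := by
    intro F _ _ f hf
    obtain ⟨C₀, hC₀⟩ := hcomp.exists_bound_of_continuousOn (hf.continuousOn.mono hε)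
    obtain ⟨C₁, hC₁⟩ := hcomp.exists_bound_of_continuousOn ((hd' hf).continuousOn.mono hε)
    refine ⟨max C₀ (|C₁| * (2 * |ε|) ^ (1 - α)), fun q hq => zero_iff.2 ⟨?_, ?_, ?_⟩⟩
    · exact hf.continuousOn.comp (by fun_prop) fun u hu => hmem q hq u hu
    · exact fun u hu => (hC₀ _ ⟨Metric.ball_subset_closedBall hu, hq⟩).trans (le_max_left _ _)
    · intro x hx y hy
      have h1 := (convex_ball a ε).norm_image_sub_le_of_norm_hasFDerivWithin_le (C := |C₁|)
        (f := fun u => f (u, q))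
        (fun u hu => (hd hf (u, q) (hmem q hq u hu)).hasFDerivWithinAt)
        (fun u hu => (hC₁ _ ⟨Metric.ball_subset_closedBall hu, hq⟩).trans (le_abs_self _)) hy hx
      refine h1.trans ?_
      have h2 : ‖x - y‖ ≤ 2 * |ε| := by
        rw [← dist_eq_norm]
        have h3 := Metric.mem_ball.1 hx
        have h4 := Metric.mem_ball.1 hy
        have := dist_triangle_right x y a
        have := le_abs_self ε
        linarith
      -- A Lipschitz bound on a bounded set yields a Hölder bound, at the cost of a power of the
      -- diameter.
      have h3 : ‖x - y‖ = ‖x - y‖ ^ (1 - α) * ‖x - y‖ ^ α := by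
        rw [← Real.rpow_add_of_nonneg (norm_nonneg _) (by linarith) hα₀.le, sub_add_cancel,
          Real.rpow_one]
      calc |C₁| * ‖x - y‖ = |C₁| * ‖x - y‖ ^ (1 - α) * ‖x - y‖ ^ α := by
            rw [mul_assoc, ← h3]
        _ ≤ |C₁| * (2 * |ε|) ^ (1 - α) * ‖x - y‖ ^ α := by
            gcongr
        _ ≤ _ := by gcongr; exact le_max_right _ _
  induction k generalizing F with
  | zero => exact base hf
  | succ k ih =>
    obtain ⟨Ca, ha⟩ := base hf
    obtain ⟨Cb, hb⟩ := ih (hd' hf)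
    refine ⟨max Ca Cb, fun q hq => (succ_iff Metric.isOpen_ball).2
      ⟨(ha q hq).mono_const (le_max_left _ _), fun u hu => ?_, ?_⟩⟩
    · exact (hd hf (u, q) (hmem q hq u hu)).differentiableAt.differentiableWithinAt
    · exact ((hb q hq).mono_const (le_max_right _ _)).congr Metric.isOpen_ball fun u hu =>
        (hd hf (u, q) (hmem q hq u hu)).fderiv

end Holder

/-! ### Taylor polynomials -/

section Taylor

universe u

variable {E F G H : Type u} [NormedAddCommGroup E] [NormedSpace ℝ E] [NormedAddCommGroup F]
  [NormedSpace ℝ F] [NormedAddCommGroup G] [NormedSpace ℝ G] [NormedAddCommGroup H]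
  [NormedSpace ℝ H]

/-! ### Symmetry of higher derivatives and differentiation of Taylor polynomials. -/

lemma iteratedFDeriv_apply_of_eventuallyEq (T : F →L[ℝ] G) {g : E → F} {g' : E → G} {k : ℕ} {y : E}
    (hg : ContDiffAt ℝ k g y) (h : g' =ᶠ[𝓝 y] T ∘ g) (m : Fin k → E) :
    iteratedFDeriv ℝ k g' y m = T (iteratedFDeriv ℝ k g y m) := by
  rw [(Filter.EventuallyEq.iteratedFDeriv ℝ h k).eq_of_nhds, T.iteratedFDeriv_comp_left hg le_rfl]
  rfl

/-- The second derivative is fixed by transposition on a whole neighbourhood of `y`, and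
transposition, being linear, commutes with further differentiation. -/
lemma iteratedFDeriv_fderiv_fderiv_swap {f : E → F} {k : ℕ} {y : E}
    (hf : ContDiffAt ℝ (k + 2 : ℕ) f y) (m : Fin k → E) (v w : E) :
    iteratedFDeriv ℝ k (fderiv ℝ (fderiv ℝ f)) y m v w =
      iteratedFDeriv ℝ k (fderiv ℝ (fderiv ℝ f)) y m w v := by
  obtain ⟨T, hT⟩ : ∃ T : (E →L[ℝ] E →L[ℝ] F) →L[ℝ] (E →L[ℝ] E →L[ℝ] F),
      ∀ S a b, T S a b = S b a :=
    ⟨(ContinuousLinearMap.flipₗᵢ ℝ E E F).toLinearIsometry.toContinuousLinearMap,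
      fun _ _ _ => rfl⟩
  have h1 : fderiv ℝ (fderiv ℝ f) =ᶠ[𝓝 y] T ∘ fderiv ℝ (fderiv ℝ f) := by
    have h2 : ContDiffAt ℝ 2 f y := hf.of_le (by norm_cast; omega)
    filter_upwards [h2.eventually (by simp)] with x hx
    ext a b
    rw [Function.comp_apply, hT]
    exact (hx.isSymmSndFDerivAt (by simp)).eq a b
  have h4 : ContDiffAt ℝ k (fderiv ℝ (fderiv ℝ f)) y :=
    (hf.fderiv_right (m := (k + 1 : ℕ)) (by norm_cast)).fderiv_right (by norm_cast)
  have h5 : iteratedFDeriv ℝ k (fderiv ℝ (fderiv ℝ f)) y m =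
      T (iteratedFDeriv ℝ k (fderiv ℝ (fderiv ℝ f)) y m) :=
    iteratedFDeriv_apply_of_eventuallyEq (F := E →L[ℝ] E →L[ℝ] F) (G := E →L[ℝ] E →L[ℝ] F)
      T h4 h1 m
  conv_lhs => rw [h5]
  exact hT _ v w

/-- Just enough symmetry to differentiate `h ↦ D^{k+1} f (h, …, h)`: the single different argument
may be moved to the last slot. -/
lemma iteratedFDeriv_update_const {f : E → F} {k : ℕ} {y : E}
    (hf : ContDiffAt ℝ (k + 1 : ℕ) f y) (i : Fin (k + 1)) (v h : E) :
    iteratedFDeriv ℝ (k + 1) f y (Function.update (fun _ => v) i h) =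
      iteratedFDeriv ℝ k (fderiv ℝ f) y (fun _ => v) h := by
  induction k generalizing F with
  | zero =>
    obtain rfl : i = 0 := by ext; omega
    rw [iteratedFDeriv_succ_apply_right]
    simp
  | succ k ih =>
    rw [iteratedFDeriv_succ_apply_right]
    induction i using Fin.lastCases with
    | last =>
      rw [Fin.init_update_last, Function.update_self]
      rfl
    | cast j =>
      have h1 : Fin.init (Function.update (fun _ => v) j.castSucc h : Fin (k + 2) → E) =
          Function.update (fun _ => v) j h := by
        rw [Fin.init_update_castSucc]; rfl
      rw [h1, ih ((hf.fderiv_right (m := (k + 1 : ℕ)) (by norm_cast))) j,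
        Function.update_of_ne (Fin.castSucc_ne_last j).symm,
        iteratedFDeriv_fderiv_fderiv_swap hf, iteratedFDeriv_succ_apply_right]
      rfl

lemma taylorPoly_self (k : ℕ) (f : E → F) (y : E) : taylorPoly k f y y = f y := by
  rw [taylorPoly, Finset.sum_range_succ']
  simp [ContinuousMultilinearMap.map_zero, sub_self, ← Pi.zero_def]

lemma contDiff_taylorPoly (k : ℕ) (f : E → F) (y : E) {N : WithTop ℕ∞} :
    ContDiff ℝ N (taylorPoly k f y) := by
  refine ContDiff.sum fun m _ => contDiff_const.smul ?_
  exact (iteratedFDeriv ℝ m f y).contDiff.comp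
    (contDiff_pi.2 fun _ => contDiff_id.sub contDiff_const)

lemma fderiv_taylorPoly {k : ℕ} {f : E → F} {y : E} (hf : ContDiffAt ℝ (k + 1 : ℕ) f y) (x : E) :
    fderiv ℝ (taylorPoly (k + 1) f y) x = taylorPoly k (fderiv ℝ f) y x := by
  have h1 : ∀ m ∈ Finset.range (k + 1), HasFDerivAt
      (fun x => (((m + 1).factorial : ℝ)⁻¹) • iteratedFDeriv ℝ (m + 1) f y (fun _ => x - y))
      (((m.factorial : ℝ)⁻¹) • iteratedFDeriv ℝ m (fderiv ℝ f) y (fun _ => x - y)) x := by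
    intro m hm
    have h2 : HasFDerivAt (fun x : E => (fun _ : Fin (m + 1) => x - y))
        (ContinuousLinearMap.pi fun _ => ContinuousLinearMap.id ℝ E) x :=
      hasFDerivAt_pi.2 fun _ => (hasFDerivAt_id x).sub_const y
    have h3 := (((iteratedFDeriv ℝ (m + 1) f y).hasFDerivAt (fun _ => x - y)).comp x h2).const_smul
      (((m + 1).factorial : ℝ)⁻¹)
    refine h3.congr_fderiv ?_
    ext h
    have h4 : ContDiffAt ℝ (m + 1 : ℕ) f y :=
      hf.of_le (by norm_cast; have := Finset.mem_range.1 hm; omega)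
    simp only [smul_apply, ContinuousLinearMap.comp_apply,
      ContinuousMultilinearMap.linearDeriv_apply, ContinuousLinearMap.pi_apply,
      ContinuousLinearMap.id_apply, iteratedFDeriv_update_const h4, Finset.sum_const,
      Finset.card_univ, Fintype.card_fin]
    rw [← Nat.cast_smul_eq_nsmul ℝ, smul_smul, Nat.factorial_succ]
    congr 1
    push_cast
    field_simp
  have h5 : taylorPoly (k + 1) f y = fun x => (∑ m ∈ Finset.range (k + 1),
      (((m + 1).factorial : ℝ)⁻¹) • iteratedFDeriv ℝ (m + 1) f y (fun _ => x - y)) + f y := by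
    ext x
    rw [taylorPoly, Finset.sum_range_succ']
    simp
  rw [h5]
  exact ((HasFDerivAt.fun_sum h1).add_const (f y)).fderiv

/-- `f` vanishes at `y` to order `k + α` together with its derivatives: the derivatives of
order `m ≤ k` are bounded by `C |x - y|^{k - m + α}` on `s`. -/
def FlatWith (C : ℝ) (k : ℕ) (α : ℝ) (y : E) (s : Set E) (f : E → F) : Prop :=
  ContDiffOn ℝ k f s ∧ ∀ m ≤ k, ∀ x ∈ s,
    ‖iteratedFDeriv ℝ m f x‖ ≤ C * ‖x - y‖ ^ (((k - m : ℕ) : ℝ) + α)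

namespace FlatWith

variable {C C' α : ℝ} {k : ℕ} {y : E} {s : Set E} {f g : E → F}

lemma zero_iff : FlatWith C 0 α y s f ↔ ContinuousOn f s ∧ ∀ x ∈ s, ‖f x‖ ≤ C * ‖x - y‖ ^ α := by
  constructor
  · intro h
    exact ⟨h.1.continuousOn, fun x hx => by simpa using h.2 0 le_rfl x hx⟩
  · rintro ⟨h0, h1⟩
    refine ⟨by simpa using h0, fun m hm x hx => ?_⟩
    obtain rfl : m = 0 := by omega
    simpa using h1 x hx

lemma bound (h : FlatWith C k α y s f) {x : E} (hx : x ∈ s) :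
    ‖f x‖ ≤ C * ‖x - y‖ ^ ((k : ℝ) + α) := by
  simpa using h.2 0 (Nat.zero_le _) x hx

lemma mono_const (h : FlatWith C k α y s f) (hC : C ≤ C') : FlatWith C' k α y s f :=
  ⟨h.1, fun m hm x hx => (h.2 m hm x hx).trans (by gcongr)⟩

lemma congr (h : FlatWith C k α y s f) (hs : IsOpen s) (hfg : Set.EqOn g f s) :
    FlatWith C k α y s g := by
  refine ⟨h.1.congr hfg, fun m hm x hx => ?_⟩
  rw [iteratedFDeriv_congr_of_eqOn hs hfg m hx]; exact h.2 m hm x hx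

lemma succ_iff (hs : IsOpen s) : FlatWith C (k + 1) α y s f ↔
    (∀ x ∈ s, ‖f x‖ ≤ C * ‖x - y‖ ^ (((k + 1 : ℕ) : ℝ) + α)) ∧ DifferentiableOn ℝ f s ∧
      FlatWith C k α y s (fderiv ℝ f) := by
  constructor
  · intro h
    have h1 := (contDiffOn_succ_iff_fderiv_of_isOpen (n := (k : WithTop ℕ∞)) hs).1
      (by simpa using h.1)
    refine ⟨fun x hx => h.bound hx, h1.1, h1.2.2, fun m hm x hx => ?_⟩
    rw [norm_iteratedFDeriv_fderiv]
    simpa using h.2 (m + 1) (by omega) x hx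
  · rintro ⟨h0, hd, h1⟩
    refine ⟨?_, fun m hm x hx => ?_⟩
    · have := (contDiffOn_succ_iff_fderiv_of_isOpen (n := (k : WithTop ℕ∞)) (f := f) hs).2
        ⟨hd, by simp, h1.1⟩
      simpa using this
    · rcases m with _ | m
      · simpa using h0 x hx
      · rw [← norm_iteratedFDeriv_fderiv]
        simpa using h1.2 m (by omega) x hx

lemma add (hs : IsOpen s) (hf : FlatWith C k α y s f) (hg : FlatWith C' k α y s g) :
    FlatWith (C + C') k α y s (fun x => f x + g x) := by
  refine ⟨hf.1.add hg.1, fun m hm x hx => ?_⟩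
  have e : iteratedFDeriv ℝ m (fun x => f x + g x) x =
      iteratedFDeriv ℝ m f x + iteratedFDeriv ℝ m g x :=
    iteratedFDeriv_add_apply ((hf.1.contDiffAt (hs.mem_nhds hx)).of_le (by exact_mod_cast hm))
      ((hg.1.contDiffAt (hs.mem_nhds hx)).of_le (by exact_mod_cast hm))
  rw [e, add_mul]
  exact (norm_add_le _ _).trans (add_le_add (hf.2 m hm x hx) (hg.2 m hm x hx))

lemma neg (hf : FlatWith C k α y s f) : FlatWith C k α y s (fun x => -f x) := by
  refine ⟨hf.1.neg, fun m hm x hx => ?_⟩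
  have e : iteratedFDeriv ℝ m (fun x => -f x) x = -iteratedFDeriv ℝ m f x :=
    iteratedFDeriv_neg_apply
  rw [e, norm_neg]; exact hf.2 m hm x hx

lemma mono_order (hα : 0 ≤ α) (hs1 : ∀ x ∈ s, ‖x - y‖ ≤ 1) (hC : 0 ≤ C)
    (h : FlatWith C k α y s f) {l : ℕ} (hl : l ≤ k) : FlatWith C l α y s f := by
  refine ⟨h.1.of_le (by exact_mod_cast hl), fun m hm x hx =>
    (h.2 m (hm.trans hl) x hx).trans ?_⟩
  refine mul_le_mul_of_nonneg_left ?_ hC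
  refine Real.rpow_le_rpow_of_exponent_ge_of_imp (norm_nonneg _) (hs1 x hx) (by gcongr) ?_
  intro h0 h1
  have : (0 : ℝ) ≤ ((l - m : ℕ) : ℝ) := Nat.cast_nonneg _
  have h3 : (((l - m : ℕ)) : ℝ) ≤ ((k - m : ℕ) : ℝ) := by gcongr
  linarith

/-- With exponent `0` the Hölder condition follows from the bound, so the class just records bounds
on derivatives; nothing more is needed of the second factor in products with flat functions. -/
lemma holderClassWith (hα : 0 ≤ α) (hs1 : ∀ x ∈ s, ‖x - y‖ ≤ 1) (hC : 0 ≤ C)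
    (h : FlatWith C k α y s f) : HolderClassWith (2 * C) k 0 s f := by
  have h1 : ∀ m ≤ k, ∀ x ∈ s, ‖iteratedFDeriv ℝ m f x‖ ≤ C := fun m hm x hx =>
    (h.2 m hm x hx).trans (mul_le_of_le_one_right hC
      (Real.rpow_le_one (norm_nonneg _) (hs1 x hx) (by positivity)))
  refine ⟨h.1, fun m hm => ⟨fun x hx => (h1 m hm x hx).trans (by linarith), fun x hx z hz => ?_⟩⟩
  rw [Real.rpow_zero, mul_one, two_mul]
  exact (norm_sub_le _ _).trans (add_le_add (h1 m hm x hx) (h1 m hm z hz))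

end FlatWith

lemma HolderClassWith.holder_zero {C α : ℝ} {k : ℕ} {s : Set E} {f : E → F}
    (h : HolderClassWith C k α s f) (hC : 0 ≤ C) : HolderClassWith (2 * C) k 0 s f := by
  refine ⟨h.1, fun m hm => ⟨fun x hx => ((h.2 m hm).1 x hx).trans (by linarith),
    fun x hx z hz => ?_⟩⟩
  rw [Real.rpow_zero, mul_one, two_mul]
  exact (norm_sub_le _ _).trans (add_le_add ((h.2 m hm).1 x hx) ((h.2 m hm).1 z hz))

/-- Taylor's formula with Hölder continuous remainder. -/
lemma HolderClassWith.flatWith_sub_taylorPoly {C α : ℝ} (hα : 0 ≤ α) {k : ℕ} {s : Set E}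
    (hs : IsOpen s) (hsc : Convex ℝ s) {y : E} (hy : y ∈ s) {f : E → F}
    (hf : HolderClassWith C k α s f) :
    FlatWith C k α y s (fun x => f x - taylorPoly k f y x) := by
  induction k generalizing F with
  | zero =>
    refine FlatWith.zero_iff.2 ⟨hf.1.continuousOn.sub (contDiff_taylorPoly 0 f y
      (N := 0)).continuous.continuousOn, fun x hx => ?_⟩
    simpa [taylorPoly] using hf.holder hx hy
  | succ k ih =>
    have hf' := (HolderClassWith.succ_iff hs).1 hf
    have hfd : ∀ x ∈ s, HasFDerivAt (fun x => f x - taylorPoly (k + 1) f y x)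
        (fderiv ℝ f x - taylorPoly k (fderiv ℝ f) y x) x := by
      intro x hx
      have h1 : HasFDerivAt (taylorPoly (k + 1) f y) (taylorPoly k (fderiv ℝ f) y x) x := by
        rw [← fderiv_taylorPoly (hf.1.contDiffAt (hs.mem_nhds hy))]
        exact ((contDiff_taylorPoly (k + 1) f y (N := 1)).differentiable (by simp) x).hasFDerivAt
      exact (hf'.2.1.differentiableAt (hs.mem_nhds hx)).hasFDerivAt.sub h1
    have hi := ih hf'.2.2
    have hC := hf.nonneg hy
    refine (FlatWith.succ_iff hs).2 ⟨fun x hx => ?_, fun x hx =>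
      (hfd x hx).differentiableAt.differentiableWithinAt,
      hi.congr hs fun x hx => (hfd x hx).fderiv⟩
    -- The remainder vanishes at `y`; integrating the bound on its derivative along the segment from
    -- `y` to `x` gains one power of the distance.
    have hsub : segment ℝ y x ⊆ s := hsc.segment_subset hy hx
    have h2 := (convex_segment y x).norm_image_sub_le_of_norm_hasFDerivWithin_le
      (C := C * ‖x - y‖ ^ ((k : ℝ) + α))
      (fun z hz => (hfd z (hsub hz)).hasFDerivWithinAt) (fun z hz => ?_)
      (left_mem_segment ℝ y x) (right_mem_segment ℝ y x)
    · rw [taylorPoly_self, sub_self, sub_zero] at h2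
      refine h2.trans (le_of_eq ?_)
      rw [mul_assoc]
      congr 1
      rw [show ((k + 1 : ℕ) : ℝ) + α = (k + α) + 1 by push_cast; ring,
        Real.rpow_add_one' (norm_nonneg _) (by positivity)]
    · refine (hi.bound (hsub hz)).trans ?_
      gcongr
      exact norm_sub_le_of_mem_segment hz

lemma FlatWith.bilinear (k : ℕ) {α : ℝ} (hα : 0 ≤ α) (B : F →L[ℝ] G →L[ℝ] H) (C₁ C₂ : ℝ)
    (hC₁ : 0 ≤ C₁) :
    ∃ C, 0 ≤ C ∧ ∀ {s : Set E} {y : E} {f : E → F} {g : E → G}, IsOpen s → (∀ x ∈ s, ‖x - y‖ ≤ 1) →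
      FlatWith C₁ k α y s f → HolderClassWith C₂ k 0 s g →
        FlatWith C k α y s (fun x => B (f x) (g x)) := by
  have base : ∀ {F G H : Type u} [NormedAddCommGroup F] [NormedSpace ℝ F] [NormedAddCommGroup G]
      [NormedSpace ℝ G] [NormedAddCommGroup H] [NormedSpace ℝ H] (B : F →L[ℝ] G →L[ℝ] H) {k : ℕ}
      {s : Set E} {y : E} {f : E → F} {g : E → G}, FlatWith C₁ k α y s f →
      HolderClassWith C₂ k 0 s g → ∀ x ∈ s,
        ‖B (f x) (g x)‖ ≤ (‖B‖ * C₁ * |C₂|) * ‖x - y‖ ^ ((k : ℝ) + α) := by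
    intro F G H _ _ _ _ _ _ B k s y f g hf hg x hx
    calc ‖B (f x) (g x)‖ ≤ ‖B‖ * ‖f x‖ * ‖g x‖ := B.le_opNorm₂ _ _
      _ ≤ ‖B‖ * (C₁ * ‖x - y‖ ^ ((k : ℝ) + α)) * |C₂| := by
        gcongr <;> [exact hf.bound hx; exact (hg.bound hx).trans (le_abs_self _)]
      _ = _ := by ring
  induction k generalizing F G H with
  | zero =>
    refine ⟨‖B‖ * C₁ * |C₂|, by positivity, fun _ _ hf hg => FlatWith.zero_iff.2 ⟨?_, ?_⟩⟩
    · have := hf.1.continuousOn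
      have := hg.1.continuousOn
      fun_prop
    · simpa using base B hf hg
  | succ k ih =>
    obtain ⟨Ca, hCa, ha⟩ := ih (B.precompR E)
    obtain ⟨Cb, hCb, hb⟩ := ih (B.precompL E)
    refine ⟨max (‖B‖ * C₁ * |C₂|) (Ca + Cb), by positivity, fun {s y f g} hs hs1 hf hg => ?_⟩
    have hf' := (FlatWith.succ_iff hs).1 hf
    have hg' := (HolderClassWith.succ_iff hs).1 hg
    refine (FlatWith.succ_iff hs).2 ⟨fun x hx => (base B hf hg x hx).trans
      (by gcongr; exact le_max_left _ _), fun x hx => ?_, ?_⟩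
    · exact (B.hasFDerivWithinAt_of_bilinear (hf'.2.1 x hx).hasFDerivWithinAt
        (hg'.2.1 x hx).hasFDerivWithinAt).differentiableWithinAt
    · refine (((ha hs hs1 (hf.mono_order hα hs1 hC₁ (Nat.le_succ k)) hg'.2.2).add hs
        (hb hs hs1 hf'.2.2 (hg.mono_order (Nat.le_succ k)))).mono_const
          (le_max_right _ _)).congr hs ?_
      intro x hx
      exact B.fderiv_of_bilinear (hf'.2.1.differentiableAt (hs.mem_nhds hx))
        (hg'.2.1.differentiableAt (hs.mem_nhds hx))

/-- The commutators of the fields and of their Taylor approximations at `y` agree at `y`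
up to the weighted order of smoothness. -/
theorem exists_flatWith_bracket_sub {n r : ℕ} {α : ℝ} (hα : 0 ≤ α) {s : Set E} (hs : IsOpen s)
    (hsc : Convex ℝ s) (hs1 : ∀ x ∈ s, ∀ y ∈ s, ‖x - y‖ ≤ 1) {X : Fin (n + 1) → E → E}
    (hX : ∀ i, HolderClass (r - fieldWeight i) α s (X i))
    {I : List (Fin (n + 1))} (hI : I ∈ multiindices n r) :
    ∃ C, 0 ≤ C ∧ ∀ y ∈ s, FlatWith C (r - weight I) α y s
      (fun x => bracket X I x - bracket (approxField r X y) I x) := by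
  have key : ∀ I ∈ multiindices n r, ∃ C, 0 ≤ C ∧ HolderClassWith C (r - weight I) 0 s (bracket X I) := by
    intro I hI
    obtain ⟨C, hC⟩ := holderClass_bracket hs hX hI
    exact ⟨2 * |C|, by positivity, (hC.mono_const (le_abs_self C)).holder_zero (abs_nonneg C)⟩
  have single : ∀ i, ∃ C, 0 ≤ C ∧ ∀ y ∈ s, FlatWith C (r - fieldWeight i) α y s
      (fun x => X i x - approxField r X y i x) := by
    intro i
    obtain ⟨C, hC⟩ := hX i
    exact ⟨|C|, abs_nonneg C, fun y hy =>
      (hC.mono_const (le_abs_self C)).flatWith_sub_taylorPoly hα hs hsc hy⟩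
  refine nonempty_list_induction (P := fun I => weight I ≤ r → ∃ C, 0 ≤ C ∧ ∀ y ∈ s,
    FlatWith C (r - weight I) α y s
      (fun x => bracket X I x - bracket (approxField r X y) I x)) ?_ ?_ I hI.1 hI.2
  · intro i _
    simpa [bracket] using single i
  · intro i J hJ ih hw
    have hJw := weight_pos hJ
    have hiw := fieldWeight_pos i
    rw [weight_cons] at hw ⊢
    obtain ⟨Cj, hCj, hj⟩ := ih (by omega)
    obtain ⟨Ci, hCi, hi⟩ := single i
    obtain ⟨Dj, hDj, hj'⟩ := key J ⟨hJ, by omega⟩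
    obtain ⟨Di, hDi, hi'⟩ := key [i] ⟨by simp, by simp [weight_cons, weight_nil]; omega⟩
    have hi' : HolderClassWith Di (r - fieldWeight i) 0 s (X i) := by simpa [bracket] using hi'
    -- Both weights are at least one, so either field is controlled up to order `k + 1` and the
    -- bracket may consume one derivative.
    set k := r - (fieldWeight i + weight J) with hk
    let id' := ContinuousLinearMap.id ℝ (E →L[ℝ] E)
    obtain ⟨c₁, hc₁, h₁⟩ := FlatWith.bilinear (E := E) k hα id' Cj Di hCj
    obtain ⟨c₂, hc₂, h₂⟩ := FlatWith.bilinear (E := E) k hα id'.flip Ci (Dj + 2 * Cj) hCi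
    obtain ⟨c₃, hc₃, h₃⟩ := FlatWith.bilinear (E := E) k hα id' Ci Dj hCi
    obtain ⟨c₄, hc₄, h₄⟩ := FlatWith.bilinear (E := E) k hα id'.flip Cj (Di + 2 * Ci) hCj
    refine ⟨(c₁ + c₂) + (c₃ + c₄), by positivity, fun y hy => ?_⟩
    have hs1' : ∀ x ∈ s, ‖x - y‖ ≤ 1 := fun x hx => hs1 x hx y hy
    have hSj : ContDiff ℝ ∞ (bracket (approxField r X y) J) :=
      contDiff_bracket (fun i => contDiff_taylorPoly _ _ _) J
    have hSi : ContDiff ℝ ∞ (approxField r X y i) := contDiff_taylorPoly _ _ _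
    have fj := (hj y hy).mono_order hα hs1' hCj (l := k + 1) (by omega)
    have fi := (hi y hy).mono_order hα hs1' hCi (l := k + 1) (by omega)
    have gj := hj'.mono_order (l := k + 1) (by omega)
    have gi := hi'.mono_order (l := k + 1) (by omega)
    have sj : HolderClassWith (Dj + 2 * Cj) (k + 1) 0 s (bracket (approxField r X y) J) :=
      (gj.sub hs (fj.holderClassWith hα hs1' hCj)).congr hs fun x _ => by simp
    have si : HolderClassWith (Di + 2 * Ci) (k + 1) 0 s (approxField r X y i) :=
      (gi.sub hs (fi.holderClassWith hα hs1' hCi)).congr hs fun x _ => by simp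
    -- Bilinear splitting of the difference of the two brackets: each of the four terms has a factor
    -- that is a flat difference or its derivative, and another factor with bounded derivatives.
    have e₁ := h₁ hs hs1' ((FlatWith.succ_iff hs).1 fj).2.2 (gi.mono_order (Nat.le_succ k))
    have e₂ := h₂ hs hs1' (fi.mono_order hα hs1' hCi (Nat.le_succ k))
      ((HolderClassWith.succ_iff hs).1 sj).2.2
    have e₃ := h₃ hs hs1' ((FlatWith.succ_iff hs).1 fi).2.2 (gj.mono_order (Nat.le_succ k))
    have e₄ := h₄ hs hs1' (fj.mono_order hα hs1' hCj (Nat.le_succ k))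
      ((HolderClassWith.succ_iff hs).1 si).2.2
    refine ((e₁.add hs e₂).add hs (e₃.add hs e₄).neg).congr hs fun x hx => ?_
    have dj := ((HolderClassWith.succ_iff hs).1 gj).2.1.differentiableAt (hs.mem_nhds hx)
    have di := ((HolderClassWith.succ_iff hs).1 gi).2.1.differentiableAt (hs.mem_nhds hx)
    simp only [bracket_cons _ i hJ, VectorField.lieBracket, id',
      ContinuousLinearMap.coe_id', id_eq, ContinuousLinearMap.flip_apply]
    rw [fderiv_fun_sub dj (hSj.differentiable (by simp) x),
      fderiv_fun_sub di (hSi.differentiable (by simp) x)]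
    simp only [sub_apply, map_sub]
    abel

end Taylor

/-! ### Smooth dependence of flows on parameters -/

section Flow

universe u

variable {K : Type*} [TopologicalSpace K] [CompactSpace K]
  {A B D E Q P : Type u} [NormedAddCommGroup A] [NormedSpace ℝ A]
  [NormedAddCommGroup B] [NormedSpace ℝ B] [NormedAddCommGroup D] [NormedSpace ℝ D]
  [NormedAddCommGroup E] [NormedSpace ℝ E] [NormedAddCommGroup Q] [NormedSpace ℝ Q]
  [NormedAddCommGroup P] [NormedSpace ℝ P]

/-- Pointwise application as a continuous bilinear map on spaces of continuous functions. -/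
def pointwiseApply (K : Type*) [TopologicalSpace K] [CompactSpace K] (A B : Type u)
    [NormedAddCommGroup A] [NormedSpace ℝ A] [NormedAddCommGroup B] [NormedSpace ℝ B] :
    C(K, A →L[ℝ] B) →L[ℝ] C(K, A) →L[ℝ] C(K, B) :=
  LinearMap.mkContinuous₂ (LinearMap.mk₂ ℝ
    (fun (a : C(K, A →L[ℝ] B)) (h : C(K, A)) => (⟨fun t => a t (h t), by fun_prop⟩ : C(K, B)))
    (fun a b h => by ext; simp) (fun c a h => by ext; simp) (fun a h k => by ext; simp)
    (fun c a h => by ext; simp)) 1 fun a h => by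
      rw [one_mul, ContinuousMap.norm_le _ (by positivity)]
      intro t
      exact (a t).le_of_opNorm_le_of_le (a.norm_coe_le_norm t) (h.norm_coe_le_norm t)

/-- The pointwise mean value inequality is made uniform in `t` by the continuity of composition with
`fderiv ℝ H` in the sup norm. -/
lemma hasFDerivAt_postcomp {H : A → B} (hH : ContDiff ℝ 1 H) (γ : C(K, A)) :
    HasFDerivAt (fun γ : C(K, A) => (⟨H, hH.continuous⟩ : C(A, B)).comp γ)
      (pointwiseApply K A B
        ((⟨fderiv ℝ H, hH.continuous_fderiv (by simp)⟩ : C(A, A →L[ℝ] B)).comp γ)) γ := by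
  rw [hasFDerivAt_iff_isLittleO, Asymptotics.isLittleO_iff]
  intro c hc
  have h1 := (ContinuousMap.continuous_postcomp (X := K)
    (⟨fderiv ℝ H, hH.continuous_fderiv (by simp)⟩ : C(A, A →L[ℝ] B))).continuousAt (x := γ)
  obtain ⟨δ, hδ, h2⟩ := Metric.continuousAt_iff (α := C(K, A)) (β := C(K, A →L[ℝ] B)) |>.1 h1 c hc
  filter_upwards [Metric.ball_mem_nhds γ hδ] with γ' hγ'
  rw [ContinuousMap.norm_le _ (by positivity)]
  intro t
  have hmem : γ' t ∈ Metric.ball (γ t) δ :=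
    (ContinuousMap.dist_apply_le_dist t).trans_lt hγ'
  have h3 := (convex_ball (γ t) δ).norm_image_sub_le_of_norm_hasFDerivWithin_le' (C := c)
    (f := H) (φ := fderiv ℝ H (γ t))
    (fun a _ => (hH.differentiable (by simp) a).hasFDerivAt.hasFDerivWithinAt) (fun a ha => ?_)
    (Metric.mem_ball_self hδ) hmem
  · refine h3.trans ?_
    gcongr
    exact (γ' - γ).norm_coe_le_norm t
  -- A translate of `γ` through the point `a` at time `t` is close to `γ` in the sup norm, so sup
  -- norm continuity controls the derivative at `a`.
  · let γ'' : C(K, A) := γ + ContinuousMap.const K (a - γ t)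
    have h4 : dist γ'' γ < δ := by
      rw [dist_eq_norm, show γ'' - γ = ContinuousMap.const K (a - γ t) by ext; simp [γ'']]
      refine lt_of_le_of_lt ((ContinuousMap.norm_le _ (norm_nonneg _)).2 fun _ => le_rfl) ?_
      exact (dist_eq_norm a (γ t)).symm.trans_lt ha
    have h5 := (ContinuousMap.dist_apply_le_dist (f := _) (g := _) t).trans_lt (h2 h4)
    have h6 : γ'' t = a := by simp [γ'']
    rw [← dist_eq_norm]
    simpa [h6] using h5.le

/-- The derivative of composition with `H` is composition with `fderiv ℝ H` followed by a bounded
bilinear map, so induction applies. -/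
lemma contDiff_postcomp {H : A → B} (hH : ContDiff ℝ ∞ H) :
    ContDiff ℝ ∞ (fun γ : C(K, A) => (⟨H, hH.continuous⟩ : C(A, B)).comp γ) := by
  rw [contDiff_infty]
  intro n
  induction n generalizing B with
  | zero => exact contDiff_zero.2 (ContinuousMap.continuous_postcomp _)
  | succ n ih =>
    have h1 : ContDiff ℝ 1 H := hH.of_le (by simp)
    have h2 : ContDiff ℝ ∞ (fderiv ℝ H) := hH.fderiv_right (by simp)
    push_cast
    refine contDiff_succ_iff_fderiv.2 ⟨fun γ => (hasFDerivAt_postcomp h1 γ).differentiableAt,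
      by simp, ?_⟩
    have h3 : fderiv ℝ (fun γ : C(K, A) => (⟨H, hH.continuous⟩ : C(A, B)).comp γ) =
        fun γ => pointwiseApply K A B ((⟨fderiv ℝ H, h2.continuous⟩ : C(A, A →L[ℝ] B)).comp γ) :=
      funext fun γ => (hasFDerivAt_postcomp h1 γ).fderiv
    rw [h3]
    exact (pointwiseApply K A B).contDiff.comp (ih h2)

/-- The primitive vanishing at `0` of a continuous function on the unit interval. -/
def primitive (E : Type u) [NormedAddCommGroup E] [NormedSpace ℝ E] :
    C(unitInterval, E) →L[ℝ] C(unitInterval, E) :=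
  LinearMap.mkContinuous
    { toFun := fun f => ⟨fun t => ∫ s in (0 : ℝ)..t, f (Set.projIcc 0 1 zero_le_one s), by
        have h : Continuous fun s : ℝ => f (Set.projIcc 0 1 zero_le_one s) :=
          f.continuous.comp continuous_projIcc
        exact (intervalIntegral.continuous_primitive (fun a b => h.intervalIntegrable a b) 0).comp
          continuous_subtype_val⟩
      map_add' := fun f g => by
        ext t
        exact intervalIntegral.integral_add
          ((f.continuous.comp continuous_projIcc).intervalIntegrable _ _)
          ((g.continuous.comp continuous_projIcc).intervalIntegrable _ _)
      map_smul' := fun c f => by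
        ext t
        exact intervalIntegral.integral_smul _ _ } 1 fun f => by
      rw [one_mul, ContinuousMap.norm_le _ (norm_nonneg _)]
      intro t
      refine (intervalIntegral.norm_integral_le_of_norm_le_const (C := ‖f‖)
        fun s _ => f.norm_coe_le_norm _).trans ?_
      have := t.2.1
      have := t.2.2
      rw [sub_zero, abs_of_nonneg t.2.1]
      exact mul_le_of_le_one_right (norm_nonneg _) t.2.2

lemma primitive_apply (f : C(unitInterval, E)) (t : unitInterval) :
    primitive E f t = ∫ s in (0 : ℝ)..t, f (Set.projIcc 0 1 zero_le_one s) := rfl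

/-- The map whose zeros `(p, γ)` are the integral curves `γ` of `H (p, ·)` starting at `π p`. -/
def curveDefect (π : P →L[ℝ] E) {H : P × E → E} (hH : Continuous H)
    (v : P × C(unitInterval, E)) : C(unitInterval, E) :=
  v.2 - ContinuousMap.const _ (π v.1) -
    primitive E ((⟨H, hH⟩ : C(P × E, E)).comp ((ContinuousMap.const _ v.1).prodMk v.2))

/-- Pairs of a constant and a continuous function. -/
def constProd (P E : Type u) [NormedAddCommGroup E] [NormedSpace ℝ E]
    [NormedAddCommGroup P] [NormedSpace ℝ P] :
    P × C(unitInterval, E) →L[ℝ] C(unitInterval, P × E) :=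
  LinearMap.mkContinuous
    { toFun := fun v => (ContinuousMap.const _ v.1).prodMk v.2
      map_add' := fun _ _ => rfl
      map_smul' := fun _ _ => rfl } 1 fun v => by
      rw [one_mul, ContinuousMap.norm_le _ (norm_nonneg _)]
      intro t
      exact max_le_max le_rfl (v.2.norm_coe_le_norm t)

/-- Constant functions. -/
def constCLM (E : Type u) [NormedAddCommGroup E] [NormedSpace ℝ E] :
    E →L[ℝ] C(unitInterval, E) :=
  LinearMap.mkContinuous
    { toFun := fun v => ContinuousMap.const _ v
      map_add' := fun _ _ => rfl
      map_smul' := fun _ _ => rfl } 1 fun v => by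
      rw [one_mul, ContinuousMap.norm_le _ (norm_nonneg _)]
      exact fun t => le_rfl

lemma contDiff_curveDefect (π : P →L[ℝ] E) {H : P × E → E} (hH : ContDiff ℝ ∞ H) :
    ContDiff ℝ ∞ (curveDefect π hH.continuous) := by
  refine (contDiff_snd.sub ((constCLM E).contDiff.comp (π.contDiff.comp contDiff_fst))).sub
    ((primitive E).contDiff.comp ((contDiff_postcomp hH).comp (constProd P E).contDiff))

/-- At the parameter `p₀` the field vanishes, so the defect is `γ - γ₀` and its derivative in the
curve is the identity. The implicit function theorem then gives both the smooth family of curves and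
its local uniqueness. -/
lemma exists_smooth_flow [CompleteSpace P] [CompleteSpace E] (π : P →L[ℝ] E) {H : P × E → E}
    (hH : ContDiff ℝ ∞ H) {p₀ : P} (h0 : ∀ x, H (p₀, x) = 0) :
    ∃ Γ : P → C(unitInterval, E),
      (∀ᶠ p in 𝓝 p₀, ContDiffAt ℝ ∞ Γ p ∧ curveDefect π hH.continuous (p, Γ p) = 0) ∧
      Γ p₀ = ContinuousMap.const _ (π p₀) ∧
      ∀ᶠ v in 𝓝 (p₀, ContinuousMap.const unitInterval (π p₀)),
        curveDefect π hH.continuous v = 0 → Γ v.1 = v.2 := by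
  set Φ := curveDefect π hH.continuous with hΦ
  have hsm : ContDiff ℝ ∞ Φ := contDiff_curveDefect π hH
  set γ₀ : C(unitInterval, E) := ContinuousMap.const _ (π p₀) with hγ₀
  have hΦ₀ : ∀ γ, Φ (p₀, γ) = γ - γ₀ := by
    intro γ
    ext t
    simp [hΦ, curveDefect, primitive_apply, h0, hγ₀]
  have hder : fderiv ℝ Φ (p₀, γ₀) ∘L .inr ℝ P C(unitInterval, E) = ContinuousLinearMap.id ℝ _ := by
    have h1 : HasFDerivAt (fun γ => Φ (p₀, γ))
        (fderiv ℝ Φ (p₀, γ₀) ∘L .inr ℝ P C(unitInterval, E)) γ₀ :=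
      (hsm.differentiable (by simp) (p₀, γ₀)).hasFDerivAt.comp γ₀ (hasFDerivAt_prodMk_right p₀ γ₀)
    refine h1.unique ?_
    simp only [hΦ₀]
    exact (hasFDerivAt_id γ₀).sub_const γ₀
  have hinv : (fderiv ℝ Φ (p₀, γ₀) ∘L .inr ℝ P C(unitInterval, E)).IsInvertible := by
    rw [hder]; exact ⟨ContinuousLinearEquiv.refl ℝ _, rfl⟩
  have hz : Φ (p₀, γ₀) = 0 := by rw [hΦ₀, sub_self]
  have hca : ∀ v, ContDiffAt ℝ ∞ Φ v := fun v => hsm.contDiffAt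
  have hn : (∞ : WithTop ℕ∞) ≠ 0 := by simp
  set Γ := (hca (p₀, γ₀)).implicitFunction hn hinv with hΓ
  have hΓ₀ : Γ p₀ = γ₀ := (hca (p₀, γ₀)).implicitFunction_apply_self hn hinv
  have hc1 : ContDiffAt ℝ 1 Γ p₀ :=
    ((hca (p₀, γ₀)).contDiffAt_implicitFunction hn hinv).of_le (by simp)
  have hcont : ∀ᶠ p in 𝓝 p₀, ContinuousAt Γ p :=
    (hc1.eventually (by simp)).mono fun p hp => hp.continuousAt
  have hzero : ∀ᶠ p in 𝓝 p₀, Φ (p, Γ p) = 0 := by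
    simpa [hz] using (hca (p₀, γ₀)).eventually_apply_implicitFunction hn hinv
  have hinv' : ∀ᶠ p in 𝓝 p₀,
      (fderiv ℝ Φ (p, Γ p) ∘L .inr ℝ P C(unitInterval, E)).IsInvertible := by
    have h1 : ContinuousAt (fun p => fderiv ℝ Φ (p, Γ p) ∘L .inr ℝ P C(unitInterval, E)) p₀ := by
      have h2 : ContinuousAt (fun p => fderiv ℝ Φ (p, Γ p)) p₀ :=
        ContinuousAt.comp (g := fderiv ℝ Φ) (f := fun p => (p, Γ p))
          (hsm.continuous_fderiv (by simp)).continuousAt (continuousAt_id.prodMk hc1.continuousAt)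
      exact h2.clm_comp continuousAt_const
    have h3 : IsOpen {T : C(unitInterval, E) →L[ℝ] C(unitInterval, E) | T.IsInvertible} :=
      ContinuousLinearEquiv.isOpen
    refine h1.eventually (h3.mem_nhds ?_)
    simpa [hΓ₀] using hinv
  refine ⟨Γ, ?_, hΓ₀, ?_⟩
  -- Smoothness of infinite order at `p₀` alone does not spread to a neighbourhood. At each nearby
  -- `p` the implicit function theorem is applied again, and uniqueness identifies its solution with
  -- `Γ`.
  · filter_upwards [hcont, hzero.eventually_nhds, hinv'] with p hp hzp hip
    refine ⟨?_, hzp.self_of_nhds⟩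
    have h1 := (hca (p, Γ p)).eventually_apply_eq_iff_implicitFunction hn hip
    have h2 : Tendsto (fun p' => (p', Γ p')) (𝓝 p) (𝓝 (p, Γ p)) := continuousAt_id.prodMk hp
    have h3 : Γ =ᶠ[𝓝 p] (hca (p, Γ p)).implicitFunction hn hip := by
      filter_upwards [h2.eventually h1, hzp] with p' h4 h5
      exact (h4.1 (h5.trans hzp.self_of_nhds.symm)).symm
    exact ((hca (p, Γ p)).contDiffAt_implicitFunction hn hip).congr_of_eventuallyEq h3
  · filter_upwards [(hca (p₀, γ₀)).eventually_apply_eq_iff_implicitFunction hn hinv] with v hv h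
    exact hv.1 (h.trans hz.symm)

lemma curveDefect_eq_zero_iff {π : P →L[ℝ] E} {H : P × E → E} {hH : Continuous H} {p : P}
    {γ : C(unitInterval, E)} : curveDefect π hH (p, γ) = 0 ↔ ∀ t : unitInterval,
      γ t = π p + ∫ s in (0 : ℝ)..t, H (p, γ (Set.projIcc 0 1 zero_le_one s)) := by
  rw [ContinuousMap.ext_iff]
  refine forall_congr' fun t => ?_
  simp only [curveDefect, ContinuousMap.sub_apply, ContinuousMap.const_apply, primitive_apply,
    ContinuousMap.zero_apply]
  rw [sub_sub, sub_eq_zero]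
  rfl

lemma hasDerivAt_of_curveDefect_eq_zero [CompleteSpace E] {π : P →L[ℝ] E} {H : P × E → E}
    {hH : Continuous H} {p : P} {γ : C(unitInterval, E)} (h : curveDefect π hH (p, γ) = 0) :
    ∃ c : ℝ → E, (∀ t : unitInterval, c t = γ t) ∧
      ∀ t : unitInterval, HasDerivAt c (H (p, γ t)) t := by
  rw [curveDefect_eq_zero_iff] at h
  have hc : Continuous fun s : ℝ => H (p, γ (Set.projIcc 0 1 zero_le_one s)) :=
    hH.comp (continuous_const.prodMk (γ.continuous.comp continuous_projIcc))
  refine ⟨fun t => π p + ∫ s in (0 : ℝ)..t, H (p, γ (Set.projIcc 0 1 zero_le_one s)),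
    fun t => (h t).symm, fun t => ?_⟩
  have := (hc.integral_hasStrictDerivAt 0 (t : ℝ)).hasDerivAt.const_add (π p)
  simpa using this

/-- The time one flows of the fields `A (q, ·) u`, linear in `u`, starting at the point `π q`,
form a smooth family of exponential maps. -/
theorem exists_smooth_exp [CompleteSpace D] [CompleteSpace E] [CompleteSpace Q] (π : Q →L[ℝ] E)
    {A : Q × E → D →L[ℝ] E} (hA : ContDiff ℝ ∞ A) (q₀ : Q) :
    ∃ Ex : D × Q → E,
      (∀ᶠ p in 𝓝 ((0 : D), q₀), ContDiffAt ℝ ∞ Ex p ∧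
        IsExp (fun x => A (p.2, x) p.1) (π p.2) (Ex p) ∧
        fderiv ℝ Ex p (p.1, 0) = A (p.2, Ex p) p.1) ∧
      ∀ᶠ q in 𝓝 q₀, Ex (0, q) = π q ∧ ∀ u, fderiv ℝ Ex (0, q) (u, 0) = A (q, π q) u := by
  let H : (D × Q) × E → E := fun v => A (v.1.2, v.2) v.1.1
  have hH : ContDiff ℝ ∞ H := by
    refine (hA.comp (f := fun v : (D × Q) × E => (v.1.2, v.2)) (by fun_prop)).clm_apply (by fun_prop)
  obtain ⟨Γ, h1, h2, h3⟩ := exists_smooth_flow (P := D × Q) (π ∘L .snd ℝ D Q) hH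
    (p₀ := (0, q₀)) (fun x => by simp [H])
  have hπ : ∀ p : D × Q, (π ∘L .snd ℝ D Q) p = π p.2 := fun _ => rfl
  rw [hπ] at h2 h3
  obtain ⟨ε, hε, h3⟩ := Metric.eventually_nhds_iff.1 h3
  have hcont : ContinuousAt Γ (0, q₀) := h1.self_of_nhds.1.continuousAt
  have hclose : ∀ᶠ p in 𝓝 ((0 : D), q₀), dist (Γ p) (ContinuousMap.const _ (π q₀)) < ε := by
    have := Metric.tendsto_nhds.1 hcont.tendsto ε hε
    rwa [h2] at this
  obtain ⟨δ, hδ, hgood⟩ := Metric.eventually_nhds_iff_ball.1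
    ((h1.and hclose).and (Metric.ball_mem_nhds _ hε))
  have hmem : ∀ p ∈ Metric.ball ((0 : D), q₀) δ, ∀ s : unitInterval,
      ((s : ℝ) • p.1, p.2) ∈ Metric.ball ((0 : D), q₀) δ := by
    intro p hp s
    refine lt_of_le_of_lt ?_ (Metric.mem_ball.1 hp)
    simp only [Prod.dist_eq, dist_zero_right, norm_smul, Real.norm_eq_abs, abs_of_nonneg s.2.1]
    exact max_le_max (mul_le_of_le_one_left (norm_nonneg _) s.2.2) le_rfl
  have hstart : ∀ p ∈ Metric.ball ((0 : D), q₀) δ, Γ p 0 = π p.2 := by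
    intro p hp
    have := curveDefect_eq_zero_iff.1 (hgood p hp).1.1.2 0
    simpa using this
  -- Since the field is linear in `u`, slowing time by `s` solves the equation for `s u`; local
  -- uniqueness identifies the two curves.
  have hscale : ∀ p ∈ Metric.ball ((0 : D), q₀) δ, ∀ s t : unitInterval,
      Γ ((s : ℝ) • p.1, p.2) t = Γ p (s * t) := by
    intro p hp s t
    have hz := curveDefect_eq_zero_iff.1 (hgood p hp).1.1.2
    let γ : C(unitInterval, E) := (Γ p).comp ⟨fun t => s * t, by fun_prop⟩
    have hγ : curveDefect (π ∘L .snd ℝ D Q) hH.continuous (((s : ℝ) • p.1, p.2), γ) = 0 := by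
      refine curveDefect_eq_zero_iff.2 fun t => ?_
      have h4 := hz (s * t)
      have h5 : ∀ σ ∈ Set.uIcc (0 : ℝ) t, H (((s : ℝ) • p.1, p.2),
          γ (Set.projIcc 0 1 zero_le_one σ)) =
            (s : ℝ) • H (p, Γ p (Set.projIcc 0 1 zero_le_one (s * σ))) := by
        intro σ hσ
        rw [Set.uIcc_of_le t.2.1] at hσ
        have h6 : σ ∈ Set.Icc (0 : ℝ) 1 := ⟨hσ.1, hσ.2.trans t.2.2⟩
        have h7 : (s : ℝ) * σ ∈ Set.Icc (0 : ℝ) 1 := unitInterval.mul_mem s.2 h6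
        rw [Set.projIcc_of_mem _ h6, Set.projIcc_of_mem _ h7]
        exact map_smul _ _ _
      rw [intervalIntegral.integral_congr h5, intervalIntegral.integral_smul,
        intervalIntegral.smul_integral_comp_mul_left
          (fun σ => H (p, Γ p (Set.projIcc 0 1 zero_le_one σ))), mul_zero]
      exact h4
    have hd : dist (((s : ℝ) • p.1, p.2), γ)
        (((0 : D), q₀), ContinuousMap.const unitInterval (π q₀)) < ε := by
      rw [Prod.dist_eq]
      refine max_lt (hgood _ (hmem p hp s)).2 (lt_of_le_of_lt ?_ (hgood p hp).1.2)
      refine (ContinuousMap.dist_le dist_nonneg).2 fun t => ?_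
      exact ContinuousMap.dist_apply_le_dist (f := Γ p)
        (g := ContinuousMap.const unitInterval (π q₀)) (s * t)
    exact DFunLike.congr_fun (h3 hd hγ) t
  let ev : C(unitInterval, E) →L[ℝ] E := LinearMap.mkContinuous
    { toFun := fun γ => γ 1, map_add' := fun _ _ => rfl, map_smul' := fun _ _ => rfl } 1
    fun γ => by rw [one_mul]; exact γ.norm_coe_le_norm 1
  have hEx : ∀ p ∈ Metric.ball ((0 : D), q₀) δ, ContDiffAt ℝ ∞ (fun p => Γ p 1) p := fun p hp =>
    ev.contDiff.contDiffAt.comp p (hgood p hp).1.1.1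
  -- Time one at the parameter `s u` is time `s` at `u`; differentiating in `s` gives the radial
  -- derivative of the exponential map.
  have heuler : ∀ p ∈ Metric.ball ((0 : D), q₀) δ, ∀ s : unitInterval,
      fderiv ℝ (fun p => Γ p 1) ((s : ℝ) • p.1, p.2) (p.1, 0) = A (p.2, Γ p s) p.1 := by
    intro p hp s
    obtain ⟨c, hc, hc'⟩ := hasDerivAt_of_curveDefect_eq_zero (hgood p hp).1.1.2
    have h4 : HasDerivAt (fun s : ℝ => (s • p.1, p.2)) (p.1, (0 : Q)) (s : ℝ) := by
      simpa using ((hasDerivAt_id (s : ℝ)).smul_const p.1).prodMk (hasDerivAt_const (s : ℝ) p.2)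
    have h5 := ((hEx _ (hmem p hp s)).differentiableAt (by simp)).hasFDerivAt.comp_hasDerivAt
      (s : ℝ) h4
    have h6 : HasDerivWithinAt c (fderiv ℝ (fun p => Γ p 1) ((s : ℝ) • p.1, p.2) (p.1, 0))
        (Set.Icc 0 1) s := by
      refine h5.hasDerivWithinAt.congr_of_mem (fun σ hσ => ?_) s.2
      have := hscale p hp ⟨σ, hσ⟩ 1
      rw [mul_one] at this
      exact (hc ⟨σ, hσ⟩).trans this.symm
    exact (uniqueDiffOn_Icc zero_lt_one s s.2).eq_deriv _ h6 (hc' s).hasDerivWithinAt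
  refine ⟨fun p => Γ p 1, ?_, ?_⟩
  · filter_upwards [Metric.ball_mem_nhds _ hδ] with p hp
    refine ⟨hEx p hp, ?_, by simpa using heuler p hp 1⟩
    obtain ⟨c, hc, hc'⟩ := hasDerivAt_of_curveDefect_eq_zero (hgood p hp).1.1.2
    refine ⟨c, (hc 0).trans (hstart p hp), hc 1, fun t ht => ?_⟩
    rw [hc ⟨t, ht⟩]
    exact (hc' ⟨t, ht⟩).hasDerivWithinAt
  · filter_upwards [Metric.ball_mem_nhds q₀ hδ] with q hq
    have hball : ∀ u : D, ‖u‖ < δ → (u, q) ∈ Metric.ball ((0 : D), q₀) δ := fun u hu => by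
      rw [Metric.mem_ball, Prod.dist_eq, dist_zero_right]
      exact max_lt hu hq
    have h0 : ∀ t, Γ (0, q) t = π q := by
      intro t
      have := hscale (0, q) (hball 0 (by simpa using hδ)) 0 t
      rw [zero_mul, hstart _ (hball 0 (by simpa using hδ))] at this
      simpa using this
    refine ⟨h0 1, fun u => ?_⟩
    -- The identity is linear in `u`, so it may be proved for a small multiple.
    obtain ⟨c, hc, hcu⟩ : ∃ c : ℝ, c ≠ 0 ∧ ‖c • u‖ < δ := by
      have h4 : Tendsto (fun c : ℝ => ‖c • u‖) (𝓝[≠] 0) (𝓝 0) := by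
        have : Continuous fun c : ℝ => ‖c • u‖ := by fun_prop
        simpa using (this.tendsto 0).mono_left nhdsWithin_le_nhds
      exact ((eventually_mem_nhdsWithin).and (h4.eventually_lt_const hδ)).exists
    have h4 := heuler (c • u, q) (hball _ hcu) 0
    rw [hstart _ (hball _ hcu)] at h4
    have h5 : ((c • u, 0) : D × Q) = c • (u, 0) := by simp
    simp only [Set.Icc.coe_zero, zero_smul, map_smul] at h4
    rw [h5, map_smul] at h4
    exact smul_right_injective E hc h4

end Flow

/-! ### Families of charts -/

section Chart

universe u

variable {D E Q : Type u} [NormedAddCommGroup D] [NormedSpace ℝ D]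
  [NormedAddCommGroup E] [NormedSpace ℝ E] [NormedAddCommGroup Q] [NormedSpace ℝ Q]

/-- `M` is inverse to the partial derivative of `f` in the first variable. -/
def IsPartialInverse (f : D × Q → E) (M : E →L[ℝ] D) (p : D × Q) : Prop :=
  M ∘L (fderiv ℝ f p ∘L .inl ℝ D Q) = .id ℝ D ∧ (fderiv ℝ f p ∘L .inl ℝ D Q) ∘L M = .id ℝ E

/-- The differential of `(u, q) ↦ (f (u, q), q)` is block triangular, so it is invertible as soon as
the partial derivative in `u` is. -/
lemma IsPartialInverse.exists_equiv {f : D × Q → E} {M : E →L[ℝ] D} {p : D × Q}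
    (h : IsPartialInverse f M p) :
    ∃ e : (D × Q) ≃L[ℝ] (E × Q), (e : (D × Q) →L[ℝ] (E × Q)) =
      (fderiv ℝ f p).prod (.snd ℝ D Q) := by
  have h1 : ∀ d, M (fderiv ℝ f p (d, 0)) = d := fun d => DFunLike.congr_fun h.1 d
  have h2 : ∀ e, fderiv ℝ f p (M e, 0) = e := fun e => DFunLike.congr_fun h.2 e
  have h3 : ∀ d k, fderiv ℝ f p (d, k) = fderiv ℝ f p (d, 0) + fderiv ℝ f p (0, k) := fun d k => by
    rw [← map_add]; simp
  refine ⟨ContinuousLinearEquiv.equivOfInverse ((fderiv ℝ f p).prod (.snd ℝ D Q))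
    ((M ∘L (.fst ℝ E Q - fderiv ℝ f p ∘L .inr ℝ D Q ∘L .snd ℝ E Q)).prod (.snd ℝ E Q)) ?_ ?_, rfl⟩
  · rintro ⟨d, k⟩
    refine Prod.ext ?_ rfl
    change M (fderiv ℝ f p (d, k) - fderiv ℝ f p (0, k)) = d
    rw [h3 d k, add_sub_cancel_right, h1]
  · rintro ⟨e, k⟩
    refine Prod.ext ?_ rfl
    change fderiv ℝ f p (M (e - fderiv ℝ f p (0, k)), k) = e
    rw [h3 _ k, h2, sub_add_cancel]

/-- One application of the inverse function theorem to `(u, q) ↦ (f (u, q), q)` inverts the whole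
family, so every chart maps onto the same ball. The differential of the chart is the smooth map `M`,
and the dependence on `q` is Lipschitz because the inverse and `M` are `C¹`. -/
theorem exists_chart_family [CompleteSpace D] [CompleteSpace E] [CompleteSpace Q]
    {f : D × Q → E} {q₀ : Q}
    (hf : ∀ᶠ p in 𝓝 ((0 : D), q₀), ContDiffAt ℝ ∞ f p)
    (hinv : (fderiv ℝ f (0, q₀) ∘L .inl ℝ D Q).IsInvertible) :
    ∃ M : D × Q → E →L[ℝ] D,
      (∀ᶠ p in 𝓝 ((0 : D), q₀), ContDiffAt ℝ ∞ M p ∧ IsPartialInverse f (M p) p) ∧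
      ∃ ρ > 0, ∀ ε > 0, ε ≤ ρ → ∃ (Θ : Q → OpenPartialHomeomorph E D) (C δ : ℝ), 0 < δ ∧
        (∀ q ∈ Metric.ball q₀ ρ, (Θ q).target = Metric.ball 0 ε ∧
          ContDiffOn ℝ ∞ (Θ q) (Θ q).source ∧ ContDiffOn ℝ ∞ (Θ q).symm (Metric.ball 0 ε) ∧
          ∀ u ∈ Metric.ball (0 : D) ε, (Θ q).symm u = f (u, q) ∧
            fderiv ℝ (Θ q) (f (u, q)) = M (u, q)) ∧
        ∀ x ∈ Metric.ball (f (0, q₀)) δ, ∀ q ∈ Metric.ball q₀ δ, x ∈ (Θ q).source ∧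
          ∀ q' ∈ Metric.ball q₀ δ, ‖Θ q x - Θ q' x‖ ≤ C * ‖q - q'‖ ∧
            ‖fderiv ℝ (Θ q) x - fderiv ℝ (Θ q') x‖ ≤ C * ‖q - q'‖ := by
  have hn : (∞ : WithTop ℕ∞) ≠ 0 := by simp
  let G : D × Q → D →L[ℝ] E := fun p => fderiv ℝ f p ∘L .inl ℝ D Q
  let M : D × Q → E →L[ℝ] D := fun p => (G p).inverse
  have hG : ∀ p, ContDiffAt ℝ ∞ f p → ContDiffAt ℝ ∞ G p := fun p hp =>
    (hp.fderiv_right (m := ∞) (by simp)).clm_comp contDiffAt_const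
  have hGinv : ∀ᶠ p in 𝓝 ((0 : D), q₀), (G p).IsInvertible := by
    have h3 : IsOpen {T : D →L[ℝ] E | T.IsInvertible} := ContinuousLinearEquiv.isOpen
    exact (hG _ hf.self_of_nhds).continuousAt.eventually (h3.mem_nhds hinv)
  have hM : ∀ᶠ p in 𝓝 ((0 : D), q₀), ContDiffAt ℝ ∞ M p ∧ IsPartialInverse f (M p) p := by
    filter_upwards [hf, hGinv] with p hp hip
    refine ⟨?_, ?_, ?_⟩
    · obtain ⟨e, he⟩ := hip
      have h1 : ContDiffAt ℝ ∞ (ContinuousLinearMap.inverse : (D →L[ℝ] E) → E →L[ℝ] D) (G p) := by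
        rw [← he]; exact contDiffAt_map_inverse e
      exact h1.comp p (hG p hp)
    · obtain ⟨e, he⟩ := hip
      change (G p).inverse ∘L G p = _
      rw [← he, ContinuousLinearMap.inverse_equiv]; ext; simp
    · obtain ⟨e, he⟩ := hip
      change G p ∘L (G p).inverse = _
      rw [← he, ContinuousLinearMap.inverse_equiv]; ext; simp
  refine ⟨M, hM, ?_⟩
  let ψ : D × Q → E × Q := fun p => (f p, p.2)
  have hψ : ∀ p, ContDiffAt ℝ ∞ f p → ContDiffAt ℝ ∞ ψ p := fun p hp => hp.prodMk contDiffAt_snd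
  have hψ' : ∀ p, ContDiffAt ℝ ∞ f p → HasFDerivAt ψ ((fderiv ℝ f p).prod (.snd ℝ D Q)) p :=
    fun p hp => (hp.differentiableAt (by simp)).hasFDerivAt.prodMk hasFDerivAt_snd
  obtain ⟨e₀, he₀⟩ := hM.self_of_nhds.2.exists_equiv
  have hψ₀ : HasFDerivAt ψ (e₀ : (D × Q) →L[ℝ] (E × Q)) (0, q₀) := by
    rw [he₀]; exact hψ' _ hf.self_of_nhds
  let Ψ := (hψ _ hf.self_of_nhds).toOpenPartialHomeomorph ψ hψ₀ (by simp)
  have hΨ : ∀ p, Ψ p = (f p, p.2) := fun p => rfl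
  have h0 : ((0 : D), q₀) ∈ Ψ.source :=
    (hψ _ hf.self_of_nhds).mem_toOpenPartialHomeomorph_source hψ₀ (by simp)
  obtain ⟨KM, sM, hsM, hLM⟩ := (hM.self_of_nhds.1.of_le (m := 1) (by simp)).exists_lipschitzOnWith
  obtain ⟨ρ, hρ, hgood⟩ := Metric.eventually_nhds_iff_ball.1
    (((hf.and hM).and (Ψ.open_source.eventually_mem h0)).and (eventually_mem_set.2 hsM))
  refine ⟨ρ, hρ, fun ε hε hερ => ?_⟩
  have hmem : ∀ u ∈ Metric.ball (0 : D) ε, ∀ q ∈ Metric.ball q₀ ρ,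
      (u, q) ∈ Metric.ball ((0 : D), q₀) ρ := fun u hu q hq => by
    rw [Metric.mem_ball, Prod.dist_eq]
    exact max_lt ((Metric.mem_ball.1 hu).trans_le hερ) hq
  have hsymm : ∀ x q, (x, q) ∈ Ψ.target → (Ψ.symm (x, q)).2 = q ∧ f ((Ψ.symm (x, q)).1, q) = x := by
    intro x q hx
    have h1 := Ψ.right_inv hx
    rw [hΨ, Prod.mk.injEq] at h1
    refine ⟨h1.2, ?_⟩
    nth_rw 2 [← h1.1]
    rw [← h1.2, h1.2]
    congr 1
    exact Prod.ext rfl h1.2.symm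
  have hsmooth : ∀ x, ∀ q ∈ Metric.ball q₀ ρ, (x, q) ∈ Ψ.target →
      (Ψ.symm (x, q)).1 ∈ Metric.ball (0 : D) ε → ContDiffAt ℝ ∞ Ψ.symm (x, q) := by
    intro x q hq hx hu
    have h1 : Ψ.symm (x, q) = ((Ψ.symm (x, q)).1, q) := Prod.ext rfl (hsymm x q hx).1
    have h2 := (hgood _ (hmem _ hu q hq)).1.1
    rw [← h1] at h2
    obtain ⟨e, he⟩ := h2.2.2.exists_equiv
    refine Ψ.contDiffAt_symm (f₀' := e) hx ?_ (hψ _ h2.1)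
    rw [he]; exact hψ' _ h2.1
  have hchart : ∀ q ∈ Metric.ball q₀ ρ, ∃ Θ : OpenPartialHomeomorph E D,
      Θ.target = Metric.ball 0 ε ∧ (∀ u, Θ.symm u = f (u, q)) ∧
      (∀ x, Θ x = (Ψ.symm (x, q)).1) ∧
      ∀ x, x ∈ Θ.source ↔ (x, q) ∈ Ψ.target ∧ (Ψ.symm (x, q)).1 ∈ Metric.ball (0 : D) ε := by
    intro q hq
    have hsrc : ∀ u ∈ Metric.ball (0 : D) ε, Ψ.symm (f (u, q), q) = (u, q) ∧
        (f (u, q), q) ∈ Ψ.target := fun u hu => by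
      have h1 := (hgood _ (hmem u hu q hq)).1.2
      exact ⟨Ψ.left_inv h1, Ψ.map_source h1⟩
    have hcq : Continuous fun x : E => (x, q) := by fun_prop
    refine ⟨{ toFun := fun x => (Ψ.symm (x, q)).1
              invFun := fun u => f (u, q)
              source := {x | (x, q) ∈ Ψ.target ∧ (Ψ.symm (x, q)).1 ∈ Metric.ball (0 : D) ε}
              target := Metric.ball 0 ε
              map_source' := fun x hx => hx.2
              map_target' := fun u hu => ⟨(hsrc u hu).2, by rw [(hsrc u hu).1]; exact hu⟩
              left_inv' := fun x hx => (hsymm x q hx.1).2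
              right_inv' := fun u hu => by rw [(hsrc u hu).1]
              open_source := ?_
              open_target := Metric.isOpen_ball
              continuousOn_toFun := ?_
              continuousOn_invFun := ?_ }, rfl, fun _ => rfl, fun _ => rfl, fun _ => Iff.rfl⟩
    · exact continuous_fst.comp_continuousOn
        (Ψ.symm.continuousOn.comp hcq.continuousOn fun x hx => hx.1)
    · intro u hu
      exact ((hgood _ (hmem u hu q hq)).1.1.1.continuousAt.comp (f := fun u => (u, q))
        (by fun_prop)).continuousWithinAt
    · exact (Ψ.symm.isOpen_inter_preimage
        (Metric.isOpen_ball.preimage continuous_fst)).preimage hcq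
  have : Nonempty (OpenPartialHomeomorph E D) := ⟨(hchart q₀ (Metric.mem_ball_self hρ)).choose⟩
  choose! Θ hΘt hΘs hΘ hΘm using hchart
  have h00 : Ψ.symm (f (0, q₀), q₀) = (0, q₀) := Ψ.left_inv h0
  have hΨc : ContDiffAt ℝ 1 Ψ.symm (f (0, q₀), q₀) :=
    (hsmooth _ q₀ (Metric.mem_ball_self hρ) (Ψ.map_source h0)
      (by rw [h00]; exact Metric.mem_ball_self hε)).of_le (by simp)
  obtain ⟨KΨ, sΨ, hsΨ, hLΨ⟩ := hΨc.exists_lipschitzOnWith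
  have hnear : ∀ᶠ v in 𝓝 (f (0, q₀), q₀), v ∈ Ψ.target ∧ (Ψ.symm v).1 ∈ Metric.ball (0 : D) ε := by
    refine (Ψ.open_target.eventually_mem (Ψ.map_source h0)).and ?_
    have h1 : ContinuousAt (fun v => (Ψ.symm v).1) (f (0, q₀), q₀) := hΨc.continuousAt.fst
    refine h1.eventually_mem ?_
    rw [h00]; exact Metric.ball_mem_nhds _ hε
  obtain ⟨δ, hδ, hnear⟩ := Metric.eventually_nhds_iff_ball.1
    ((hnear.and (eventually_mem_set.2 hsΨ)).and
      (eventually_mem_set.2 (Metric.ball_mem_nhds _ hρ)))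
  have hball : ∀ x ∈ Metric.ball (f (0, q₀)) δ, ∀ q ∈ Metric.ball q₀ δ,
      (x, q) ∈ Metric.ball (f (0, q₀), q₀) δ := fun x hx q hq => by
    rw [Metric.mem_ball, Prod.dist_eq]; exact max_lt hx hq
  have hqρ : ∀ x ∈ Metric.ball (f (0, q₀)) δ, ∀ q ∈ Metric.ball q₀ δ, q ∈ Metric.ball q₀ ρ :=
    fun x hx q hq => by
      have h1 := (hnear _ (hball x hx q hq)).2
      rw [Metric.mem_ball, Prod.dist_eq] at h1
      exact (le_max_right _ _).trans_lt h1
  have hfd : ∀ q ∈ Metric.ball q₀ ρ, ContDiffOn ℝ ∞ (Θ q) (Θ q).source := by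
    intro q hq x hx
    have h1 := (hΘm q hq x).1 hx
    have h2 := ((hsmooth x q hq h1.1 h1.2).comp x (f := fun x => (x, q)) (by fun_prop)).fst
    refine (h2.congr_of_eventuallyEq (Eventually.of_forall fun x => ?_)).contDiffWithinAt
    exact hΘ q hq x
  have hMeq : ∀ q ∈ Metric.ball q₀ ρ, ∀ u ∈ Metric.ball (0 : D) ε,
      fderiv ℝ (Θ q) (f (u, q)) = M (u, q) := by
    intro q hq u hu
    have hg := (hgood _ (hmem u hu q hq)).1.1
    have h1 : HasFDerivAt (fun u => f (u, q)) (G (u, q)) u :=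
      (hg.1.differentiableAt (by simp)).hasFDerivAt.comp u (hasFDerivAt_prodMk_left u q)
    have hx : f (u, q) ∈ (Θ q).source := by
      have := (Θ q).map_target (x := u) (by rw [hΘt q hq]; exact hu)
      rwa [hΘs q hq] at this
    have h2 : HasFDerivAt (Θ q) (fderiv ℝ (Θ q) (f (u, q))) (f (u, q)) :=
      (((hfd q hq).contDiffAt ((Θ q).open_source.mem_nhds hx)).differentiableAt
        (by simp)).hasFDerivAt
    have h3 := h2.comp u h1
    have h4 : HasFDerivAt (Θ q ∘ fun u => f (u, q)) (ContinuousLinearMap.id ℝ D) u := by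
      refine (hasFDerivAt_id u).congr_of_eventuallyEq ?_
      filter_upwards [Metric.isOpen_ball.mem_nhds hu] with v hv
      have := (Θ q).right_inv (x := v) (by rw [hΘt q hq]; exact hv)
      rwa [hΘs q hq] at this
    have h5 := h3.unique h4
    calc fderiv ℝ (Θ q) (f (u, q))
        = fderiv ℝ (Θ q) (f (u, q)) ∘L (G (u, q) ∘L M (u, q)) := by
          rw [show G (u, q) ∘L M (u, q) = .id ℝ E from hg.2.2.2]; rfl
      _ = (fderiv ℝ (Θ q) (f (u, q)) ∘L G (u, q)) ∘L M (u, q) := rfl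
      _ = M (u, q) := by rw [h5]; rfl
  refine ⟨Θ, max KΨ (KM * max KΨ 1), δ, hδ, fun q hq => ⟨hΘt q hq, hfd q hq, ?_, fun u hu =>
    ⟨hΘs q hq u, hMeq q hq u hu⟩⟩, fun x hx q hq => ⟨?_, fun q' hq' => ?_⟩⟩
  · intro u hu
    refine ContDiffAt.contDiffWithinAt ?_
    refine ((hgood _ (hmem u hu q hq)).1.1.1.comp u (f := fun u => (u, q))
      (by fun_prop)).congr_of_eventuallyEq (Eventually.of_forall fun u => ?_)
    exact hΘs q hq u
  · exact (hΘm q (hqρ x hx q hq) x).2 (hnear _ (hball x hx q hq)).1.1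
  · have key : ∀ q ∈ Metric.ball q₀ δ, fderiv ℝ (Θ q) x = M (Θ q x, q) ∧
        (Θ q x, q) ∈ Metric.ball ((0 : D), q₀) ρ := by
      intro q hq
      have h1 := (hnear _ (hball x hx q hq)).1.1
      have h2 := hqρ x hx q hq
      have h3 := hMeq q h2 _ h1.2
      rw [(hsymm x q h1.1).2, ← hΘ q h2 x] at h3
      refine ⟨h3, hmem _ ?_ q h2⟩
      rw [hΘ q h2 x]; exact h1.2
    have h1 : ‖Θ q x - Θ q' x‖ ≤ KΨ * ‖q - q'‖ := by
      rw [hΘ q (hqρ x hx q hq), hΘ q' (hqρ x hx q' hq')]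
      have h2 := hLΨ.norm_sub_le (hnear _ (hball x hx q hq)).1.2 (hnear _ (hball x hx q' hq')).1.2
      refine (norm_fst_le (Ψ.symm (x, q) - Ψ.symm (x, q'))).trans (h2.trans_eq ?_)
      simp [Prod.norm_def]
    refine ⟨h1.trans (by gcongr; exact le_max_left _ _), ?_⟩
    rw [(key q hq).1, (key q' hq').1]
    refine (hLM.norm_sub_le (hgood _ (key q hq).2).2 (hgood _ (key q' hq').2).2).trans ?_
    have h2 : ‖(Θ q x, q) - (Θ q' x, q')‖ ≤ max (KΨ : ℝ) 1 * ‖q - q'‖ := by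
      rw [Prod.mk_sub_mk, Prod.norm_mk]
      refine max_le (h1.trans (by gcongr; exact le_max_left _ _)) ?_
      exact le_mul_of_one_le_left (norm_nonneg _) (le_max_right _ _)
    calc _ ≤ (KM : ℝ) * (max (KΨ : ℝ) 1 * ‖q - q'‖) := by gcongr
      _ = KM * max (KΨ : ℝ) 1 * ‖q - q'‖ := by ring
      _ ≤ _ := by gcongr; exact le_max_right _ _

end Chart

/-! ### Comparison of frames in canonical coordinates -/

section Frames

variable {n : ℕ} {B : Finset (List (Fin (n + 1)))}

lemma homNorm_nonneg (u : EuclideanSpace ℝ B) : 0 ≤ homNorm u :=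
  Finset.sum_nonneg fun _ _ => Real.rpow_nonneg (abs_nonneg _) _

lemma continuous_homNorm : Continuous (homNorm : EuclideanSpace ℝ B → ℝ) := by
  refine continuous_finsetSum _ fun J _ => ?_
  exact (by fun_prop : Continuous fun u : EuclideanSpace ℝ B => |u J|).rpow_const
    fun u => Or.inr (by positivity)

lemma homNorm_zero (hB : ∀ J : B, 0 < weight (J : List (Fin (n + 1)))) :
    homNorm (0 : EuclideanSpace ℝ B) = 0 := by
  refine Finset.sum_eq_zero fun J _ => ?_
  have := hB J
  rw [PiLp.zero_apply, abs_zero, Real.zero_rpow (by positivity)]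

lemma abs_apply_le_homNorm_pow (hB : ∀ J : B, 0 < weight (J : List (Fin (n + 1))))
    (u : EuclideanSpace ℝ B) (J : B) :
    |u J| ≤ homNorm u ^ weight (J : List (Fin (n + 1))) := by
  have h1 : |u J| ^ (1 / (weight (J : List (Fin (n + 1))) : ℝ)) ≤ homNorm u :=
    Finset.single_le_sum (f := fun J : B => |u J| ^ (1 / (weight (J : List (Fin (n + 1))) : ℝ)))
      (fun _ _ => Real.rpow_nonneg (abs_nonneg _) _) (Finset.mem_univ J)
  calc |u J| = (|u J| ^ (1 / (weight (J : List (Fin (n + 1))) : ℝ))) ^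
        weight (J : List (Fin (n + 1))) := by
        rw [one_div, Real.rpow_inv_natCast_pow (abs_nonneg _) (hB J).ne']
    _ ≤ _ := by gcongr

lemma norm_le_homNorm (hB : ∀ J : B, 0 < weight (J : List (Fin (n + 1))))
    {u : EuclideanSpace ℝ B} (hu : homNorm u ≤ 1) : ‖u‖ ≤ B.card * homNorm u := by
  have h1 : ‖u‖ ≤ ∑ J : B, ‖u J‖ := by
    have h2 : u = ∑ J : B, EuclideanSpace.single J (u J) := by
      ext K; simp [Pi.single_apply, Finset.sum_apply]
    conv_lhs => rw [h2]
    exact (norm_sum_le _ _).trans (Finset.sum_le_sum fun J _ => by simp)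
  refine h1.trans ((Finset.sum_le_card_nsmul _ _ (homNorm u) fun J _ => ?_).trans_eq ?_)
  · exact (abs_apply_le_homNorm_pow hB u J).trans
      (pow_le_of_le_one (homNorm_nonneg u) hu (hB J).ne')
  · simp

lemma homNorm_smul_le {s : ℝ} (hs₀ : 0 ≤ s) (hs₁ : s ≤ 1) (u : EuclideanSpace ℝ B) :
    homNorm (s • u) ≤ homNorm u := by
  refine Finset.sum_le_sum fun J _ => Real.rpow_le_rpow (abs_nonneg _) ?_ (by positivity)
  rw [PiLp.smul_apply, smul_eq_mul, abs_mul, abs_of_nonneg hs₀]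
  exact mul_le_of_le_one_left (abs_nonneg _) hs₁

/-- The fields `v I` are, in the coordinates `u`, the canonical coordinates of the frame itself,
and their commutators have the structure constants `c` up to weight `r`. -/
structure IsCanonicalFrame (r : ℕ) (C : ℝ) (c : B → B → B → ℝ) (U : Set (EuclideanSpace ℝ B))
    (v : B → EuclideanSpace ℝ B → EuclideanSpace ℝ B) : Prop where
  differentiableAt : ∀ I, ∀ u ∈ U, DifferentiableAt ℝ (v I) u
  at_zero : ∀ I, v I 0 = EuclideanSpace.single I 1
  euler : ∀ u ∈ U, ∑ J, u J • v J u = u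
  lieBracket_eq : ∀ J I : B, weight (J : List (Fin (n + 1))) + weight (I : List (Fin (n + 1))) ≤ r →
    ∀ u ∈ U, VectorField.lieBracket ℝ (v J) (v I) u = ∑ K, c J I K • v K u
  norm_lieBracket_le : ∀ J I, ∀ u ∈ U, ‖VectorField.lieBracket ℝ (v J) (v I) u‖ ≤ C
  lipschitz : ∀ I, ∀ u ∈ U, ‖v I u - v I 0‖ ≤ C * ‖u‖

/-- The right-hand side of the radial differential equation for the fields of a frame. -/
def radialForm (v : B → EuclideanSpace ℝ B → EuclideanSpace ℝ B) (I : B)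
    (u : EuclideanSpace ℝ B) : EuclideanSpace ℝ B :=
  ∑ J, u J • VectorField.lieBracket ℝ (v J) (v I) u -
    ∑ J, (v I u - v I 0) J • (v J u - v J 0)

lemma sum_apply_smul_single (w : EuclideanSpace ℝ B) :
    ∑ J, w J • EuclideanSpace.single J (1 : ℝ) = w := by
  ext K; simp [Pi.single_apply, Finset.sum_apply]

/-- Differentiate `∑ u_J v_J = u` in the direction `v_I` and use the brackets to replace `∑ u_J
Dv_J(v_I)` by the radial derivative of `v_I`. Writing `v_J = v_J(0) + (v_J - v_J(0))` separates the
linear part from the quadratic one. -/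
lemma IsCanonicalFrame.fderiv_apply_self {r : ℕ} {C : ℝ} {c : B → B → B → ℝ}
    {U : Set (EuclideanSpace ℝ B)} (hU : IsOpen U)
    {v : B → EuclideanSpace ℝ B → EuclideanSpace ℝ B} (hv : IsCanonicalFrame r C c U v) (I : B)
    {u : EuclideanSpace ℝ B} (hu : u ∈ U) :
    fderiv ℝ (v I) u u + (v I u - v I 0) = radialForm v I u := by
  have h1 : HasFDerivAt (fun u : EuclideanSpace ℝ B => ∑ J, u J • v J u)
      (∑ J, (u J • fderiv ℝ (v J) u +
        (EuclideanSpace.proj J : EuclideanSpace ℝ B →L[ℝ] ℝ).smulRight (v J u))) u :=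
    HasFDerivAt.fun_sum fun J _ => HasFDerivAt.smul
      (EuclideanSpace.proj J : EuclideanSpace ℝ B →L[ℝ] ℝ).hasFDerivAt
      (hv.differentiableAt J u hu).hasFDerivAt
  have h2 : HasFDerivAt (fun u : EuclideanSpace ℝ B => ∑ J, u J • v J u)
      (ContinuousLinearMap.id ℝ _) u :=
    (hasFDerivAt_id u).congr_of_eventuallyEq (by
      filter_upwards [hU.mem_nhds hu] with w hw using hv.euler w hw)
  have h3 := DFunLike.congr_fun (h1.unique h2) (v I u)
  simp only [sum_apply, add_apply, smul_apply, ContinuousLinearMap.smulRight_apply,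
    EuclideanSpace.coe_proj, ContinuousLinearMap.id_apply, Finset.sum_add_distrib] at h3
  have h4 : fderiv ℝ (v I) u u = ∑ J, u J • fderiv ℝ (v I) u (v J u) := by
    conv_lhs => rw [← hv.euler u hu]
    simp only [map_sum, map_smul]
    rw [hv.euler u hu]
  have h5 : ∑ J, (v I u) J • v J u = v I u + (v I u - v I 0) +
      ∑ J, (v I u - v I 0) J • (v J u - v J 0) := by
    have e1 : ∀ J, (v I u) J • v J u = (v I u) J • v J 0 + (v I 0) J • (v J u - v J 0) +
        (v I u - v I 0) J • (v J u - v J 0) := fun J => by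
      rw [PiLp.sub_apply]; module
    rw [Finset.sum_congr rfl fun J _ => e1 J, Finset.sum_add_distrib, Finset.sum_add_distrib]
    congr 1
    congr 1
    · simp only [hv.at_zero]
      exact sum_apply_smul_single _
    · simp [hv.at_zero]
  rw [radialForm]
  simp only [VectorField.lieBracket, smul_sub, Finset.sum_sub_distrib]
  rw [← h4, eq_sub_of_add_eq h3]
  simp only [smul_sub, Finset.sum_sub_distrib] at h5
  rw [h5]
  abel

/-- Along the ray, `s d(s u)` has derivative `f(s u)` and vanishes at `s = 0`; the homogeneous norm
does not grow as `s` decreases. -/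
lemma abs_apply_le_of_radial {U : Set (EuclideanSpace ℝ B)} (hU : StarConvex ℝ 0 U)
    {d f : EuclideanSpace ℝ B → EuclideanSpace ℝ B} (hd : ∀ u ∈ U, DifferentiableAt ℝ d u)
    (h : ∀ u ∈ U, fderiv ℝ d u u + d u = f u) {K : B} {A : ℝ} {m : ℕ} (hA : 0 ≤ A)
    (hf : ∀ u ∈ U, |f u K| ≤ A * homNorm u ^ m) {u : EuclideanSpace ℝ B} (hu : u ∈ U) :
    |d u K| ≤ A * homNorm u ^ m := by
  have hsU : ∀ s ∈ Set.Icc (0 : ℝ) 1, s • u ∈ U := fun s hs => by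
    simpa using hU hu (sub_nonneg.2 hs.2) hs.1 (by simp)
  have h1 : ∀ s ∈ Set.Icc (0 : ℝ) 1, HasDerivWithinAt (fun s : ℝ => (s • d (s • u)) K)
      (f (s • u) K) (Set.Icc 0 1) s := by
    intro s hs
    have h2 : HasDerivAt (fun s : ℝ => s • u) u s := by simpa using (hasDerivAt_id s).smul_const u
    have h3 := (hasDerivAt_id s).smul ((hd _ (hsU s hs)).hasFDerivAt.comp_hasDerivAt s h2)
    have h4 : s • fderiv ℝ d (s • u) u + (1 : ℝ) • d (s • u) = f (s • u) := by
      rw [← h _ (hsU s hs), map_smul, one_smul]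
    have h5 := ((EuclideanSpace.proj K : EuclideanSpace ℝ B →L[ℝ] ℝ).hasFDerivAt).comp_hasDerivAt
      s h3
    simp only [id_eq, Function.comp_apply, h4] at h5
    exact h5.hasDerivWithinAt
  have h2 := norm_image_sub_le_of_norm_deriv_le_segment_01' (C := A * homNorm u ^ m) h1
    fun s hs => (hf _ (hsU s ⟨hs.1, hs.2.le⟩)).trans (by
      gcongr
      exacts [homNorm_nonneg _, homNorm_smul_le hs.1 hs.2.le u])
  simpa using h2

/-- Two canonical frames with the same structure constants agree up to terms of positive weight. -/
theorem exists_frame_comparison {r : ℕ}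
    (hB : ∀ J : B, 0 < weight (J : List (Fin (n + 1))))
    (hBr : ∀ J : B, weight (J : List (Fin (n + 1))) ≤ r) (C : ℝ) (hC : 0 ≤ C)
    (c : B → B → B → ℝ)
    (hc : ∀ J I K : B, weight (K : List (Fin (n + 1))) ≠
      weight (J : List (Fin (n + 1))) + weight (I : List (Fin (n + 1))) → c J I K = 0) :
    ∃ C', 0 ≤ C' ∧ ∀ (U : Set (EuclideanSpace ℝ B))
      (v y : B → EuclideanSpace ℝ B → EuclideanSpace ℝ B), IsOpen U → StarConvex ℝ 0 U →
      (∀ u ∈ U, homNorm u ≤ 1) → IsCanonicalFrame r C c U v → IsCanonicalFrame r C c U y →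
      (∀ I K : B, ∀ u ∈ U, |(y I u - y I 0) K| ≤ C * homNorm u ^
        max 1 (weight (K : List (Fin (n + 1))) - weight (I : List (Fin (n + 1))))) →
      ∀ I K : B, ∀ u ∈ U, |(v I u - y I u) K| ≤ C' * homNorm u ^
        (1 + (weight (K : List (Fin (n + 1))) - weight (I : List (Fin (n + 1))))) := by
  -- The order of vanishing is improved one step at a time, capped by the target exponent. After `r`
  -- steps the cap is active, because `w K ≤ r`.
  let w : B → ℕ := fun J => weight (J : List (Fin (n + 1)))
  suffices H : ∀ m : ℕ, ∃ C', 0 ≤ C' ∧ ∀ (U : Set (EuclideanSpace ℝ B))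
      (v y : B → EuclideanSpace ℝ B → EuclideanSpace ℝ B), IsOpen U → StarConvex ℝ 0 U →
      (∀ u ∈ U, homNorm u ≤ 1) → IsCanonicalFrame r C c U v → IsCanonicalFrame r C c U y →
      (∀ I K : B, ∀ u ∈ U, |(y I u - y I 0) K| ≤ C * homNorm u ^ max 1 (w K - w I)) →
      ∀ I K : B, ∀ u ∈ U, |(v I u - y I u) K| ≤
        C' * homNorm u ^ (min (m + 1) (1 + (w K - w I))) by
    obtain ⟨C', hC', h⟩ := H r
    refine ⟨C', hC', fun U v y hU hUs hN hv hy hyw I K u hu => ?_⟩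
    have h1 := h U v y hU hUs hN hv hy hyw I K u hu
    rwa [min_eq_right] at h1
    have := hBr K
    simp only [w]; omega
  intro m
  induction m with
  | zero =>
    refine ⟨2 * C * B.card, by positivity, fun U v y hU hUs hN hv hy hyw I K u hu => ?_⟩
    have h1 : v I u - y I u = (v I u - v I 0) - (y I u - y I 0) := by
      rw [hv.at_zero, hy.at_zero]; abel
    rw [h1, zero_add, min_eq_left (by omega), pow_one]
    calc |((v I u - v I 0) - (y I u - y I 0)) K| ≤ ‖(v I u - v I 0) - (y I u - y I 0)‖ :=
          PiLp.norm_apply_le (v I u - v I 0 - (y I u - y I 0)) K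
      _ ≤ C * ‖u‖ + C * ‖u‖ := (norm_sub_le _ _).trans
          (add_le_add (hv.lipschitz I u hu) (hy.lipschitz I u hu))
      _ = 2 * C * ‖u‖ := by ring
      _ ≤ 2 * C * (B.card * homNorm u) := by gcongr; exact norm_le_homNorm hB (hN u hu)
      _ = _ := by ring
  | succ m ih =>
    obtain ⟨A, hA, ih⟩ := ih
    let S : ℝ := ∑ J, ∑ I, ∑ K, |c J I K|
    have hS : ∀ J I, ∑ K, |c J I K| ≤ S := fun J I =>
      (Finset.single_le_sum (f := fun I => ∑ K, |c J I K|)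
        (fun _ _ => Finset.sum_nonneg fun _ _ => abs_nonneg _) (Finset.mem_univ I)).trans
      (Finset.single_le_sum (f := fun J => ∑ I, ∑ K, |c J I K|)
        (fun _ _ => Finset.sum_nonneg fun _ _ => Finset.sum_nonneg fun _ _ => abs_nonneg _)
          (Finset.mem_univ J))
    have hS0 : 0 ≤ S := Finset.sum_nonneg fun _ _ => Finset.sum_nonneg fun _ _ =>
      Finset.sum_nonneg fun _ _ => abs_nonneg _
    refine ⟨B.card * (S * A + 2 * C) + B.card * (A * C + A * A + C * A), by positivity,
      fun U v y hU hUs hN hv hy hyw I K u hu => ?_⟩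
    have ih := ih U v y hU hUs hN hv hy hyw
    refine abs_apply_le_of_radial (d := fun u => v I u - y I u)
      (f := fun u => radialForm v I u - radialForm y I u) hUs
      (fun u hu => (hv.differentiableAt I u hu).sub (hy.differentiableAt I u hu))
      (fun u hu => ?_) (by positivity) (fun u hu => ?_) hu
    · rw [← hv.fderiv_apply_self hU I hu, ← hy.fderiv_apply_self hU I hu,
        fderiv_fun_sub (hv.differentiableAt I u hu) (hy.differentiableAt I u hu), hv.at_zero,
        hy.at_zero, sub_apply]
      abel
    · have hN0 := homNorm_nonneg u
      have hN1 := hN u hu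
      have hpow : ∀ {a b : ℕ}, b ≤ a → homNorm u ^ a ≤ homNorm u ^ b := fun h =>
        pow_le_pow_of_le_one hN0 hN1 h
      set M := min (m + 1 + 1) (1 + (w K - w I)) with hM
      set N := homNorm u with hNdef
      -- The quadratic terms are regrouped so that `v` occurs only in `v - y`. The weights of `y`
      -- are known, whereas `v` is a priori only Lipschitz and its weights come from the induction.
      let T₁ : B → ℝ := fun J => u J * (VectorField.lieBracket ℝ (v J) (v I) u -
        VectorField.lieBracket ℝ (y J) (y I) u) K
      let T₂ : B → ℝ := fun J => (v I u - y I u) J * (y J u - y J 0) K +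
        (v I u - y I u) J * (v J u - y J u) K + (y I u - y I 0) J * (v J u - y J u) K
      have hsplit : (radialForm v I u - radialForm y I u) K = ∑ J, T₁ J - ∑ J, T₂ J := by
        have h0 : ∀ J, v J 0 = y J 0 := fun J => by rw [hv.at_zero, hy.at_zero]
        simp only [radialForm, PiLp.sub_apply, WithLp.ofLp_sum, Finset.sum_apply, PiLp.smul_apply,
          smul_eq_mul, h0, T₁, T₂]
        rw [sub_sub_sub_comm, ← Finset.sum_sub_distrib, ← Finset.sum_sub_distrib]
        congr 1 <;> refine Finset.sum_congr rfl fun J _ => ?_ <;> ring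
      -- For `|J| + |I| ≤ r` the bracket difference is a combination of earlier differences of that
      -- weight, and `u_J` adds at least one order. Otherwise the brackets are merely bounded, but
      -- `|J| > r - |I|` makes `u_J` alone small enough.
      have hT₁ : ∀ J, |T₁ J| ≤ (S * A + 2 * C) * N ^ M := by
        intro J
        have hJ := hB J
        have hK := hBr K
        have hJ' := abs_apply_le_homNorm_pow hB u J
        rw [abs_mul]
        by_cases hJI : weight (J : List (Fin (n + 1))) + weight (I : List (Fin (n + 1))) ≤ r
        · rw [hv.lieBracket_eq J I hJI u hu, hy.lieBracket_eq J I hJI u hu,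
            ← Finset.sum_sub_distrib]
          have h1 : |(∑ L, (c J I L • v L u - c J I L • y L u)) K| ≤
              S * A * N ^ (min (m + 1) (1 + (w K - (w J + w I)))) := by
            rw [WithLp.ofLp_sum, Finset.sum_apply]
            calc _ ≤ ∑ L, |c J I L| * (A * N ^ (min (m + 1) (1 + (w K - (w J + w I))))) := by
                  refine (Finset.abs_sum_le_sum_abs _ _).trans (Finset.sum_le_sum fun L _ => ?_)
                  rw [← smul_sub, PiLp.smul_apply, smul_eq_mul, abs_mul]
                  by_cases hL : weight (L : List (Fin (n + 1))) =
                      weight (J : List (Fin (n + 1))) + weight (I : List (Fin (n + 1)))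
                  · have := ih L K u hu
                    rw [show w L = w J + w I from hL] at this
                    gcongr
                  · rw [hc J I L hL, abs_zero, zero_mul, zero_mul]
              _ ≤ S * (A * N ^ (min (m + 1) (1 + (w K - (w J + w I))))) := by
                  rw [← Finset.sum_mul]; gcongr; exact hS J I
              _ = _ := by ring
          calc _ ≤ N ^ w J * (S * A * N ^ (min (m + 1) (1 + (w K - (w J + w I))))) := by gcongr
            _ = S * A * N ^ (w J + min (m + 1) (1 + (w K - (w J + w I)))) := by rw [pow_add]; ring
            _ ≤ S * A * N ^ M := by
                gcongr 1
                refine hpow ?_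
                simp only [hM, w] at *
                omega
            _ ≤ _ := by gcongr; linarith
        · have h1 : |(VectorField.lieBracket ℝ (v J) (v I) u -
              VectorField.lieBracket ℝ (y J) (y I) u) K| ≤ 2 * C := by
            refine (PiLp.norm_apply_le (VectorField.lieBracket ℝ (v J) (v I) u -
              VectorField.lieBracket ℝ (y J) (y I) u) K).trans ((norm_sub_le _ _).trans ?_)
            linarith [hv.norm_lieBracket_le J I u hu, hy.norm_lieBracket_le J I u hu]
          calc _ ≤ N ^ w J * (2 * C) := by gcongr
            _ ≤ N ^ M * (2 * C) := by
                gcongr 1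
                refine hpow ?_
                simp only [hM, w] at *
                omega
            _ = 2 * C * N ^ M := mul_comm _ _
            _ ≤ _ := by gcongr; linarith [mul_nonneg hS0 hA]
      -- Each product has a difference `v - y` of order from the induction and another factor
      -- vanishing at least to first order. The weights telescope through `J`.
      have hT₂ : ∀ J, |T₂ J| ≤ (A * C + A * A + C * A) * N ^ M := by
        intro J
        have key : ∀ {a b x z : ℝ} {i j : ℕ}, 0 ≤ x → 0 ≤ z → |a| ≤ x * N ^ i → |b| ≤ z * N ^ j →
            M ≤ i + j → |a * b| ≤ x * z * N ^ M := by
          intro a b x z i j hx hz ha hb hij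
          rw [abs_mul]
          calc _ ≤ (x * N ^ i) * (z * N ^ j) := by gcongr
            _ = x * z * N ^ (i + j) := by rw [pow_add]; ring
            _ ≤ _ := by gcongr 1; exact hpow hij
        have hI := hB I
        have hd₁ := ih I J u hu
        have hd₂ := ih J K u hu
        have h1 := key hA hC hd₁ (hyw J K u hu) (by simp only [hM, w] at *; omega)
        have h2 := key hA hA hd₁ hd₂ (by simp only [hM, w] at *; omega)
        have h3 := key hC hA (hyw I J u hu) hd₂ (by simp only [hM, w] at *; omega)
        calc _ ≤ _ := (abs_add_le _ _).trans (add_le_add (abs_add_le _ _) le_rfl)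
          _ ≤ A * C * N ^ M + A * A * N ^ M + C * A * N ^ M := by gcongr
          _ = _ := by ring
      rw [hsplit, add_mul]
      refine (abs_sub _ _).trans (add_le_add ?_ ?_)
      · refine (Finset.abs_sum_le_sum_abs _ _).trans
          ((Finset.sum_le_card_nsmul _ _ _ fun J _ => hT₁ J).trans_eq ?_)
        simp [mul_assoc]
      · refine (Finset.abs_sum_le_sum_abs _ _).trans
          ((Finset.sum_le_card_nsmul _ _ _ fun J _ => hT₂ J).trans_eq ?_)
        simp [mul_assoc]

end Frames

/-! ### Bases of commutators of fields of limited smoothness -/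

section Basis

variable {n r p : ℕ} {α : ℝ} {Ω : Set (EuclideanSpace ℝ (Fin p))}
  {X : Fin (n + 1) → EuclideanSpace ℝ (Fin p) → EuclideanSpace ℝ (Fin p)}
  {B : Finset (List (Fin (n + 1)))}

lemma contDiff_approxField (r : ℕ)
    (X : Fin (n + 1) → EuclideanSpace ℝ (Fin p) → EuclideanSpace ℝ (Fin p))
    (y : EuclideanSpace ℝ (Fin p)) (i : Fin (n + 1)) : ContDiff ℝ ∞ (approxField r X y i) :=
  contDiff_taylorPoly _ _ _

/-- The flat difference vanishes at `y` itself. Universal relations thereby reach the given fields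
pointwise, through `S^y`. -/
lemma bracket_eq_bracket_approxField (hα : 0 < α) (hΩ : IsOpen Ω)
    (hX : ∀ i, HolderClass (r - fieldWeight i) α Ω (X i)) {y : EuclideanSpace ℝ (Fin p)}
    (hy : y ∈ Ω) {I : List (Fin (n + 1))} (hI : I ∈ multiindices n r) :
    bracket X I y = bracket (approxField r X y) I y := by
  obtain ⟨ε, hε, hball⟩ := Metric.isOpen_iff.1 hΩ y hy
  have hsub : Metric.ball y (min ε (1 / 2)) ⊆ Ω :=
    (Metric.ball_subset_ball (min_le_left _ _)).trans hball
  obtain ⟨C, -, hC⟩ := exists_flatWith_bracket_sub hα.le (s := Metric.ball y (min ε (1 / 2)))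
    Metric.isOpen_ball (convex_ball _ _) (fun a ha b hb => by
      rw [← dist_eq_norm]
      have h1 := (Metric.mem_ball.1 ha).trans_le (min_le_right _ _)
      have h2 := (Metric.mem_ball.1 hb).trans_le (min_le_right _ _)
      linarith [dist_triangle_right a b y])
    (fun i => (hX i).imp fun _ h => h.mono_set hsub) hI
  have hy' : y ∈ Metric.ball y (min ε (1 / 2)) := Metric.mem_ball_self (by positivity)
  have h1 := (hC y hy').bound hy'
  rw [sub_self, norm_zero, Real.zero_rpow (by positivity), mul_zero] at h1
  exact sub_eq_zero.1 (norm_le_zero_iff.1 h1)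

/-- A relation in the free algebra holds for the polynomial fields at `x`, which gives independence
of the `ξ_[I]`. Conversely, expanding a commutator at `x` gives a pointwise relation, which freeness
lifts to the free algebra. -/
lemma isFreeBasis_of_isFreeAt (hα : 0 < α) (hΩ : IsOpen Ω)
    (hX : ∀ i, HolderClass (r - fieldWeight i) α Ω (X i)) {x : EuclideanSpace ℝ (Fin p)}
    (hx : x ∈ Ω) (hfree : IsFreeAt X r x)
    (hBr : (B : Set (List (Fin (n + 1)))) ⊆ multiindices n r)
    (hli : LinearIndependent ℝ (fun I : B => bracket X I x))
    (hsp : Submodule.span ℝ (Set.range fun I : B => bracket X I x) = ⊤) : IsFreeBasis r B := by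
  refine IsFreeBasis.of_mem_span hBr ?_ fun J hJ => ?_
  · rw [Fintype.linearIndependent_iff] at hli ⊢
    intro a ha
    refine hli a ?_
    rw [← sum_bracket_eq_zero (contDiff_approxField r X x) (fun K _ => (hBr K.2).1) ha x]
    exact Finset.sum_congr rfl fun K _ => by
      rw [bracket_eq_bracket_approxField hα hΩ hX hx (hBr K.2)]
  · have h1 : bracket X J x ∈ Submodule.span ℝ (Set.range fun I : B => bracket X I x) := by
      rw [hsp]; trivial
    obtain ⟨a, ha⟩ := (Submodule.mem_span_range_iff_exists_fun ℝ).1 h1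
    let b : List (Fin (n + 1)) →₀ ℝ :=
      Finsupp.single J 1 - ∑ I : B, Finsupp.single (I : List (Fin (n + 1))) (a I)
    have hsum : ∀ {F : Type} [AddCommGroup F] [Module ℝ F] (g : List (Fin (n + 1)) → F),
        (b.sum fun I c => c • g I) = g J - ∑ I : B, a I • g I := by
      intro F _ _ g
      have : (b.sum fun I c => c • g I) = Finsupp.linearCombination ℝ g b := rfl
      rw [this, map_sub, map_sum]
      simp [Finsupp.linearCombination_single]
    have hb : (b.support : Set (List (Fin (n + 1)))) ⊆ multiindices n r := by
      have h2 : b ∈ Finsupp.supported ℝ ℝ (multiindices n r) :=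
        Submodule.sub_mem _ (Finsupp.single_mem_supported ℝ _ hJ)
          (Submodule.sum_mem _ fun I _ => Finsupp.single_mem_supported ℝ _ (hBr I.2))
      exact h2
    have h3 := (sum_structConst_eq_zero_iff b).1 (hfree b hb (by
      rw [hsum fun I => bracket X I x, ha, sub_self]))
    rw [hsum, sub_eq_zero] at h3
    exact ⟨a, h3⟩

/-- The linear map `u ↦ ∑ u_I z_I`. -/
def frameMap {E : Type*} [NormedAddCommGroup E] [NormedSpace ℝ E] (z : B → E) :
    EuclideanSpace ℝ B →L[ℝ] E :=
  ∑ I : B, (EuclideanSpace.proj I : EuclideanSpace ℝ B →L[ℝ] ℝ).smulRight (z I)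

lemma frameMap_apply {E : Type*} [NormedAddCommGroup E] [NormedSpace ℝ E] (z : B → E)
    (u : EuclideanSpace ℝ B) : frameMap z u = ∑ I : B, u I • z I := by
  simp [frameMap, sum_apply]

/-- The expansions in `B` are universal, so the commutators in `B` span wherever all commutators do;
equality of dimensions does the rest. A basis at one point is thus a basis everywhere. -/
lemma isInvertible_frameMap (hα : 0 < α) (hΩ : IsOpen Ω)
    (hX : ∀ i, HolderClass (r - fieldWeight i) α Ω (X i)) (hB : IsFreeBasis r B)
    (hcard : B.card = p) {y : EuclideanSpace ℝ (Fin p)} (hy : y ∈ Ω)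
    (hspan : Submodule.span ℝ ((fun I => bracket X I y) '' multiindices n r) = ⊤) :
    (frameMap fun I : B => bracket (approxField r X y) I y).IsInvertible := by
  have hsurj : Function.Surjective (frameMap fun I : B => bracket (approxField r X y) I y) := by
    have h1 : Submodule.span ℝ ((fun I => bracket X I y) '' multiindices n r) ≤
        LinearMap.range (frameMap fun I : B => bracket (approxField r X y) I y).toLinearMap := by
      rw [Submodule.span_le]
      rintro _ ⟨I, hI, rfl⟩
      obtain ⟨c, hc, -⟩ := hB.expansion I hI
      refine ⟨WithLp.toLp 2 c, ?_⟩
      change frameMap _ _ = bracket X I y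
      rw [frameMap_apply, bracket_eq_bracket_approxField hα hΩ hX hy hI,
        bracket_eq_sum (contDiff_approxField r X y) hI.1 (fun K _ => (hB.subset K.2).1) hc]
    rw [hspan] at h1
    exact fun e => h1 trivial
  have hinj : Function.Injective (frameMap fun I : B => bracket (approxField r X y) I y) :=
    (LinearMap.injective_iff_surjective_of_finrank_eq_finrank (f := (frameMap fun I : B =>
      bracket (approxField r X y) I y).toLinearMap) (by simp [hcard])).2 hsurj
  exact ⟨(LinearEquiv.ofBijective (frameMap fun I : B =>
    bracket (approxField r X y) I y).toLinearMap ⟨hinj, hsurj⟩).toContinuousLinearEquiv, rfl⟩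

end Basis

/-! ### The approximating fields as a smooth family -/

section Jets

universe u

variable {n : ℕ} {E Q : Type u} [NormedAddCommGroup E] [NormedSpace ℝ E] [NormedAddCommGroup Q]
  [NormedSpace ℝ Q]

/-- Smoothness jointly in the jet and the point is what allows the flow to be differentiated in the
jet. -/
lemma contDiff_bracket_family {ι : Type*} {Z : Q → ι → E → E}
    (hZ : ∀ i, ContDiff ℝ ∞ fun v : Q × E => Z v.1 i v.2) (I : List ι) :
    ContDiff ℝ ∞ fun v : Q × E => bracket (Z v.1) I v.2 := by
  rcases eq_or_ne I [] with rfl | hI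
  · exact contDiff_const
  refine nonempty_list_induction (P := fun I => ContDiff ℝ ∞ fun v : Q × E =>
    bracket (Z v.1) I v.2) hZ (fun i J hJ ih => ?_) I hI
  have h1 : ∀ {F : Q → E → E}, (ContDiff ℝ ∞ fun v : Q × E => F v.1 v.2) →
      ContDiff ℝ ∞ fun v : Q × E => fderiv ℝ (F v.1) v.2 := by
    intro F hF
    refine ContDiff.fderiv (f := fun (v : Q × E) x => F v.1 x) (g := fun v => v.2) (m := ∞) (n := ∞) ?_
      contDiff_snd (by simp)
    exact hF.comp (f := fun w : (Q × E) × E => (w.1.1, w.2)) (by fun_prop)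
  simp only [bracket_cons _ i hJ, VectorField.lieBracket]
  exact ((h1 (F := fun q => bracket (Z q) J) ih).clm_apply (hZ i)).sub
    ((h1 (F := fun q => Z q i) (hZ i)).clm_apply ih)

lemma contDiff_multilinear_apply_const (m : ℕ) {F : Type u} [NormedAddCommGroup F]
    [NormedSpace ℝ F] : ContDiff ℝ ∞ fun v : (E [×m]→L[ℝ] F) × E => v.1 fun _ => v.2 := by
  induction m generalizing F with
  | zero =>
    have h1 : (fun v : (E [×0]→L[ℝ] F) × E => v.1 fun _ => v.2) =
        fun v => continuousMultilinearCurryFin0 ℝ E F v.1 := by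
      ext v
      rw [continuousMultilinearCurryFin0_apply]
      congr 1
      exact Subsingleton.elim _ _
    rw [h1]
    exact (continuousMultilinearCurryFin0 ℝ E F).contDiff.comp contDiff_fst
  | succ m ih =>
    have h1 : (fun v : (E [×(m + 1)]→L[ℝ] F) × E => v.1 fun _ => v.2) =
        fun v => (continuousMultilinearCurryRightEquiv' ℝ m E F v.1 fun _ => v.2) v.2 := by
      ext v
      rw [continuousMultilinearCurryRightEquiv_apply']
      congr 1
      ext i
      refine Fin.lastCases ?_ (fun j => ?_) i <;> simp
    rw [h1]
    have h2 : ContDiff ℝ ∞ fun v : (E [×(m + 1)]→L[ℝ] F) × E =>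
        continuousMultilinearCurryRightEquiv' ℝ m E F v.1 :=
      ContDiff.comp (g := continuousMultilinearCurryRightEquiv' ℝ m E F)
        (LinearIsometryEquiv.contDiff _) contDiff_fst
    exact ((ih (F := E →L[ℝ] F)).comp (h2.prodMk contDiff_snd)).clm_apply contDiff_snd

/-- Taylor coefficients of the fields `X_i` of order at most `r - p_i`, with the base point. -/
abbrev Jets (n r : ℕ) (E : Type u) [NormedAddCommGroup E] [NormedSpace ℝ E] : Type u :=
  ((i : Fin (n + 1)) → (m : Fin (r - fieldWeight i + 1)) → E [×(m : ℕ)]→L[ℝ] E) × E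

instance [FiniteDimensional ℝ E] (m : ℕ) : FiniteDimensional ℝ (E [×m]→L[ℝ] E) :=
  FiniteDimensional.of_injective
    (ContinuousMultilinearMap.toMultilinearMapLinear :
      (E [×m]→L[ℝ] E) →ₗ[ℝ] MultilinearMap ℝ (fun _ : Fin m => E) E)
    ContinuousMultilinearMap.toMultilinearMap_injective

/-- The polynomial fields with given Taylor coefficients. -/
def jetField {r : ℕ} (q : Jets n r E) (i : Fin (n + 1)) (x : E) : E :=
  ∑ m : Fin (r - fieldWeight i + 1), ((m : ℕ).factorial : ℝ)⁻¹ • q.1 i m fun _ => x - q.2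

/-- The Taylor coefficients of the fields `X_i` at `y`. -/
def jetAt (r : ℕ) (X : Fin (n + 1) → E → E) (y : E) : Jets n r E :=
  (fun i m => iteratedFDeriv ℝ m (X i) y, y)

lemma jetField_jetAt (r : ℕ) (X : Fin (n + 1) → E → E) (y : E) :
    jetField (jetAt r X y) = approxField r X y := by
  ext i x
  rw [approxField, taylorPoly, Finset.sum_range]
  rfl

lemma contDiff_jetField {r : ℕ} (i : Fin (n + 1)) :
    ContDiff ℝ ∞ fun v : Jets n r E × E => jetField v.1 i v.2 := by
  refine ContDiff.sum fun m _ => contDiff_const.smul ?_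
  have h0 : ContDiff ℝ ∞ fun v : Jets n r E × E => v.1.1 := by fun_prop
  have h1 : ContDiff ℝ ∞ fun v : Jets n r E × E => v.2 - v.1.2 := by fun_prop
  exact (contDiff_multilinear_apply_const (m : ℕ)).comp
    ((contDiff_pi.1 (contDiff_pi.1 h0 i) m).prodMk h1)

/-- The only place where smooth dependence on the base point is lost: the coefficients of the Taylor
polynomials are `C^α` functions of `y`. -/
lemma exists_norm_jetAt_sub_le {r : ℕ} {α : ℝ} (hα₁ : α ≤ 1) {s : Set E}
    {X : Fin (n + 1) → E → E} (hX : ∀ i, HolderClass (r - fieldWeight i) α s (X i)) :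
    ∃ C, 0 ≤ C ∧ ∀ y ∈ s, ∀ y' ∈ s, ‖y - y'‖ ≤ 1 →
      ‖jetAt r X y - jetAt r X y'‖ ≤ C * ‖y - y'‖ ^ α := by
  choose C hC using hX
  refine ⟨(∑ i, |C i|) + 1, by positivity, fun y hy y' hy' h => ?_⟩
  have hi : ∀ i, |C i| ≤ (∑ i, |C i|) + 1 := fun i =>
    (Finset.single_le_sum (fun i _ => abs_nonneg (C i)) (Finset.mem_univ i)).trans (by linarith)
  have h0 : 0 ≤ ‖y - y'‖ ^ α := by positivity
  refine max_le ?_ ?_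
  · refine (pi_norm_le_iff_of_nonneg (by positivity)).2 fun i =>
      (pi_norm_le_iff_of_nonneg (by positivity)).2 fun m => ?_
    refine (((hC i).2 m (by omega)).2 y hy y' hy').trans ?_
    gcongr
    exact (le_abs_self _).trans (hi i)
  · have h1 : ‖y - y'‖ ≤ ‖y - y'‖ ^ α := by
      simpa using Real.rpow_le_rpow_of_exponent_ge_of_imp (norm_nonneg (y - y')) h hα₁
        (fun _ h => absurd h one_ne_zero)
    refine h1.trans (le_mul_of_one_le_left h0 ?_)
    linarith [Finset.sum_nonneg fun i (_ : i ∈ Finset.univ) => abs_nonneg (C i)]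

end Jets

/-! ### Comparison with the free model -/

section Comparison

lemma exists_uniform_bound {ι : Type*} [Finite ι] {P : ι → ℝ → Prop}
    (hP : ∀ i C C', C ≤ C' → P i C → P i C') (h : ∀ i, ∃ C, P i C) :
    ∃ C, 0 ≤ C ∧ ∀ i, P i C := by
  have := Fintype.ofFinite ι
  choose C hC using h
  exact ⟨∑ i, |C i|, by positivity, fun i => hP i _ _ ((le_abs_self _).trans
    (Finset.single_le_sum (fun i _ => abs_nonneg (C i)) (Finset.mem_univ i))) (hC i)⟩

variable {n r : ℕ} {B : Finset (List (Fin (n + 1)))}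

lemma homNorm_dilation {t : ℝ} (ht : 0 < t) (hB : ∀ J : B, 0 < weight (J : List (Fin (n + 1))))
    (u : EuclideanSpace ℝ B) : homNorm (dilation t u) = t * homNorm u := by
  rw [homNorm, homNorm, Finset.mul_sum]
  refine Finset.sum_congr rfl fun J _ => ?_
  rw [dilation_apply, abs_mul, abs_of_pos (pow_pos ht _),
    Real.mul_rpow (pow_pos ht _).le (abs_nonneg _), one_div,
    Real.pow_rpow_inv_natCast ht.le (hB J).ne']

/-- The `K`-component is homogeneous of degree `|K| - |I|`. For positive degree, scaling to
homogeneous norm one gives the exact power; otherwise the Lipschitz bound at the origin gives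
exponent one. -/
lemma IsFreeModel.exists_abs_bracket_le
    {mul : EuclideanSpace ℝ B → EuclideanSpace ℝ B → EuclideanSpace ℝ B}
    {Y : Fin (n + 1) → EuclideanSpace ℝ B → EuclideanSpace ℝ B} (hY : IsFreeModel r B mul Y)
    (hB : IsFreeBasis r B) :
    ∃ C, 0 ≤ C ∧ ∀ I K : B, ∀ u : EuclideanSpace ℝ B, homNorm u ≤ 1 →
      |(bracket Y I u - bracket Y I 0) K| ≤ C * homNorm u ^
        max 1 (weight (K : List (Fin (n + 1))) - weight (I : List (Fin (n + 1)))) := by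
  have hw : ∀ J : B, 0 < weight (J : List (Fin (n + 1))) := hB.weight_pos
  suffices H : ∃ C, 0 ≤ C ∧ ∀ i : B × B, ∀ u : EuclideanSpace ℝ B, homNorm u ≤ 1 →
      |(bracket Y i.1 u - bracket Y i.1 0) i.2| ≤ C * homNorm u ^
        max 1 (weight (i.2 : List (Fin (n + 1))) - weight (i.1 : List (Fin (n + 1)))) from
    H.imp fun C h => ⟨h.1, fun I K => h.2 (I, K)⟩
  refine exists_uniform_bound (fun i C C' hCC h u hu => (h u hu).trans ?_) ?_
  · have := homNorm_nonneg u
    gcongr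
  rintro ⟨I, K⟩
  have hsm : ContDiff ℝ ∞ (bracket Y I) := contDiff_bracket hY.smooth I
  have hcomp : IsCompact (Metric.closedBall (0 : EuclideanSpace ℝ B) B.card) :=
    isCompact_closedBall _ _
  have hmem : ∀ u : EuclideanSpace ℝ B, homNorm u ≤ 1 → u ∈ Metric.closedBall 0 (B.card : ℝ) :=
    fun u hu => by
      rw [mem_closedBall_zero_iff]
      exact (norm_le_homNorm hw hu).trans (mul_le_of_le_one_right (by positivity) hu)
  obtain ⟨C₀, hC₀⟩ := hcomp.exists_bound_of_continuousOn hsm.continuous.continuousOn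
  obtain ⟨C₁, hC₁⟩ := hcomp.exists_bound_of_continuousOn
    (hsm.continuous_fderiv (by simp)).continuousOn
  by_cases hKI : weight (K : List (Fin (n + 1))) ≤ weight (I : List (Fin (n + 1)))
  · refine ⟨|C₁| * B.card, fun u hu => ?_⟩
    rw [Nat.sub_eq_zero_of_le hKI, max_eq_left zero_le_one, pow_one]
    have h1 := (convex_closedBall (0 : EuclideanSpace ℝ B) B.card).norm_image_sub_le_of_norm_fderiv_le
      (C := |C₁|) (fun x _ => hsm.differentiable (by simp) x)
      (fun x hx => (hC₁ x hx).trans (le_abs_self _)) (Metric.mem_closedBall_self (by positivity))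
      (hmem u hu)
    rw [sub_zero] at h1
    calc _ ≤ ‖bracket Y I u - bracket Y I 0‖ := PiLp.norm_apply_le (bracket Y I u - bracket Y I 0) K
      _ ≤ |C₁| * ‖u‖ := h1
      _ ≤ |C₁| * (B.card * homNorm u) := by gcongr; exact norm_le_homNorm hw hu
      _ = _ := by ring
  · have hKI' : K ≠ I := by rintro rfl; exact hKI le_rfl
    refine ⟨|C₀|, fun u hu => ?_⟩
    rw [hY.at_zero, PiLp.sub_apply, PiLp.single_apply, if_neg hKI', sub_zero,
      max_eq_right (by dsimp only; omega)]
    rcases (homNorm_nonneg u).eq_or_lt with h0 | hN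
    · have h1 : u = 0 := by
        have := norm_le_homNorm hw hu
        rw [← h0, mul_zero] at this
        exact norm_le_zero_iff.1 this
      rw [h1, hY.at_zero, PiLp.single_apply, if_neg hKI', abs_zero]
      have := homNorm_nonneg (0 : EuclideanSpace ℝ B)
      positivity
    · set N := homNorm u with hNdef
      set w := dilation N⁻¹ u with hwdef
      have hwu : dilation N w = u := by
        ext J
        rw [dilation_apply, hwdef, dilation_apply, ← mul_assoc, ← mul_pow,
          mul_inv_cancel₀ hN.ne', one_pow, one_mul]
      have hw1 : homNorm w = 1 := by
        rw [hwdef, homNorm_dilation (inv_pos.2 hN) hw, ← hNdef, inv_mul_cancel₀ hN.ne']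
      have h1 := hY.homogeneous I (hB.mem I).1 (fun v => v K)
        (EuclideanSpace.proj K : EuclideanSpace ℝ B →L[ℝ] ℝ).contDiff N hN w
      have h2 : act (bracket Y I) ((fun v => v K) ∘ dilation N) w =
          N ^ weight (K : List (Fin (n + 1))) * bracket Y I w K := by
        have h3 : HasFDerivAt ((fun v : EuclideanSpace ℝ B => v K) ∘ dilation N)
            (N ^ weight (K : List (Fin (n + 1))) •
              (EuclideanSpace.proj K : EuclideanSpace ℝ B →L[ℝ] ℝ)) w := by
          have h4 : ((fun v : EuclideanSpace ℝ B => v K) ∘ dilation N) =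
              ((N ^ weight (K : List (Fin (n + 1))) •
              (EuclideanSpace.proj K : EuclideanSpace ℝ B →L[ℝ] ℝ) :
                EuclideanSpace ℝ B →L[ℝ] ℝ) : EuclideanSpace ℝ B → ℝ) := by
            ext v; simp [dilation_apply]
          rw [h4]; exact ContinuousLinearMap.hasFDerivAt _
        rw [act, h3.fderiv]; simp
      have h3 : act (bracket Y I) (fun v => v K) u = bracket Y I u K := by
        change fderiv ℝ (EuclideanSpace.proj K : EuclideanSpace ℝ B →L[ℝ] ℝ) u _ = _
        rw [ContinuousLinearMap.fderiv]
        rfl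
      rw [h2, hwu, h3] at h1
      have h4 : bracket Y I u K = N ^ (weight (K : List (Fin (n + 1))) -
          weight (I : List (Fin (n + 1)))) * bracket Y I w K := by
        have h5 : N ^ weight (I : List (Fin (n + 1))) ≠ 0 := (pow_pos hN _).ne'
        refine mul_left_cancel₀ h5 ?_
        rw [← h1, ← mul_assoc, ← pow_add]
        congr 2
        omega
      rw [h4, abs_mul, abs_of_pos (pow_pos hN _), mul_comm]
      exact mul_le_mul_of_nonneg_right ((PiLp.norm_apply_le (bracket Y I w) K).trans
        ((hC₀ w (hmem w hw1.le)).trans (le_abs_self _))) (pow_pos hN _).le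

lemma IsFreeBasis.exists_structure (hB : IsFreeBasis r B) : ∃ c : B → B → B → ℝ,
    (∀ J I K : B, weight (K : List (Fin (n + 1))) ≠
      weight (J : List (Fin (n + 1))) + weight (I : List (Fin (n + 1))) → c J I K = 0) ∧
    ∀ J I : B, weight (J : List (Fin (n + 1))) + weight (I : List (Fin (n + 1))) ≤ r →
      freeBracket (J : List (Fin (n + 1))) * freeBracket (I : List (Fin (n + 1))) -
        freeBracket (I : List (Fin (n + 1))) * freeBracket (J : List (Fin (n + 1))) =
      ∑ K : B, c J I K • freeBracket (K : List (Fin (n + 1))) := by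
  have h : ∀ J I : B, ∃ c : B → ℝ, (∀ K : B, weight (K : List (Fin (n + 1))) ≠
      weight (J : List (Fin (n + 1))) + weight (I : List (Fin (n + 1))) → c K = 0) ∧
      (weight (J : List (Fin (n + 1))) + weight (I : List (Fin (n + 1))) ≤ r →
      freeBracket (J : List (Fin (n + 1))) * freeBracket (I : List (Fin (n + 1))) -
        freeBracket (I : List (Fin (n + 1))) * freeBracket (J : List (Fin (n + 1))) =
      ∑ K : B, c K • freeBracket (K : List (Fin (n + 1)))) := by
    intro J I
    by_cases hJI : weight (J : List (Fin (n + 1))) + weight (I : List (Fin (n + 1))) ≤ r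
    · obtain ⟨c, hc, hc'⟩ := hB.commutator (hB.mem J).1 (hB.mem I).1 hJI
      exact ⟨c, hc', fun _ => hc⟩
    · exact ⟨0, fun _ _ => rfl, fun h => absurd h hJI⟩
  choose c hc using h
  exact ⟨c, fun J I => (hc J I).1, fun J I => (hc J I).2⟩

/-- Hölder exponent `1` provides the Lipschitz estimate, and the product of the bounds on the fields
and their derivatives gives the `2 C²` for brackets. -/
lemma isCanonicalFrame_of_holderClassWith {C : ℝ} {c : B → B → B → ℝ} {ε : ℝ} (hε : 0 < ε)
    {v : B → EuclideanSpace ℝ B → EuclideanSpace ℝ B}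
    (hv : ∀ I, HolderClassWith C 1 1 (Metric.ball 0 ε) (v I))
    (h0 : ∀ I, v I 0 = EuclideanSpace.single I 1)
    (he : ∀ u ∈ Metric.ball (0 : EuclideanSpace ℝ B) ε, ∑ J, u J • v J u = u)
    (hl : ∀ J I : B, weight (J : List (Fin (n + 1))) + weight (I : List (Fin (n + 1))) ≤ r →
      ∀ u ∈ Metric.ball (0 : EuclideanSpace ℝ B) ε,
        VectorField.lieBracket ℝ (v J) (v I) u = ∑ K, c J I K • v K u) :
    IsCanonicalFrame r (max C (2 * (C * C))) c (Metric.ball 0 ε) v := by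
  have h1 := fun I => (HolderClassWith.succ_iff (k := 0) Metric.isOpen_ball).1 (hv I)
  refine ⟨fun I u hu => (h1 I).2.1.differentiableAt (Metric.isOpen_ball.mem_nhds hu), h0, he, hl,
    fun J I u hu => ?_, fun I u hu => ?_⟩
  · have hC := (h1 I).1.nonneg hu
    have key : ∀ I J, ‖fderiv ℝ (v I) u (v J u)‖ ≤ C * C := fun I J =>
      ((fderiv ℝ (v I) u).le_opNorm _).trans (by
        gcongr
        exacts [(h1 I).2.2.bound hu, (h1 J).1.bound hu])
    refine le_trans ?_ (le_max_right _ _)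
    rw [VectorField.lieBracket, two_mul]
    exact (norm_sub_le _ _).trans (add_le_add (key _ _) (key _ _))
  · have h2 := (h1 I).1.holder hu (Metric.mem_ball_self hε)
    rw [sub_zero, Real.rpow_one] at h2
    exact h2.trans (by gcongr; exact le_max_left _ _)

/-! ### Smooth families of fields in exponential coordinates. -/

variable {E Q : Type} [NormedAddCommGroup E] [NormedSpace ℝ E] [NormedAddCommGroup Q]
  [NormedSpace ℝ Q]

lemma exists_holderClassWith_of_contDiff [ProperSpace E] {F : Type} [NormedAddCommGroup F]
    [NormedSpace ℝ F] (k : ℕ) {α : ℝ} (hα₀ : 0 < α) (hα₁ : α ≤ 1) {f : E → F}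
    (hf : ContDiff ℝ ∞ f) (a : E) {ε : ℝ} (hε : 0 ≤ ε) :
    ∃ C, HolderClassWith C k α (Metric.ball a ε) f := by
  obtain ⟨C, hC⟩ := exists_holderClassWith_of_contDiffOn (Q := ℝ) (q₀ := 0) (a := a) (ε := ε) k hα₀
    hα₁ isOpen_univ (Set.subset_univ _) (f := fun v => f v.1) (hf.comp contDiff_fst).contDiffOn
  exact ⟨C, hC 0 (Metric.mem_closedBall_self hε)⟩

/-- `Ex (u, q)` is a smooth family of exponential maps of the fields `∑ u_I Z(q)_[I]` based at
`π q`, and `M` is the inverse of its differential in `u`. -/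
structure IsExpFamily (Z : Q → Fin (n + 1) → E → E) (π : Q →L[ℝ] E)
    (O : Set (EuclideanSpace ℝ B × Q)) (Ex : EuclideanSpace ℝ B × Q → E)
    (M : EuclideanSpace ℝ B × Q → E →L[ℝ] EuclideanSpace ℝ B) : Prop where
  isOpen : IsOpen O
  contDiffOn_exp : ContDiffOn ℝ ∞ Ex O
  contDiffOn_inv : ContDiffOn ℝ ∞ M O
  inverse : ∀ v ∈ O, IsPartialInverse Ex (M v) v
  euler : ∀ v ∈ O, fderiv ℝ Ex v (v.1, 0) = ∑ I : B, v.1 I • bracket (Z v.2) I (Ex v)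
  zero_mem : ∀ v ∈ O, (0, v.2) ∈ O
  at_zero : ∀ v ∈ O, Ex (0, v.2) = π v.2
  fderiv_at_zero : ∀ v ∈ O, ∀ u, fderiv ℝ Ex (0, v.2) (u, 0) =
    ∑ I : B, u I • bracket (Z v.2) I (π v.2)

namespace IsExpFamily

variable {Z : Q → Fin (n + 1) → E → E} {π : Q →L[ℝ] E} {O : Set (EuclideanSpace ℝ B × Q)}
  {Ex : EuclideanSpace ℝ B × Q → E} {M : EuclideanSpace ℝ B × Q → E →L[ℝ] EuclideanSpace ℝ B}

/-- The fields `Z(q)_[I]` in the coordinates given by the exponential map. -/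
def field (Z : Q → Fin (n + 1) → E → E) (Ex : EuclideanSpace ℝ B × Q → E)
    (M : EuclideanSpace ℝ B × Q → E →L[ℝ] EuclideanSpace ℝ B) (I : List (Fin (n + 1)))
    (v : EuclideanSpace ℝ B × Q) : EuclideanSpace ℝ B :=
  M v (bracket (Z v.2) I (Ex v))

lemma contDiffOn_field (h : IsExpFamily Z π O Ex M)
    (hZ : ∀ i, ContDiff ℝ ∞ fun v : Q × E => Z v.1 i v.2) (I : List (Fin (n + 1))) :
    ContDiffOn ℝ ∞ (field Z Ex M I) O :=
  h.contDiffOn_inv.clm_apply ((contDiff_bracket_family hZ I).comp_contDiffOn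
    (contDiffOn_snd.prodMk h.contDiffOn_exp))

lemma field_at_zero (h : IsExpFamily Z π O Ex M) {v : EuclideanSpace ℝ B × Q} (hv : v ∈ O)
    (I : B) : field Z Ex M I (0, v.2) = EuclideanSpace.single I 1 := by
  have h1 := DFunLike.congr_fun (h.inverse _ (h.zero_mem v hv)).1 (EuclideanSpace.single I (1 : ℝ))
  have h2 := h.fderiv_at_zero v hv (EuclideanSpace.single I 1)
  simp only [ContinuousLinearMap.comp_apply, ContinuousLinearMap.inl_apply,
    ContinuousLinearMap.id_apply] at h1
  rw [h2] at h1
  rw [field, h.at_zero v hv, ← h1]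
  congr 1
  simp [PiLp.single_apply]

lemma field_euler (h : IsExpFamily Z π O Ex M) {v : EuclideanSpace ℝ B × Q} (hv : v ∈ O) :
    ∑ I : B, v.1 I • field Z Ex M I v = v.1 := by
  have h1 := DFunLike.congr_fun (h.inverse v hv).1 v.1
  simp only [ContinuousLinearMap.comp_apply, ContinuousLinearMap.inl_apply,
    ContinuousLinearMap.id_apply] at h1
  rw [h.euler v hv] at h1
  simpa [field, map_sum] using h1

lemma hasFDerivAt_exp (h : IsExpFamily Z π O Ex M) {u : EuclideanSpace ℝ B} {q : Q}
    (hv : (u, q) ∈ O) : HasFDerivAt (fun u => Ex (u, q))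
      (fderiv ℝ Ex (u, q) ∘L .inl ℝ (EuclideanSpace ℝ B) Q) u :=
  ((h.contDiffOn_exp.contDiffAt (h.isOpen.mem_nhds hv)).differentiableAt
    (by simp)).hasFDerivAt.comp u (hasFDerivAt_prodMk_left u q)

lemma field_eq_pullback (h : IsExpFamily Z π O Ex M) {u : EuclideanSpace ℝ B} {q : Q}
    (hv : (u, q) ∈ O) (I : List (Fin (n + 1))) :
    field Z Ex M I (u, q) = VectorField.pullback ℝ (fun u => Ex (u, q)) (bracket (Z q) I) u := by
  rw [VectorField.pullback, (h.hasFDerivAt_exp hv).fderiv,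
    ContinuousLinearMap.inverse_eq (h.inverse _ hv).2 (h.inverse _ hv).1, field]

/-- Pullback by the exponential map commutes with Lie brackets, so the universal structure constants
survive the change of coordinates. -/
lemma lieBracket_field [CompleteSpace E] (h : IsExpFamily Z π O Ex M)
    (hZ : ∀ i, ContDiff ℝ ∞ fun v : Q × E => Z v.1 i v.2) {c : B → ℝ} {J I : List (Fin (n + 1))}
    (hJ : J ≠ []) (hI : I ≠ []) (hB : ∀ K ∈ B, K ≠ [])
    (hc : freeBracket J * freeBracket I - freeBracket I * freeBracket J =
      ∑ K : B, c K • freeBracket (K : List (Fin (n + 1)))) {u : EuclideanSpace ℝ B} {q : Q}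
    (hv : (u, q) ∈ O) :
    VectorField.lieBracket ℝ (fun u => field Z Ex M J (u, q)) (fun u => field Z Ex M I (u, q)) u =
      ∑ K : B, c K • field Z Ex M K (u, q) := by
  have hZq : ∀ i, ContDiff ℝ ∞ (Z q i) := fun i => (hZ i).comp (f := fun x : E => (q, x))
    (by fun_prop)
  have hev : ∀ I, (fun u => field Z Ex M I (u, q)) =ᶠ[𝓝 u]
      VectorField.pullback ℝ (fun u => Ex (u, q)) (bracket (Z q) I) := by
    intro I
    have h1 : ∀ᶠ w in 𝓝 u, (w, q) ∈ O :=
      (by fun_prop : ContinuousAt (fun w : EuclideanSpace ℝ B => (w, q)) u).eventually_mem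
        (h.isOpen.mem_nhds hv)
    filter_upwards [h1] with w hw using h.field_eq_pullback hw I
  have hdiff : ∀ I, Differentiable ℝ (bracket (Z q) I) := fun I =>
    (contDiff_bracket hZq I).differentiable (by simp)
  have hex : ContDiffAt ℝ ∞ (fun u => Ex (u, q)) u :=
    (h.contDiffOn_exp.contDiffAt (h.isOpen.mem_nhds hv)).comp u (f := fun u => (u, q))
      (by fun_prop)
  rw [(hev J).lieBracket_vectorField_eq (hev I),
    ← VectorField.pullback_lieBracket (n := ∞) (by simp [two_le_infty]) hex
      (hdiff J _) (hdiff I _),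
    lieBracket_bracket_eq_sum hZq (K := fun K : B => (K : List (Fin (n + 1)))) hJ hI
      (fun K _ => hB K K.2) hc]
  simp only [h.field_eq_pullback hv, VectorField.pullback, map_sum, map_smul]

/-- In exponential coordinates the smooth fields agree with the fields of the free model up to
terms of positive weight. -/
theorem exists_abs_field_sub_le [FiniteDimensional ℝ E] [FiniteDimensional ℝ Q]
    (h : IsExpFamily Z π O Ex M)
    (hZ : ∀ i, ContDiff ℝ ∞ fun v : Q × E => Z v.1 i v.2) (hB : IsFreeBasis r B)
    {mul : EuclideanSpace ℝ B → EuclideanSpace ℝ B → EuclideanSpace ℝ B}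
    {Y : Fin (n + 1) → EuclideanSpace ℝ B → EuclideanSpace ℝ B} (hY : IsFreeModel r B mul Y)
    {q₀ : Q} {ε : ℝ} (hε : 0 < ε)
    (hO : Metric.closedBall 0 ε ×ˢ Metric.closedBall q₀ ε ⊆ O)
    (hN : ∀ u ∈ Metric.ball (0 : EuclideanSpace ℝ B) ε, homNorm u ≤ 1)
    {I : List (Fin (n + 1))} (hI : I ∈ multiindices n r) :
    ∃ C, 0 ≤ C ∧ ∀ q ∈ Metric.closedBall q₀ ε, ∀ u ∈ Metric.ball (0 : EuclideanSpace ℝ B) ε,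
      ∀ K : B, |(field Z Ex M I (u, q) - bracket Y I u) K| ≤
        C * homNorm u ^ (1 + (weight (K : List (Fin (n + 1))) - weight I)) := by
  have := FiniteDimensional.proper_real Q
  have hne : ∀ K ∈ B, K ≠ [] := fun K hK => (hB.subset hK).1
  have hmem : ∀ q ∈ Metric.closedBall q₀ ε, ∀ u ∈ Metric.ball (0 : EuclideanSpace ℝ B) ε,
    (u, q) ∈ O := fun q hq u hu => hO ⟨Metric.ball_subset_closedBall hu, hq⟩
  obtain ⟨c, hc, hc'⟩ := hB.exists_structure
  obtain ⟨C₁, hC₁, hv⟩ := exists_uniform_bound (ι := B) (P := fun I C => ∀ q ∈ Metric.closedBall q₀ ε,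
      HolderClassWith C 1 1 (Metric.ball 0 ε) (fun u => field Z Ex M I (u, q)))
    (fun I C C' hCC h q hq => (h q hq).mono_const hCC) fun I =>
    exists_holderClassWith_of_contDiffOn 1 one_pos le_rfl h.isOpen hO (h.contDiffOn_field hZ I)
  obtain ⟨C₂, hC₂, hy⟩ := exists_uniform_bound (ι := B) (P := fun I C => 
      HolderClassWith C 1 1 (Metric.ball 0 ε) (bracket Y I))
    (fun I C C' hCC h => h.mono_const hCC) fun I =>
    exists_holderClassWith_of_contDiff 1 one_pos le_rfl (contDiff_bracket hY.smooth I) 0 hε.le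
  obtain ⟨C₃, hC₃, hyw⟩ := hY.exists_abs_bracket_le hB
  set C₄ := max C₃ (max C₁ C₂) with hC₄
  set C₅ := max C₄ (2 * (C₄ * C₄)) with hC₅
  have hC₅0 : 0 ≤ C₅ := hC₃.trans ((le_max_left _ _).trans (le_max_left _ _))
  obtain ⟨C, hC, hfr⟩ := exists_frame_comparison hB.weight_pos hB.weight_le C₅ hC₅0 c hc
  obtain ⟨a, ha, ha'⟩ := hB.expansion I hI
  refine ⟨(∑ K, |a K|) * C, by positivity, fun q hq u hu K => ?_⟩
  have hframe := hfr (Metric.ball 0 ε) (fun I u => field Z Ex M I (u, q)) (fun I u => bracket Y I u)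
    Metric.isOpen_ball ((convex_ball _ _).starConvex (Metric.mem_ball_self hε)) hN
    (isCanonicalFrame_of_holderClassWith hε (fun I => (hv I q hq).mono_const
        ((le_max_left _ _).trans (le_max_right _ _)))
      (fun I => h.field_at_zero (hmem q hq 0 (Metric.mem_ball_self hε)) I)
      (fun u hu => h.field_euler (hmem q hq u hu))
      (fun J I hJI u hu => h.lieBracket_field hZ (hB.mem J).1 (hB.mem I).1 hne (hc' J I hJI)
        (hmem q hq u hu)))
    (isCanonicalFrame_of_holderClassWith hε (fun I => (hy I).mono_const
        ((le_max_right _ _).trans (le_max_right _ _)))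
      hY.at_zero (fun u _ => hY.euler u)
      (fun J I hJI u _ => by
        rw [lieBracket_bracket_eq_sum hY.smooth (K := fun K : B => (K : List (Fin (n + 1))))
          (hB.mem J).1 (hB.mem I).1
          (fun K _ => hne K K.2) (hc' J I hJI)]))
    (fun I K u hu => (hyw I K u (hN u hu)).trans (by
      have := homNorm_nonneg u
      gcongr
      exact (le_max_left _ _).trans (le_max_left _ _)))
  -- The comparison is known for `B`. A general commutator is a combination of members of `B` of the
  -- same weight, with the same coefficients for both frames.
  have hZq : ∀ i, ContDiff ℝ ∞ (Z q i) := fun i => (hZ i).comp (f := fun x : E => (q, x))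
    (by fun_prop)
  have e1 : field Z Ex M I (u, q) - bracket Y I u =
      ∑ L : B, a L • (field Z Ex M L (u, q) - bracket Y L u) := by
    rw [field, bracket_eq_sum hZq (K := fun K : B => (K : List (Fin (n + 1)))) hI.1
      (fun K _ => hne K K.2) ha, bracket_eq_sum hY.smooth
      (K := fun K : B => (K : List (Fin (n + 1)))) hI.1 (fun K _ => hne K K.2) ha]
    simp [field, map_sum, smul_sub]
  rw [e1, WithLp.ofLp_sum, Finset.sum_apply, Finset.sum_mul, Finset.sum_mul]
  refine (Finset.abs_sum_le_sum_abs _ _).trans (Finset.sum_le_sum fun L _ => ?_)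
  rw [PiLp.smul_apply, smul_eq_mul, abs_mul]
  by_cases hL : weight (L : List (Fin (n + 1))) = weight I
  · have := hframe L K u hu
    rw [hL] at this
    rw [mul_assoc]
    gcongr
  · rw [ha' L hL, abs_zero, zero_mul, zero_mul, zero_mul]

end IsExpFamily

end Comparison

/-! ### Existence of exponential charts -/

section Existence

variable {n r : ℕ} {B : Finset (List (Fin (n + 1)))} {E Q : Type} [NormedAddCommGroup E]
  [NormedSpace ℝ E] [NormedAddCommGroup Q] [NormedSpace ℝ Q]

lemma contDiff_frameMap {P : Type*} [NormedAddCommGroup P] [NormedSpace ℝ P] {z : P → B → E}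
    (hz : ∀ I, ContDiff ℝ ∞ fun v => z v I) : ContDiff ℝ ∞ fun v => frameMap (z v) := by
  refine ContDiff.sum fun I _ => ?_
  exact (ContinuousLinearMap.smulRightL ℝ (EuclideanSpace ℝ B) E
    (EuclideanSpace.proj I : EuclideanSpace ℝ B →L[ℝ] ℝ)).contDiff.comp (hz I)

/-- The flow, the charts and all local bounds are gathered on one ball. Its radius is `2 ε` so that
it contains the compact product of closed `ε`-balls on which uniform Hölder bounds are taken; `η`
keeps the image where the given fields are defined. -/
theorem exists_isExpFamily [FiniteDimensional ℝ E] [FiniteDimensional ℝ Q]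
    {Z : Q → Fin (n + 1) → E → E} (hZ : ∀ i, ContDiff ℝ ∞ fun v : Q × E => Z v.1 i v.2)
    (π : Q →L[ℝ] E) {q₀ : Q} (hB : ∀ J : B, 0 < weight (J : List (Fin (n + 1))))
    (hinv : (frameMap fun I : B => bracket (Z q₀) I (π q₀)).IsInvertible) {η : ℝ} (hη : 0 < η) :
    ∃ (Ex : EuclideanSpace ℝ B × Q → E) (M : EuclideanSpace ℝ B × Q → E →L[ℝ] EuclideanSpace ℝ B)
      (ε C δ : ℝ) (Θ : Q → OpenPartialHomeomorph E (EuclideanSpace ℝ B)),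
      0 < ε ∧ 0 ≤ C ∧ 0 < δ ∧ δ ≤ ε ∧ IsExpFamily Z π (Metric.ball (0, q₀) (2 * ε)) Ex M ∧
      (∀ v ∈ Metric.ball ((0 : EuclideanSpace ℝ B), q₀) (2 * ε),
        IsExp (combination (Z v.2) B v.1) (π v.2) (Ex v) ∧ Ex v ∈ Metric.ball (π q₀) η ∧
        homNorm v.1 ≤ 1 ∧ ‖M v‖ ≤ C ∧
        ∀ v' ∈ Metric.ball ((0 : EuclideanSpace ℝ B), q₀) (2 * ε),
          ‖Ex v - Ex v'‖ ≤ C * ‖v - v'‖ ∧ ‖M v - M v'‖ ≤ C * ‖v - v'‖) ∧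
      (∀ q ∈ Metric.ball q₀ ε, (Θ q).target = Metric.ball 0 ε ∧
        ContDiffOn ℝ ∞ (Θ q) (Θ q).source ∧ ContDiffOn ℝ ∞ (Θ q).symm (Metric.ball 0 ε) ∧
        ∀ u ∈ Metric.ball (0 : EuclideanSpace ℝ B) ε, (Θ q).symm u = Ex (u, q) ∧
          fderiv ℝ (Θ q) (Ex (u, q)) = M (u, q)) ∧
      ∀ x ∈ Metric.ball (π q₀) δ, ∀ q ∈ Metric.ball q₀ δ, x ∈ (Θ q).source ∧
        ∀ q' ∈ Metric.ball q₀ δ, ‖Θ q x - Θ q' x‖ ≤ C * ‖q - q'‖ ∧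
          ‖fderiv ℝ (Θ q) x - fderiv ℝ (Θ q') x‖ ≤ C * ‖q - q'‖ := by
  have : CompleteSpace E := FiniteDimensional.complete ℝ E
  have : CompleteSpace Q := FiniteDimensional.complete ℝ Q
  let A : Q × E → EuclideanSpace ℝ B →L[ℝ] E := fun v =>
    frameMap fun I : B => bracket (Z v.1) I v.2
  have hA : ContDiff ℝ ∞ A := contDiff_frameMap fun I => contDiff_bracket_family hZ I
  obtain ⟨Ex, h1, h2⟩ := exists_smooth_exp π hA q₀
  have h0 := h2.self_of_nhds
  have hG : fderiv ℝ Ex (0, q₀) ∘L .inl ℝ (EuclideanSpace ℝ B) Q = A (q₀, π q₀) := by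
    ext u : 1
    exact h0.2 u
  obtain ⟨M, hM, ρ, hρ, hchart⟩ := exists_chart_family (f := Ex) (h1.mono fun p hp => hp.1)
    (by rw [hG]; exact hinv)
  obtain ⟨K₁, s₁, hs₁, hL₁⟩ :=
    (h1.self_of_nhds.1.of_le (m := 1) (by simp)).exists_lipschitzOnWith
  obtain ⟨K₂, s₂, hs₂, hL₂⟩ :=
    (hM.self_of_nhds.1.of_le (m := 1) (by simp)).exists_lipschitzOnWith
  have hEx : ∀ᶠ v in 𝓝 ((0 : EuclideanSpace ℝ B), q₀), Ex v ∈ Metric.ball (π q₀) η := by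
    refine h1.self_of_nhds.1.continuousAt.eventually_mem ?_
    rw [h0.1]; exact Metric.ball_mem_nhds _ hη
  have hN : ∀ᶠ v in 𝓝 ((0 : EuclideanSpace ℝ B), q₀), homNorm v.1 ≤ 1 := by
    have h3 : Continuous fun v : EuclideanSpace ℝ B × Q => homNorm v.1 :=
      continuous_homNorm.comp continuous_fst
    have h4 := h3.tendsto ((0 : EuclideanSpace ℝ B), q₀)
    rw [homNorm_zero hB] at h4
    exact (h4.eventually_lt_const one_pos).mono fun v hv => hv.le
  have hMb : ∀ᶠ v in 𝓝 ((0 : EuclideanSpace ℝ B), q₀), ‖M v‖ ≤ ‖M (0, q₀)‖ + 1 :=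
    (hM.self_of_nhds.1.continuousAt.norm.eventually_lt_const (lt_add_one _)).mono
      fun v hv => hv.le
  have h2' : ∀ᶠ v in 𝓝 ((0 : EuclideanSpace ℝ B), q₀), Ex (0, v.2) = π v.2 ∧
      ∀ u, fderiv ℝ Ex (0, v.2) (u, 0) = A (v.2, π v.2) u :=
    (continuous_snd.tendsto ((0 : EuclideanSpace ℝ B), q₀)).eventually h2
  obtain ⟨ρ', hρ', hgood⟩ := Metric.eventually_nhds_iff_ball.1
    (((((((h1.and hM).and h2').and hEx).and hN).and hMb).and (eventually_mem_set.2 hs₁)).and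
      (eventually_mem_set.2 hs₂))
  set ε := min ρ (ρ' / 2) with hε
  have hε0 : 0 < ε := by positivity
  have hsub : Metric.ball ((0 : EuclideanSpace ℝ B), q₀) (2 * ε) ⊆ Metric.ball (0, q₀) ρ' :=
    Metric.ball_subset_ball (by linarith [min_le_right ρ (ρ' / 2)])
  obtain ⟨Θ, C, δ, hδ, hΘ, hΘ'⟩ := hchart ε hε0 (min_le_left _ _)
  refine ⟨Ex, M, ε, max |C| (max (‖M (0, q₀)‖ + 1) (max K₁ K₂)), min δ ε, Θ, hε0, by positivity,
    by positivity, min_le_right _ _, ?_, ?_, ?_, ?_⟩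
  · have hfm : ∀ v u, A v u = ∑ I : B, u I • bracket (Z v.1) I v.2 := fun v u => frameMap_apply _ _
    refine ⟨Metric.isOpen_ball, fun v hv => ?_, fun v hv => ?_, fun v hv => ?_, fun v hv => ?_,
      fun v hv => ?_, fun v hv => ?_, fun v hv u => ?_⟩
    · exact (hgood v (hsub hv)).1.1.1.1.1.1.1.1.contDiffWithinAt
    · exact (hgood v (hsub hv)).1.1.1.1.1.1.2.1.contDiffWithinAt
    · exact (hgood v (hsub hv)).1.1.1.1.1.1.2.2
    · rw [(hgood v (hsub hv)).1.1.1.1.1.1.1.2.2, hfm]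
    · rw [Metric.mem_ball, Prod.dist_eq] at hv ⊢
      exact max_lt (by simpa using hε0) ((le_max_right _ _).trans_lt hv)
    · exact (hgood v (hsub hv)).1.1.1.1.1.2.1
    · rw [(hgood v (hsub hv)).1.1.1.1.1.2.2, hfm]
  · intro v hv
    have hg := hgood v (hsub hv)
    refine ⟨?_, hg.1.1.1.1.2, hg.1.1.1.2, hg.1.1.2.trans ((le_max_left _ _).trans
      (le_max_right _ _)), fun v' hv' => ⟨?_, ?_⟩⟩
    · have := hg.1.1.1.1.1.1.1.2.1
      convert this using 2 with x
      exact (frameMap_apply _ _).symm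
    · refine (hL₁.norm_sub_le hg.1.2 (hgood v' (hsub hv')).1.2).trans ?_
      gcongr
      exact (le_max_left _ _).trans ((le_max_right _ _).trans (le_max_right _ _))
    · refine (hL₂.norm_sub_le hg.2 (hgood v' (hsub hv')).2).trans ?_
      gcongr
      exact (le_max_right _ _).trans ((le_max_right _ _).trans (le_max_right _ _))
  · exact fun q hq => hΘ q (Metric.ball_subset_ball (min_le_left _ _) hq)
  · intro x hx q hq
    have hmem : ∀ {q}, q ∈ Metric.ball q₀ (min δ ε) → q ∈ Metric.ball q₀ δ := fun hq =>
      Metric.ball_subset_ball (min_le_left _ _) hq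
    have h3 := hΘ' x (by rw [h0.1]; exact Metric.ball_subset_ball (min_le_left _ _) hx) q (hmem hq)
    have hC : C ≤ max |C| (max (‖M (0, q₀)‖ + 1) (max K₁ K₂)) :=
      (le_abs_self C).trans (le_max_left _ _)
    exact ⟨h3.1, fun q' hq' => ⟨(h3.2 q' (hmem hq')).1.trans (by gcongr),
      (h3.2 q' (hmem hq')).2.trans (by gcongr)⟩⟩

end Existence

/-! ### The fields in exponential coordinates -/

section Remainder

variable {n r : ℕ} {B : Finset (List (Fin (n + 1)))} {E Q : Type} [NormedAddCommGroup E]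
  [NormedSpace ℝ E] [NormedAddCommGroup Q] [NormedSpace ℝ Q]
  {Z : Q → Fin (n + 1) → E → E} {π : Q →L[ℝ] E} {O : Set (EuclideanSpace ℝ B × Q)}
  {Ex : EuclideanSpace ℝ B × Q → E} {M : EuclideanSpace ℝ B × Q → E →L[ℝ] EuclideanSpace ℝ B}

/-- Only `f` has limited smoothness. The change of coordinates is smooth with bounds uniform in `q`,
so the regularity of `f` is kept uniformly. -/
lemma IsExpFamily.exists_holderClassWith_coords [FiniteDimensional ℝ E] [FiniteDimensional ℝ Q]
    (h : IsExpFamily Z π O Ex M) {α : ℝ} (hα₀ : 0 < α) (hα₁ : α ≤ 1) {q₀ : Q} {ε : ℝ}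
    (hO : Metric.closedBall 0 ε ×ˢ Metric.closedBall q₀ ε ⊆ O) {s : Set E} (hs : IsOpen s)
    (hmaps : ∀ v ∈ O, Ex v ∈ s) {L : ℝ}
    (hL : ∀ v ∈ O, ∀ v' ∈ O, ‖Ex v - Ex v'‖ ≤ L * ‖v - v'‖) {k : ℕ} {f : E → E}
    (hf : HolderClass k α s f) :
    ∃ C, ∀ q ∈ Metric.closedBall q₀ ε, HolderClassWith C k α (Metric.ball 0 ε)
      (fun u => M (u, q) (f (Ex (u, q)))) := by
  have := FiniteDimensional.proper_real Q
  have hmem : ∀ q ∈ Metric.closedBall q₀ ε, ∀ u ∈ Metric.ball (0 : EuclideanSpace ℝ B) ε,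
    (u, q) ∈ O := fun q hq u hu => hO ⟨Metric.ball_subset_closedBall hu, hq⟩
  obtain ⟨Cf, hCf⟩ := hf
  obtain ⟨CM, hCM⟩ := exists_holderClassWith_of_contDiffOn k hα₀ hα₁ h.isOpen hO h.contDiffOn_inv
  obtain ⟨CE, hCE⟩ := exists_holderClassWith_of_contDiffOn k hα₀ hα₁ h.isOpen hO h.contDiffOn_exp
  obtain ⟨C₁, hC₁⟩ := HolderClassWith.comp (D := EuclideanSpace ℝ B) (E := E) (F := E) k hα₀.le
    Cf CE L
  obtain ⟨C₂, hC₂⟩ := HolderClassWith.bilinear (E := EuclideanSpace ℝ B) k (α := α)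
    (ContinuousLinearMap.id ℝ (E →L[ℝ] EuclideanSpace ℝ B)) CM C₁
  refine ⟨C₂, fun q hq => ?_⟩
  refine hC₂ Metric.isOpen_ball (hCM q hq) (hC₁ hs Metric.isOpen_ball
    (fun u hu => hmaps _ (hmem q hq u hu)) hCf (hCE q hq) fun x hx y hy => ?_)
  refine (hL _ (hmem q hq x hx) _ (hmem q hq y hy)).trans_eq ?_
  simp [Prod.norm_def]

/-- Variation in `q` at fixed `u`. It is used with `β = 1` when the field has a bounded derivative
and with `β = α` at top weight. -/
lemma norm_coords_sub_le {C : ℝ} (hM : ∀ v ∈ O, ‖M v‖ ≤ C)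
    (hL : ∀ v ∈ O, ∀ v' ∈ O, ‖Ex v - Ex v'‖ ≤ C * ‖v - v'‖ ∧ ‖M v - M v'‖ ≤ C * ‖v - v'‖)
    {s : Set E} (hmaps : ∀ v ∈ O, Ex v ∈ s) {f : E → E} {Cf β : ℝ} (hβ : 0 ≤ β)
    (hf : ∀ x ∈ s, ‖f x‖ ≤ Cf) (hf' : ∀ x ∈ s, ∀ y ∈ s, ‖f x - f y‖ ≤ Cf * ‖x - y‖ ^ β)
    {u : EuclideanSpace ℝ B} {q q' : Q} (hq : (u, q) ∈ O) (hq' : (u, q') ∈ O) :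
    ‖M (u, q) (f (Ex (u, q))) - M (u, q') (f (Ex (u, q')))‖ ≤
      C * Cf * ‖q - q'‖ + C * Cf * C ^ β * ‖q - q'‖ ^ β := by
  have hC : 0 ≤ C := (norm_nonneg _).trans (hM _ hq)
  have hCf : 0 ≤ Cf := (norm_nonneg _).trans (hf _ (hmaps _ hq))
  have e1 : ‖((u, q) : EuclideanSpace ℝ B × Q) - (u, q')‖ = ‖q - q'‖ := by simp [Prod.norm_def]
  have h1 := hL _ hq _ hq'
  rw [e1] at h1
  have e2 : M (u, q) (f (Ex (u, q))) - M (u, q') (f (Ex (u, q'))) =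
      (M (u, q) - M (u, q')) (f (Ex (u, q))) + M (u, q') (f (Ex (u, q)) - f (Ex (u, q'))) := by
    simp
  rw [e2]
  refine (norm_add_le _ _).trans (add_le_add ?_ ?_)
  · calc _ ≤ ‖M (u, q) - M (u, q')‖ * ‖f (Ex (u, q))‖ := ContinuousLinearMap.le_opNorm _ _
      _ ≤ (C * ‖q - q'‖) * Cf := by gcongr; exacts [h1.2, hf _ (hmaps _ hq)]
      _ = _ := by ring
  · calc _ ≤ ‖M (u, q')‖ * ‖f (Ex (u, q)) - f (Ex (u, q'))‖ := ContinuousLinearMap.le_opNorm _ _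
      _ ≤ C * (Cf * (C * ‖q - q'‖) ^ β) := by
        gcongr
        · exact hM _ hq'
        · refine (hf' _ (hmaps _ hq) _ (hmaps _ hq')).trans ?_
          gcongr
          exact h1.1
      _ = _ := by rw [Real.mul_rpow hC (norm_nonneg _)]; ring

/-- Since the homogeneous norm is at most one, larger exponents are better: `F` gains a full unit
and `α ≤ 1`, while the order `r - w + α` of `G` suffices for every component because all weights are
at most `r`. -/
lemma hasWeightGEWith_add {C₁ C₂ α : ℝ} (hα₀ : 0 < α) (hα₁ : α ≤ 1) (hC₁ : 0 ≤ C₁) (hC₂ : 0 ≤ C₂)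
    {U : Set (EuclideanSpace ℝ B)} {F G : EuclideanSpace ℝ B → EuclideanSpace ℝ B} {w : ℕ}
    (hw : w ≤ r) (hB : ∀ J : B, weight (J : List (Fin (n + 1))) ≤ r)
    (hN : ∀ u ∈ U, homNorm u ≤ 1)
    (hF : ∀ u ∈ U, ∀ K : B, |F u K| ≤ C₁ * homNorm u ^ (1 + (weight (K : List (Fin (n + 1))) - w)))
    (hG : ∀ u ∈ U, ‖G u‖ ≤ C₂ * homNorm u ^ (((r - w : ℕ) : ℝ) + α)) :
    HasWeightGEWith (C₁ + C₂) (α - w) U (fun u => G u + F u) := by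
  intro u hu K _
  have hwR : (w : ℝ) ≤ r := by exact_mod_cast hw
  have hKR : (weight (K : List (Fin (n + 1))) : ℝ) ≤ r := by exact_mod_cast hB K
  have hN0 := homNorm_nonneg u
  have key : ∀ y : ℝ, 0 < y → α - w + weight (K : List (Fin (n + 1))) ≤ y →
      homNorm u ^ y ≤ homNorm u ^ (α - w + weight (K : List (Fin (n + 1)))) := fun y hy hle =>
    Real.rpow_le_rpow_of_exponent_ge_of_imp hN0 (hN u hu) hle fun _ h => absurd h hy.ne'
  have h1 : |F u K| ≤ C₁ * homNorm u ^ (α - w + weight (K : List (Fin (n + 1)))) := by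
    refine (hF u hu K).trans ?_
    rw [← Real.rpow_natCast]
    gcongr 1
    refine key _ (by positivity) ?_
    have : (weight (K : List (Fin (n + 1))) : ℝ) ≤
        ((weight (K : List (Fin (n + 1))) - w : ℕ) : ℝ) + w := by
      exact_mod_cast le_tsub_add
    push_cast
    linarith
  have h2 : |G u K| ≤ C₂ * homNorm u ^ (α - w + weight (K : List (Fin (n + 1)))) := by
    refine (PiLp.norm_apply_le (G u) K).trans ((hG u hu).trans ?_)
    gcongr 1
    refine key _ (by positivity) ?_
    rw [Nat.cast_sub hw]
    linarith
  rw [PiLp.add_apply, add_mul]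
  exact (abs_add_le _ _).trans (by linarith)

end Remainder

/-! ### Existence of the charts and remainders -/

section Main

variable {n r p : ℕ} {α : ℝ} {B : Finset (List (Fin (n + 1)))}
  {X : Fin (n + 1) → EuclideanSpace ℝ (Fin p) → EuclideanSpace ℝ (Fin p)}
  {Y : Fin (n + 1) → EuclideanSpace ℝ B → EuclideanSpace ℝ B}

lemma HolderClassWith.lipschitz_of_succ {E F : Type} [NormedAddCommGroup E] [NormedSpace ℝ E]
    [NormedAddCommGroup F] [NormedSpace ℝ F] {C : ℝ} {k : ℕ} {s : Set E} (hs : IsOpen s)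
    (hsc : Convex ℝ s) {f : E → F} (hf : HolderClassWith C (k + 1) α s f) :
    ∀ x ∈ s, ∀ y ∈ s, ‖f x - f y‖ ≤ C * ‖x - y‖ := fun _ hx _ hy =>
  have h := (succ_iff hs).1 hf
  hsc.norm_image_sub_le_of_norm_fderiv_le
    (fun _ hz => h.2.1.differentiableAt (hs.mem_nhds hz)) (fun _ hz => h.2.2.bound hz) hy hx

lemma HasWeightGEWith.mono_const {C C' k : ℝ} (hC : C ≤ C') {U : Set (EuclideanSpace ℝ B)}
    {F : EuclideanSpace ℝ B → EuclideanSpace ℝ B} (h : HasWeightGEWith C k U F) :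
    HasWeightGEWith C' k U F := fun u hu J hJ =>
  (h u hu J hJ).trans (mul_le_mul_of_nonneg_right hC (Real.rpow_nonneg (homNorm_nonneg u) _))

/-- The remainder of the field `X_[I]` in the coordinates `Θ`. -/
def remainder (X : Fin (n + 1) → EuclideanSpace ℝ (Fin p) → EuclideanSpace ℝ (Fin p))
    (Y : Fin (n + 1) → EuclideanSpace ℝ B → EuclideanSpace ℝ B)
    (Θ : OpenPartialHomeomorph (EuclideanSpace ℝ (Fin p)) (EuclideanSpace ℝ B))
    (I : List (Fin (n + 1))) (u : EuclideanSpace ℝ B) : EuclideanSpace ℝ B :=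
  inCoords Θ (bracket X I) u - bracket Y I u

/-- Uniform regularity, weight and Hölder dependence on `y` of the remainders of `X_[I]` in the
coordinates `Θ y`. -/
def RemainderBounds (r : ℕ) (α : ℝ)
    (X : Fin (n + 1) → EuclideanSpace ℝ (Fin p) → EuclideanSpace ℝ (Fin p))
    (Y : Fin (n + 1) → EuclideanSpace ℝ B → EuclideanSpace ℝ B)
    (W : Set (EuclideanSpace ℝ (Fin p))) (U : Set (EuclideanSpace ℝ B))
    (Θ : EuclideanSpace ℝ (Fin p) →
      OpenPartialHomeomorph (EuclideanSpace ℝ (Fin p)) (EuclideanSpace ℝ B))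
    (I : List (Fin (n + 1))) (C : ℝ) : Prop :=
  (∀ y ∈ W, HolderClassWith C (r - weight I) α U (remainder X Y (Θ y) I) ∧
    HasWeightGEWith C (α - weight I) U (remainder X Y (Θ y) I)) ∧
  (∀ x ∈ W, ∀ y ∈ W, ∀ y' ∈ W,
    ‖remainder X Y (Θ y) I (Θ y x) - remainder X Y (Θ y') I (Θ y' x)‖ ≤ C * ‖y - y'‖ ^ α) ∧
  ∀ u ∈ U, ∀ y ∈ W, ∀ y' ∈ W, ‖remainder X Y (Θ y) I u - remainder X Y (Θ y') I u‖ ≤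
    C * ‖y - y'‖ ^ (if weight I < r then α else α ^ 2)

lemma RemainderBounds.mono_const {W : Set (EuclideanSpace ℝ (Fin p))} {U : Set (EuclideanSpace ℝ B)}
    {Θ : EuclideanSpace ℝ (Fin p) →
      OpenPartialHomeomorph (EuclideanSpace ℝ (Fin p)) (EuclideanSpace ℝ B)}
    {I : List (Fin (n + 1))} {C C' : ℝ} (hC : C ≤ C') (h : RemainderBounds r α X Y W U Θ I C) :
    RemainderBounds r α X Y W U Θ I C' :=
  ⟨fun y hy => ⟨(h.1 y hy).1.mono_const hC, (h.1 y hy).2.mono_const hC⟩,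
    fun x hx y hy y' hy' => (h.2.1 x hx y hy y' hy').trans (by gcongr),
    fun u hu y hy y' hy' => (h.2.2 u hu y hy y' hy').trans (by gcongr)⟩

/-- The charts `Θ y` for the fields `X` near `x₀`, and their Hölder dependence on `y`. -/
structure IsChartFamily (r : ℕ) (α C : ℝ)
    (X : Fin (n + 1) → EuclideanSpace ℝ (Fin p) → EuclideanSpace ℝ (Fin p))
    (Ω W : Set (EuclideanSpace ℝ (Fin p))) (U : Set (EuclideanSpace ℝ B))
    (Θ : EuclideanSpace ℝ (Fin p) →
      OpenPartialHomeomorph (EuclideanSpace ℝ (Fin p)) (EuclideanSpace ℝ B)) : Prop where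
  chart : ∀ y ∈ W, (Θ y).target = U ∧ W ⊆ (Θ y).source ∧ (Θ y).source ⊆ Ω ∧ Θ y y = 0 ∧
    ContDiffOn ℝ ∞ (Θ y) (Θ y).source ∧ ContDiffOn ℝ ∞ (Θ y).symm U ∧
    ∀ u ∈ U, IsExp (combination (approxField r X y) B u) y ((Θ y).symm u)
  holder : ∀ x ∈ W, ∀ y ∈ W, ∀ y' ∈ W, ‖Θ y x - Θ y' x‖ ≤ C * ‖y - y'‖ ^ α ∧
    ‖fderiv ℝ (Θ y) x - fderiv ℝ (Θ y') x‖ ≤ C * ‖y - y'‖ ^ α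

/-- The charts are those of the smooth family over jets, evaluated at the jet `q y`; estimates in
`q` become estimates in `y` by composition with the Hölder map `q`. -/
theorem exists_isChartFamily (hα₀ : 0 < α) (hα₁ : α ≤ 1) {Ω : Set (EuclideanSpace ℝ (Fin p))}
    (hΩ : IsOpen Ω) (hX : ∀ i, HolderClass (r - fieldWeight i) α Ω (X i))
    (hB : IsFreeBasis r B)
    {mul : EuclideanSpace ℝ B → EuclideanSpace ℝ B → EuclideanSpace ℝ B}
    (hY : IsFreeModel r B mul Y) {x₀ : EuclideanSpace ℝ (Fin p)} (hx₀ : x₀ ∈ Ω)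
    (hinv : (frameMap fun I : B => bracket (approxField r X x₀) I x₀).IsInvertible) :
    ∃ (W : Set (EuclideanSpace ℝ (Fin p))) (U : Set (EuclideanSpace ℝ B))
      (Θ : EuclideanSpace ℝ (Fin p) →
        OpenPartialHomeomorph (EuclideanSpace ℝ (Fin p)) (EuclideanSpace ℝ B)) (C : ℝ),
      IsOpen W ∧ x₀ ∈ W ∧ W ⊆ Ω ∧ IsOpen U ∧ 0 ∈ U ∧ IsChartFamily r α C X Ω W U Θ ∧
      ∀ I ∈ multiindices n r, RemainderBounds r α X Y W U Θ I C := by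
  obtain ⟨η₀, hη₀, hηΩ⟩ := Metric.isOpen_iff.1 hΩ x₀ hx₀
  set η := min η₀ (1 / 2) with hη
  have hη0 : 0 < η := by positivity
  set s := Metric.ball x₀ η with hs
  have hsΩ : s ⊆ Ω := (Metric.ball_subset_ball (min_le_left _ _)).trans hηΩ
  have hs1 : ∀ a ∈ s, ∀ b ∈ s, ‖a - b‖ ≤ 1 := fun a ha b hb => by
    rw [← dist_eq_norm]
    have h1 := (Metric.mem_ball.1 ha).trans_le (min_le_right _ _)
    have h2 := (Metric.mem_ball.1 hb).trans_le (min_le_right _ _)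
    linarith [dist_triangle_right a b x₀]
  have hXs : ∀ i, HolderClass (r - fieldWeight i) α s (X i) := fun i =>
    (hX i).imp fun _ h => h.mono_set hsΩ
  let π : Jets n r (EuclideanSpace ℝ (Fin p)) →L[ℝ] EuclideanSpace ℝ (Fin p) :=
    ContinuousLinearMap.snd ℝ _ _
  let q : EuclideanSpace ℝ (Fin p) → Jets n r (EuclideanSpace ℝ (Fin p)) := jetAt r X
  have hπq : ∀ y, π (q y) = y := fun _ => rfl
  obtain ⟨Ex, M, ε, C₀, δ, Θ, hε, hC₀, hδ, hδε, hfam, hfam', hΘ, hΘ'⟩ :=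
    exists_isExpFamily (n := n) (B := B) (Z := jetField (n := n) (r := r)) contDiff_jetField π
      (q₀ := q x₀) hB.weight_pos (by rw [jetField_jetAt]; exact hinv) hη0
  rw [hπq] at hΘ' hfam'
  set O := Metric.ball ((0 : EuclideanSpace ℝ B), q x₀) (2 * ε) with hO
  have hOsub : Metric.closedBall 0 ε ×ˢ Metric.closedBall (q x₀) ε ⊆ O := by
    rintro ⟨a, b⟩ ⟨ha, hb⟩
    rw [hO, Metric.mem_ball, Prod.dist_eq]
    exact max_lt (lt_of_le_of_lt ha (by linarith)) (lt_of_le_of_lt hb (by linarith))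
  obtain ⟨Cq, hCq, hq⟩ := exists_norm_jetAt_sub_le hα₁ hXs
  -- `W` is chosen so small that the jets of its points stay in the ball of parameters where the
  -- charts exist.
  have hqc : ∀ᶠ y in 𝓝 x₀, y ∈ s ∧ Cq * ‖y - x₀‖ ^ α < δ := by
    refine (Metric.isOpen_ball.eventually_mem (Metric.mem_ball_self hη0)).and ?_
    have h1 : Continuous fun y : EuclideanSpace ℝ (Fin p) => Cq * ‖y - x₀‖ ^ α :=
      continuous_const.mul ((by fun_prop : Continuous fun y : EuclideanSpace ℝ (Fin p) =>
        ‖y - x₀‖).rpow_const fun _ => Or.inr hα₀.le)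
    have h2 := h1.tendsto x₀
    rw [sub_self, norm_zero, Real.zero_rpow hα₀.ne', mul_zero] at h2
    exact h2.eventually_lt_const hδ
  obtain ⟨τ₀, hτ₀, hτ⟩ := Metric.eventually_nhds_iff_ball.1 hqc
  set W := Metric.ball x₀ (min τ₀ δ) with hW
  have hWs : W ⊆ s := fun y hy => (hτ y (Metric.ball_subset_ball (min_le_left _ _) hy)).1
  have hWδ : W ⊆ Metric.ball x₀ δ := Metric.ball_subset_ball (min_le_right _ _)
  have hqδ : ∀ y ∈ W, q y ∈ Metric.ball (q x₀) δ := fun y hy => by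
    have h1 := hτ y (Metric.ball_subset_ball (min_le_left _ _) hy)
    rw [Metric.mem_ball, dist_eq_norm]
    exact (hq y h1.1 x₀ (Metric.mem_ball_self hη0)
      (hs1 y h1.1 x₀ (Metric.mem_ball_self hη0))).trans_lt h1.2
  have hqε : ∀ y ∈ W, q y ∈ Metric.ball (q x₀) ε := fun y hy =>
    Metric.ball_subset_ball hδε (hqδ y hy)
  set U := Metric.ball (0 : EuclideanSpace ℝ B) ε with hU
  have h0U : (0 : EuclideanSpace ℝ B) ∈ U := Metric.mem_ball_self hε
  have hmem : ∀ y ∈ W, ∀ u ∈ U, (u, q y) ∈ O := fun y hy u hu =>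
    hOsub ⟨Metric.ball_subset_closedBall hu, Metric.ball_subset_closedBall (hqε y hy)⟩
  have hqW : ∀ y ∈ W, ∀ y' ∈ W, ‖q y - q y'‖ ≤ Cq * ‖y - y'‖ ^ α := fun y hy y' hy' =>
    hq y (hWs hy) y' (hWs hy') (hs1 y (hWs hy) y' (hWs hy'))
  have hsource : ∀ x ∈ W, ∀ y ∈ W, x ∈ (Θ (q y)).source := fun x hx y hy =>
    (hΘ' x (hWδ hx) (q y) (hqδ y hy)).1
  have hΘU : ∀ x ∈ W, ∀ y ∈ W, Θ (q y) x ∈ U := fun x hx y hy => by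
    have := (Θ (q y)).map_source (hsource x hx y hy)
    rwa [(hΘ (q y) (hqε y hy)).1] at this
  have hsymm0 : ∀ y ∈ W, (Θ (q y)).symm 0 = y := fun y hy => by
    rw [((hΘ (q y) (hqε y hy)).2.2.2 0 h0U).1]
    exact hfam.at_zero _ (hmem y hy 0 h0U)
  have hchart : IsChartFamily r α (C₀ * Cq) X Ω W U (fun y => Θ (q y)) := by
    refine ⟨fun y hy => ?_, fun x hx y hy y' hy' => ?_⟩
    · obtain ⟨ht, hc, hc', hu⟩ := hΘ (q y) (hqε y hy)
      refine ⟨ht, fun x hx => hsource x hx y hy, fun x hx => ?_, ?_, hc, hc', fun u hu' => ?_⟩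
      · have h1 := (Θ (q y)).map_source hx
        rw [ht] at h1
        rw [← (Θ (q y)).left_inv hx, (hu _ h1).1]
        exact hsΩ (hfam' _ (hmem y hy _ h1)).2.1
      · have h1 := (Θ (q y)).right_inv (x := 0) (by rw [ht]; exact h0U)
        rwa [hsymm0 y hy] at h1
      · have h1 : IsExp (combination (jetField (jetAt r X y)) B u) y (Ex (u, q y)) :=
          (hfam' _ (hmem y hy u hu')).1
        rw [jetField_jetAt] at h1
        rw [(hu u hu').1]
        exact h1
    · have h1 := (hΘ' x (hWδ hx) (q y) (hqδ y hy)).2 (q y') (hqδ y' hy')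
      have h2 := hqW y hy y' hy'
      constructor
      · calc _ ≤ C₀ * ‖q y - q y'‖ := h1.1
          _ ≤ C₀ * (Cq * ‖y - y'‖ ^ α) := by gcongr
          _ = _ := by ring
      · calc _ ≤ C₀ * ‖q y - q y'‖ := h1.2
          _ ≤ C₀ * (Cq * ‖y - y'‖ ^ α) := by gcongr
          _ = _ := by ring
  have hrem : ∀ y ∈ W, ∀ I, ∀ u ∈ U, remainder X Y (Θ (q y)) I u =
      M (u, q y) (bracket X I (Ex (u, q y))) - bracket Y I u := by
    intro y hy I u hu
    have h1 := (hΘ (q y) (hqε y hy)).2.2.2 u hu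
    rw [remainder, inCoords, h1.1, h1.2]
  have hbounds : ∀ I ∈ multiindices n r, ∃ C, RemainderBounds r α X Y W U (fun y => Θ (q y)) I C := by
    intro I hI
    have hExs : ∀ v ∈ O, Ex v ∈ s := fun v hv => (hfam' v hv).2.1
    have hN : ∀ u ∈ U, homNorm u ≤ 1 := fun u hu =>
      (hfam' (u, q x₀) (hmem x₀ (Metric.mem_ball_self (by positivity)) u hu)).2.2.1
    have hXI := holderClass_bracket Metric.isOpen_ball hXs hI
    obtain ⟨C₁, hC₁⟩ := hfam.exists_holderClassWith_coords hα₀ hα₁ hOsub Metric.isOpen_ball hExs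
      (L := C₀) (fun v hv v' hv' => ((hfam' v hv).2.2.2.2 v' hv').1) hXI
    obtain ⟨C₂, hC₂⟩ := exists_holderClassWith_of_contDiff (r - weight I) hα₀ hα₁
      (contDiff_bracket hY.smooth I) 0 hε.le
    obtain ⟨C₃, hC₃⟩ := exists_holderClassWith_of_contDiff 1 one_pos le_rfl
      (contDiff_bracket hY.smooth I) 0 hε.le
    obtain ⟨C₄, hC₄0, hC₄⟩ := exists_flatWith_bracket_sub hα₀.le (s := s) Metric.isOpen_ball
      (convex_ball _ _) hs1 hXs hI
    obtain ⟨C₅, hC₅0, hC₅⟩ := hfam.exists_abs_field_sub_le contDiff_jetField hB hY hε hOsub hN hI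
    obtain ⟨C₆, hC₆⟩ := hXI
    have hC₆0 : 0 ≤ C₆ := hC₆.nonneg (Metric.mem_ball_self hη0)
    have hC₃0 : 0 ≤ C₃ := hC₃.nonneg h0U
    have ht1 : ∀ y ∈ W, ∀ y' ∈ W, ‖y - y'‖ ≤ 1 := fun y hy y' hy' => hs1 y (hWs hy) y' (hWs hy')
    have hreg : ∀ y ∈ W, HolderClassWith (C₁ + C₂) (r - weight I) α U
        (remainder X Y (Θ (q y)) I) := fun y hy =>
      ((hC₁ (q y) (Metric.ball_subset_closedBall (hqε y hy))).sub Metric.isOpen_ball hC₂).congr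
        Metric.isOpen_ball fun u hu => hrem y hy I u hu
    obtain ⟨C₇, hweight⟩ : ∃ C, ∀ y ∈ W, HasWeightGEWith C (α - weight I) U
        (remainder X Y (Θ (q y)) I) := by
      refine ⟨C₀ * (C₄ * (C₀ * B.card) ^ (((r - weight I : ℕ) : ℝ) + α)) + C₅, fun y hy => ?_⟩
      have hF : ∀ u ∈ U, ∀ K : B, |(IsExpFamily.field jetField Ex M I (u, q y) - bracket Y I u) K| ≤
          C₅ * homNorm u ^ (1 + (weight (K : List (Fin (n + 1))) - weight I)) :=
        hC₅ (q y) (Metric.ball_subset_closedBall (hqε y hy))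
      -- Flatness is stated in the distance to `y`; the exponential map is Lipschitz and `|u|` is
      -- bounded by a multiple of the homogeneous norm, which converts it.
      have hG : ∀ u ∈ U, ‖M (u, q y) (bracket X I (Ex (u, q y)) -
          bracket (approxField r X y) I (Ex (u, q y)))‖ ≤
          C₀ * (C₄ * (C₀ * B.card) ^ (((r - weight I : ℕ) : ℝ) + α)) *
            homNorm u ^ (((r - weight I : ℕ) : ℝ) + α) := by
        intro u hu
        have hv := hfam' _ (hmem y hy u hu)
        have h1 : ‖Ex (u, q y) - y‖ ≤ C₀ * (B.card * homNorm u) := by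
          have h2 := (hv.2.2.2.2 _ (hmem y hy 0 h0U)).1
          rw [show Ex (0, q y) = y from hfam.at_zero _ (hmem y hy 0 h0U)] at h2
          refine h2.trans ?_
          gcongr
          refine le_trans (le_of_eq ?_) (norm_le_homNorm hB.weight_pos (hN u hu))
          simp [Prod.norm_def]
        have hN0 := homNorm_nonneg u
        calc _ ≤ ‖M (u, q y)‖ * ‖bracket X I (Ex (u, q y)) -
              bracket (approxField r X y) I (Ex (u, q y))‖ := ContinuousLinearMap.le_opNorm _ _
          _ ≤ C₀ * (C₄ * (C₀ * (B.card * homNorm u)) ^ (((r - weight I : ℕ) : ℝ) + α)) := by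
            gcongr
            · exact hv.2.2.2.1
            · refine ((hC₄ y (hWs hy)).bound (hExs _ (hmem y hy u hu))).trans ?_
              gcongr
          _ = _ := by
            rw [← mul_assoc C₀ (B.card : ℝ), Real.mul_rpow (by positivity) hN0]; ring
      have hw := hasWeightGEWith_add hα₀ hα₁ hC₅0 (by positivity) hI.2 hB.weight_le hN hF hG
      rw [add_comm C₅] at hw
      intro u hu J hJ
      have e : IsExpFamily.field jetField Ex M I (u, q y) =
          M (u, q y) (bracket (approxField r X y) I (Ex (u, q y))) := by
        change M (u, q y) (bracket (jetField (jetAt r X y)) I (Ex (u, q y))) = _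
        rw [jetField_jetAt]
      refine le_of_eq_of_le ?_ (hw u hu J hJ)
      rw [hrem y hy I u hu]
      refine congrArg (fun v : EuclideanSpace ℝ B => |v J|) ?_
      change _ = M (u, q y) (bracket X I (Ex (u, q y)) -
        bracket (approxField r X y) I (Ex (u, q y))) +
          (IsExpFamily.field jetField Ex M I (u, q y) - bracket Y I u)
      rw [e, map_sub]
      abel
    -- At a fixed point `x` the vector `X_[I](x)` does not move with `y`; only the smooth chart and
    -- the smooth model field do. No regularity of `X_[I]` is spent, so the exponent is `α` for
    -- every weight.
    have hx : ∀ x ∈ W, ∀ y ∈ W, ∀ y' ∈ W,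
        ‖remainder X Y (Θ (q y)) I (Θ (q y) x) - remainder X Y (Θ (q y')) I (Θ (q y') x)‖ ≤
          (C₀ * Cq * C₆ + C₃ * (C₀ * Cq)) * ‖y - y'‖ ^ α := by
      intro x hx y hy y' hy'
      have h1 := hchart.holder x hx y hy y' hy'
      have e : ∀ y ∈ W, remainder X Y (Θ (q y)) I (Θ (q y) x) =
          fderiv ℝ (Θ (q y)) x (bracket X I x) - bracket Y I (Θ (q y) x) := fun y hy => by
        rw [remainder, inCoords, (Θ (q y)).left_inv (hsource x hx y hy)]
      rw [e y hy, e y' hy', sub_sub_sub_comm, ← sub_apply, add_mul]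
      refine (norm_sub_le _ _).trans (add_le_add ?_ ?_)
      · calc _ ≤ _ := ContinuousLinearMap.le_opNorm _ _
          _ ≤ C₀ * Cq * ‖y - y'‖ ^ α * C₆ := by
            gcongr
            exacts [h1.2, hC₆.bound (hWs hx)]
          _ = _ := by ring
      · have h2 := ((HolderClassWith.succ_iff (k := 0) Metric.isOpen_ball).1 hC₃).1.holder
          (hΘU x hx y hy) (hΘU x hx y' hy')
        rw [Real.rpow_one] at h2
        calc _ ≤ _ := h2
          _ ≤ C₃ * (C₀ * Cq * ‖y - y'‖ ^ α) := by gcongr; exact h1.1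
          _ = _ := by ring
    have hdiff : ∀ u ∈ U, ∀ y ∈ W, ∀ y' ∈ W,
        remainder X Y (Θ (q y)) I u - remainder X Y (Θ (q y')) I u =
          M (u, q y) (bracket X I (Ex (u, q y))) - M (u, q y') (bracket X I (Ex (u, q y'))) := by
      intro u hu y hy y' hy'
      rw [hrem y hy I u hu, hrem y' hy' I u hu, sub_sub_sub_cancel_right]
    have hcoords : ∀ {β : ℝ}, 0 ≤ β →
        (∀ x ∈ s, ∀ y ∈ s, ‖bracket X I x - bracket X I y‖ ≤ C₆ * ‖x - y‖ ^ β) →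
        ∀ u ∈ U, ∀ y ∈ W, ∀ y' ∈ W,
          ‖remainder X Y (Θ (q y)) I u - remainder X Y (Θ (q y')) I u‖ ≤
            C₀ * C₆ * ‖q y - q y'‖ + C₀ * C₆ * C₀ ^ β * ‖q y - q y'‖ ^ β := by
      intro β hβ hXβ u hu y hy y' hy'
      rw [hdiff u hu y hy y' hy']
      exact norm_coords_sub_le (O := O) (fun v hv => (hfam' v hv).2.2.2.1)
        (fun v hv => (hfam' v hv).2.2.2.2) hExs hβ (fun x hx => hC₆.bound hx) hXβ
        (hmem y hy u hu) (hmem y' hy' u hu)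
    -- At fixed `u` the model terms cancel and the field is evaluated at a moving point. For `|I| <
    -- r` it is Lipschitz and the exponent `α` of the jets survives; for `|I| = r` it is only `C^α`,
    -- and two Hölder maps are composed.
    obtain ⟨C₈, hu⟩ : ∃ C, ∀ u ∈ U, ∀ y ∈ W, ∀ y' ∈ W,
        ‖remainder X Y (Θ (q y)) I u - remainder X Y (Θ (q y')) I u‖ ≤
          C * ‖y - y'‖ ^ (if weight I < r then α else α ^ 2) := by
      split_ifs with hIr
      · refine ⟨C₀ * C₆ * Cq + C₀ * C₆ * C₀ * Cq, fun u hu y hy y' hy' => ?_⟩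
        obtain ⟨k, hk⟩ : ∃ k, r - weight I = k + 1 := ⟨r - weight I - 1, by omega⟩
        rw [hk] at hC₆
        have hlip := hC₆.lipschitz_of_succ Metric.isOpen_ball (convex_ball _ _)
        have h1 := hcoords zero_le_one (by simpa only [Real.rpow_one] using hlip) u hu y hy y' hy'
        rw [Real.rpow_one, Real.rpow_one] at h1
        have h2 := hqW y hy y' hy'
        calc _ ≤ _ := h1
          _ ≤ C₀ * C₆ * (Cq * ‖y - y'‖ ^ α) + C₀ * C₆ * C₀ * (Cq * ‖y - y'‖ ^ α) := by gcongr
          _ = _ := by ring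
      · refine ⟨C₀ * C₆ * Cq + C₀ * C₆ * C₀ ^ α * Cq ^ α, fun u hu y hy y' hy' => ?_⟩
        have h1 := hcoords hα₀.le (fun x hx y hy => hC₆.holder hx hy) u hu y hy y' hy'
        have h2 := hqW y hy y' hy'
        have h3 : ‖y - y'‖ ^ α ≤ ‖y - y'‖ ^ (α ^ 2) :=
          Real.rpow_le_rpow_of_exponent_ge_of_imp (norm_nonneg _) (ht1 y hy y' hy')
            (by nlinarith) fun _ h => absurd h hα₀.ne'
        have h4 : ‖q y - q y'‖ ^ α ≤ Cq ^ α * ‖y - y'‖ ^ (α ^ 2) := by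
          calc _ ≤ (Cq * ‖y - y'‖ ^ α) ^ α := by gcongr
            _ = _ := by
              rw [Real.mul_rpow hCq (by positivity), ← Real.rpow_mul (norm_nonneg _), sq]
        calc _ ≤ _ := h1
          _ ≤ C₀ * C₆ * (Cq * ‖y - y'‖ ^ (α ^ 2)) +
              C₀ * C₆ * C₀ ^ α * (Cq ^ α * ‖y - y'‖ ^ (α ^ 2)) := by
            gcongr
            exact h2.trans (by gcongr)
          _ = _ := by ring
    refine ⟨max (max (C₁ + C₂) C₇) (max (C₀ * Cq * C₆ + C₃ * (C₀ * Cq)) C₈), fun y hy =>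
      ⟨(hreg y hy).mono_const ((le_max_left _ _).trans (le_max_left _ _)),
        (hweight y hy).mono_const ((le_max_right _ _).trans (le_max_left _ _))⟩,
      fun x hx' y hy y' hy' => (hx x hx' y hy y' hy').trans ?_,
      fun u hu' y hy y' hy' => (hu u hu' y hy y' hy').trans ?_⟩
    · gcongr
      exact (le_max_left _ _).trans (le_max_right _ _)
    · gcongr
      exact (le_max_right _ _).trans (le_max_right _ _)
  have := (finite_multiindices n r).to_subtype
  obtain ⟨C, hC, hCI⟩ := exists_uniform_bound (ι := multiindices n r)
    (P := fun I C => RemainderBounds r α X Y W U (fun y => Θ (q y)) I C)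
    (fun I C C' hCC h => h.mono_const hCC) fun I => hbounds I I.2
  refine ⟨W, U, fun y => Θ (q y), max (C₀ * Cq) C, Metric.isOpen_ball, Metric.mem_ball_self
    (by positivity), hWs.trans hsΩ, Metric.isOpen_ball, h0U, ⟨hchart.chart,
      fun x hx y hy y' hy' => ?_⟩, fun I hI => (hCI ⟨I, hI⟩).mono_const (le_max_right _ _)⟩
  have h1 := hchart.holder x hx y hy y' hy'
  exact ⟨h1.1.trans (by gcongr; exact le_max_left _ _),
    h1.2.trans (by gcongr; exact le_max_left _ _)⟩

end Main

end WeightedFields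

end

theorem mainTheorem2 (n p r : ℕ) (α : ℝ) (hr : 2 ≤ r) (hα₀ : 0 < α) (hα₁ : α ≤ 1)
    (Ω : Set (EuclideanSpace ℝ (Fin p))) (hΩ_open : IsOpen Ω) (hΩ_conn : IsConnected Ω)
    (hΩ_bdd : Bornology.IsBounded Ω)
    (X : Fin (n + 1) → EuclideanSpace ℝ (Fin p) → EuclideanSpace ℝ (Fin p))
    (hX : ∀ i, WeightedFields.HolderClass (r - WeightedFields.fieldWeight i) α Ω (X i))
    (hspan : ∀ x ∈ Ω, Submodule.span ℝ
      ((fun I => WeightedFields.bracket X I x) '' WeightedFields.multiindices n r) = ⊤)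
    (hfree : ∀ x ∈ Ω, WeightedFields.IsFreeAt X r x)
    (B : Finset (List (Fin (n + 1))))
    (hBr : (B : Set (List (Fin (n + 1)))) ⊆ WeightedFields.multiindices n r)
    (hB : ∃ x ∈ Ω, LinearIndependent ℝ (fun I : B => WeightedFields.bracket X I x) ∧
      Submodule.span ℝ (Set.range fun I : B => WeightedFields.bracket X I x) = ⊤) :
    ∃ (mul : EuclideanSpace ℝ B → EuclideanSpace ℝ B → EuclideanSpace ℝ B)
      (Y : Fin (n + 1) → EuclideanSpace ℝ B → EuclideanSpace ℝ B),
      WeightedFields.IsFreeModel r B mul Y ∧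
      ∀ x₀ ∈ Ω, ∃ (W : Set (EuclideanSpace ℝ (Fin p))) (U : Set (EuclideanSpace ℝ B))
        (Θ : EuclideanSpace ℝ (Fin p) →
          OpenPartialHomeomorph (EuclideanSpace ℝ (Fin p)) (EuclideanSpace ℝ B))
        (R : EuclideanSpace ℝ (Fin p) → List (Fin (n + 1)) →
          EuclideanSpace ℝ B → EuclideanSpace ℝ B)
        (C : ℝ),
        IsOpen W ∧ x₀ ∈ W ∧ W ⊆ Ω ∧ IsOpen U ∧ 0 ∈ U ∧
        -- `Θ y` is a smooth diffeomorphism, inverse to the regularized exponential map at `y`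
        (∀ y ∈ W, (Θ y).target = U ∧ W ⊆ (Θ y).source ∧ (Θ y).source ⊆ Ω ∧ Θ y y = 0 ∧
          ContDiffOn ℝ ∞ (Θ y) (Θ y).source ∧ ContDiffOn ℝ ∞ (Θ y).symm U ∧
          ∀ u ∈ U, WeightedFields.IsExp
            (WeightedFields.combination (WeightedFields.approxField r X y) B u) y
            ((Θ y).symm u)) ∧
        -- `Θ y` and its Jacobian depend on `y` in a Hölder continuous way
        (∀ x ∈ W, ∀ y ∈ W, ∀ y' ∈ W,
          ‖Θ y x - Θ y' x‖ ≤ C * ‖y - y'‖ ^ α ∧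
          ‖fderiv ℝ (Θ y) x - fderiv ℝ (Θ y') x‖ ≤ C * ‖y - y'‖ ^ α) ∧
        ∀ I ∈ WeightedFields.multiindices n r,
          -- the approximation formula, in the coordinates `u` and in the original variables
          (∀ y ∈ W, ∀ u ∈ U, WeightedFields.inCoords (Θ y) (WeightedFields.bracket X I) u =
            WeightedFields.bracket Y I u + R y I u) ∧
          (∀ y ∈ W, ∀ f : EuclideanSpace ℝ B → ℝ, DifferentiableOn ℝ f U →
            ∀ x ∈ (Θ y).source,
              WeightedFields.act (WeightedFields.bracket X I) (f ∘ Θ y) x =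
                WeightedFields.act (WeightedFields.bracket Y I) f (Θ y x) +
                WeightedFields.act (R y I) f (Θ y x)) ∧
          -- regularity and weight of the remainder
          (∀ y ∈ W,
            WeightedFields.HolderClassWith C (r - WeightedFields.weight I) α U (R y I) ∧
            WeightedFields.HasWeightGEWith C (α - WeightedFields.weight I) U (R y I)) ∧
          -- Hölder dependence of the remainder on `y`, at a fixed point `x` and at a fixed `u`
          (∀ x ∈ W, ∀ y ∈ W, ∀ y' ∈ W,
            ‖R y I (Θ y x) - R y' I (Θ y' x)‖ ≤ C * ‖y - y'‖ ^ α) ∧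
          (∀ u ∈ U, ∀ y ∈ W, ∀ y' ∈ W,
            ‖R y I u - R y' I u‖ ≤
              C * ‖y - y'‖ ^ (if WeightedFields.weight I < r then α else α ^ 2)) := by
  obtain ⟨x, hx, hli, hsp⟩ := hB
  have hfb : WeightedFields.IsFreeBasis r B :=
    WeightedFields.isFreeBasis_of_isFreeAt hα₀ hΩ_open hX hx (hfree x hx) hBr hli hsp
  have hcard : B.card = p := by
    have h := Module.finrank_eq_card_basis (Module.Basis.mk hli hsp.ge)
    simpa using h.symm
  obtain ⟨mul, Y, hY⟩ := hfb.exists_isFreeModel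
  refine ⟨mul, Y, hY, fun x₀ hx₀ => ?_⟩
  obtain ⟨W, U, Θ, C, hW, hxW, hWΩ, hU, h0U, hΘ, hR⟩ :=
    WeightedFields.exists_isChartFamily hα₀ hα₁ hΩ_open hX hfb hY hx₀
      (WeightedFields.isInvertible_frameMap hα₀ hΩ_open hX hfb hcard hx₀ (hspan x₀ hx₀))
  refine ⟨W, U, Θ, fun y I => WeightedFields.remainder X Y (Θ y) I, C, hW, hxW, hWΩ, hU, h0U,
    hΘ.chart, hΘ.holder, fun I hI => ⟨fun y _ u _ => ?_, fun y hy f hf x hx => ?_, hR I hI⟩⟩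
  · simp only [WeightedFields.remainder, add_sub_cancel]
  -- The form in the original variables is the chain rule for `f ∘ Θ y`.
  · obtain ⟨ht, -, -, -, hd, -⟩ := hΘ.chart y hy
    have h1 : DifferentiableAt ℝ (Θ y) x :=
      (hd.contDiffAt ((Θ y).open_source.mem_nhds hx)).differentiableAt (by simp)
    have h2 : DifferentiableAt ℝ f (Θ y x) :=
      hf.differentiableAt (hU.mem_nhds (ht ▸ (Θ y).map_source hx))
    simp only [WeightedFields.act, WeightedFields.remainder, ← map_add, add_sub_cancel,
      WeightedFields.inCoords, (Θ y).left_inv hx]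
    rw [fderiv_comp x h2 h1]
    rfl
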